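/- **Setting.** Let $G=GL(2,\mathbb C)$, $\overline G=G/Z$, which is the quotient of $SL(2,\mathbb C)$ by $\pm1$, and $K=SU(2)$ with Haar probability measure $dk$. Put $a(y)=\mathrm{diag}(y,1)$ and $n(x)=\begin{pmatrix}1&x\\0&1\end{pmatrix}$. On $\mathbb R^+$ let $dy^\times=dy/y$. Let $d\overline g$ be the Haar measure $y^{-2}\,dx\,dy^\times\,dk$ in the coordinates $\overline g=n(x)a(y)k$ ($x\in\mathbb C$, $y>0$), with $dx$ Lebesgue measure; it pushes forward to the hyperbolic measure on $\mathbb H^3$. Let $\psi(z)=\exp(2\pi i(z+\bar z))$. Let $\rho_k$ be the irreducible unitary representation of $K$ of dimension $k+1$, with the orthonormal basis of weight vectors $v_{k-2j}=i^j\binom kj^{1/2}X^{k-j}Y^j$, $0\le j\le k$ (binary forms of degree $k$, $\kappa=\begin{pmatrix}a&b\\c&d\end{pmatrix}$ acting by $X\mapsto aX+cY$, $Y\mapsto bX+dY$). For an integer $k\ge0$ and $r\in\mathbb R$, the representation of weight $k$ and spectral parameter $r$ is the one unitarily induced from $\mathrm{diag}(z,z^{-1})\mapsto(z/|z|)^k|z|^{2ir}$.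 In its induced model, with inner product $\int_K f_1\overline{f_2}\,dk$, a vector $v$ of the minimal $K$-type $\rho_k$ is the function $f_v(n(x)a(y)\kappa)=(k+1)^{1/2}y^{1+ir}\langle\rho_k(\kappa)v,v_k\rangle$. Its Whittaker embedding $W$ into the Whittaker model for $\psi$ is the multiple of $v\mapsto W(g)(v)=\lim_{R\to\infty}\int_{|x|\le R}f_v\!\left(\begin{pmatrix}0&-1\\1&0\end{pmatrix}n(x)g\right)\overline{\psi(x)}\,dx$ that is unitary for $\langle W,W'\rangle=\int_0^\infty W(a(y))\overline{W'(a(y))}\,dy^\times$ and satisfies $W(a(y))(v_k)>0$ for all large $y$. Let $I$ have weight $k\ge0$ and spectral parameter $0$, with $v_{\pm k}\in\rho_k\subset I$. Let $I'$ have weight $0$ and spectral parameter $r'\in\mathbb R$, with unit $K$-fixed vector $u$. Let $W_1$ and $W_2$ be the Whittaker embeddings of $u\in I'$ and of $\rho_k\subset I$, let $f=f_{v_k}$ be $v_k$ in the induced model of $I$, and $f'$ be $u$ in the induced model of $I'$, so $f'(n(x)a(y)\kappa)=y^{1+ir'}$. Let $K_\nu$ be the modified Bessel function and $$\mathbf W_2(y)=y^{k/2+1}\sum_{j=0}^k\tbinom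 kj^{1/2}K_{k/2-j}(4\pi y)\,v_{k-2j}.$$ Define $$\mathcal S=\int_{\overline G}\langle gv_k,v_k\rangle\langle gv_{-k},v_{-k}\rangle\langle gu,u\rangle\,d\overline g,$$ $$\mathcal T_1=\int_0^\infty\!\!\int_K W_1(a(y)\kappa)(u)\,\overline{W_2(a(y)\kappa)(v_k)}\,f(a(y)\kappa)\,y^{-2}\,dy^\times d\kappa,$$ $$\mathcal T_2=32\pi^2\,\frac{(2\pi)^k}{\Gamma(\frac k2+1)^2}\int_0^\infty y^{1+ir'}\,|\mathbf W_2(y)|^2\,y^{-2}\,dy^\times .$$ **Theorem.** For every integer $k\ge0$ and every $r'\in\mathbb R$, the Whittaker embeddings $W_1,W_2$ exist and are unique, all the integrals above and in 4 converge absolutely, and the following hold. 1. For $y>0$, $\kappa\in K$, $v\in\rho_k$: $W_1(a(y)\kappa)(u)=4\sqrt2\,\pi\,|\Gamma(1+ir')|^{-1}\,y\,K_{ir'}(4\pi y)$ and $W_2(a(y)\kappa)(v)=4\sqrt2\,\pi\,\dfrac{(2\pi)^{k/2}(k+1)^{1/2}}{\Gamma(1+k/2)}\,\langle\rho_k(\kappa)v,\mathbf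 W_2(y)\rangle$. 2. $\displaystyle \mathcal T_1=2\pi\cdot\frac{\Gamma\!\left(\frac{1+k+ir'}2\right)\Gamma\!\left(\frac{1+k-ir'}2\right)\Gamma\!\left(\frac{1+ir'}2\right)\Gamma\!\left(\frac{1-ir'}2\right)}{\Gamma(1+\frac k2)^2\,|\Gamma(1+ir')|}.$ 3. $\displaystyle \mathcal S=\frac1{8\pi}\,|\mathcal T_1|^2$, so that $\mathcal T_1$ determines $\mathcal S$. 4. $\displaystyle \mathcal T_2=\int_0^\infty\!\!\int_K W_2(a(y)\kappa)(v_k)\,\overline{W_2(a(y)\kappa)(v_k)}\,f'(a(y)\kappa)\,y^{-2}\,dy^\times d\kappa$, and $|\mathcal T_2|=|\mathcal T_1|$. -/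

import Mathlib

open MeasureTheory Filter Topology
open scoped ComplexConjugate

namespace TripleWeight

/-! ## The groups `K = SU(2)` and `SL(2, ℂ)`

`Ḡ = GL(2, ℂ) / Z` is the quotient of `SL(2, ℂ)` by `± 1`; an element of `Ḡ` is written through
a representative in `SL(2, ℂ)`. -/

/-- The maximal compact subgroup `K = SU(2)`. -/
abbrev SU2 : Type := Matrix.specialUnitaryGroup (Fin 2) ℂ

/-- The group `SL(2, ℂ)`. -/
abbrev SL2 : Type := Matrix.SpecialLinearGroup (Fin 2) ℂ

noncomputable instance : MeasurableSpace SU2 := borel SU2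

instance : BorelSpace SU2 := ⟨rfl⟩

instance : IsTopologicalGroup SU2 where
  continuous_mul := continuous_mul
  continuous_inv := by
    refine Continuous.subtype_mk (f := fun x : SU2 => star x.1) ?_ _
    exact continuous_star.comp continuous_subtype_val

instance : CompactSpace SU2 := by
  apply isCompact_iff_compactSpace.1
  have hK : IsCompact (Set.univ.pi (fun _ : Fin 2 => Set.univ.pi
      (fun _ : Fin 2 => Metric.closedBall (0 : ℂ) 1))) :=
    isCompact_univ_pi fun _ => isCompact_univ_pi fun _ => isCompact_closedBall _ _
  refine IsCompact.of_isClosed_subset (X := Matrix (Fin 2) (Fin 2) ℂ) hK ?_ ?_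
  · have h : ((Matrix.specialUnitaryGroup (Fin 2) ℂ : Submonoid _) :
        Set (Matrix (Fin 2) (Fin 2) ℂ)) = {A | A * star A = 1} ∩ {A | A.det = 1} := by
      ext A
      simp [Matrix.mem_specialUnitaryGroup_iff, Matrix.mem_unitaryGroup_iff]
    rw [h]
    refine IsClosed.inter ?_ ?_
    · exact isClosed_eq (by fun_prop) continuous_const
    · exact isClosed_eq (Continuous.matrix_det continuous_id) continuous_const
  · intro A hA i _ j _
    have := entry_norm_bound_of_unitary (Matrix.mem_specialUnitaryGroup_iff.1 hA).1 i j
    simpa using this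

/-- The Haar probability measure `dk` on `K`. -/
noncomputable def haarK : Measure SU2 :=
  Measure.haarMeasure (⊤ : TopologicalSpace.PositiveCompacts SU2)

/-- The inclusion of `K` in `SL(2, ℂ)`. -/
def toSL (κ : SU2) : SL2 :=
  ⟨κ.1, (Matrix.mem_specialUnitaryGroup_iff.1 κ.2).2⟩

/-- `n(x)`, the upper triangular unipotent matrix with upper right entry `x`. -/
def unip (x : ℂ) : SL2 :=
  ⟨!![1, x; 0, 1], by simp [Matrix.det_fin_two]⟩

/-- `a(y)` for `y > 0`: in `Ḡ` the class of `diag(y, 1)` is the class of `diag(√y, 1/√y)`.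
(Only used for `y > 0`.) -/
noncomputable def torus (y : ℝ) : SL2 :=
  if h : 0 < y then
    ⟨!![((√y : ℝ) : ℂ), 0; 0, ((√y : ℝ) : ℂ)⁻¹], by
      have : ((√y : ℝ) : ℂ) ≠ 0 := by exact_mod_cast (Real.sqrt_pos.2 h).ne'
      simp [Matrix.det_fin_two, this]⟩
  else 1

/-- The Weyl element. -/
def weyl : SL2 :=
  ⟨!![0, -1; 1, 0], by simp [Matrix.det_fin_two]⟩

/-- The length of the bottom row of `g`. -/
noncomputable def rowNorm (g : SL2) : ℝ :=
  √(‖g.1 1 0‖ ^ 2 + ‖g.1 1 1‖ ^ 2)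

theorem rowNorm_pos (g : SL2) : 0 < rowNorm g := by
  apply Real.sqrt_pos.2
  have hd := g.2
  rw [Matrix.det_fin_two] at hd
  by_cases h0 : g.1 1 0 = 0
  · have h1 : g.1 1 1 ≠ 0 := by
      intro h1
      rw [h0, h1] at hd
      simp at hd
    have := norm_pos_iff.2 h1
    positivity
  · have := norm_pos_iff.2 h0
    positivity

theorem rowNorm_sq (g : SL2) :
    g.1 1 0 * conj (g.1 1 0) + g.1 1 1 * conj (g.1 1 1) = (rowNorm g : ℂ) ^ 2 := by
  rw [Complex.mul_conj, Complex.mul_conj, Complex.normSq_eq_norm_sq, Complex.normSq_eq_norm_sq]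
  have : rowNorm g ^ 2 = ‖g.1 1 0‖ ^ 2 + ‖g.1 1 1‖ ^ 2 := Real.sq_sqrt (by positivity)
  exact_mod_cast this.symm

/-- The height `y` in the Iwasawa decomposition `g = n(x) a(y) κ` with `y > 0`, `κ ∈ K`. -/
noncomputable def height (g : SL2) : ℝ := (rowNorm g ^ 2)⁻¹

/-- The component `κ` in the Iwasawa decomposition `g = n(x) a(y) κ` with `y > 0`, `κ ∈ K`. -/
noncomputable def kPart (g : SL2) : SU2 :=
  ⟨!![conj (g.1 1 1) / (rowNorm g : ℂ), -conj (g.1 1 0) / (rowNorm g : ℂ);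
      g.1 1 0 / (rowNorm g : ℂ), g.1 1 1 / (rowNorm g : ℂ)], by
    have hp := rowNorm_pos g
    have h0 : ((rowNorm g : ℝ) : ℂ) ≠ 0 := by exact_mod_cast hp.ne'
    have hs := rowNorm_sq g
    rw [Matrix.mem_specialUnitaryGroup_iff, Matrix.mem_unitaryGroup_iff]
    constructor
    · ext i j
      fin_cases i <;> fin_cases j <;>
        simp [Matrix.mul_apply, Matrix.star_apply, Fin.sum_univ_two] <;>
        field_simp <;> first | linear_combination hs | linear_combination -hs | ring
    · rw [Matrix.det_fin_two]
      simp
      field_simp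
      linear_combination hs⟩

/-- The Iwasawa decomposition, with the components defined above. -/
theorem iwasawa (g : SL2) : ∃ x : ℂ, g = unip x * torus (height g) * toSL (kPart g) := by
  have hp := rowNorm_pos g
  have h0 : ((rowNorm g : ℝ) : ℂ) ≠ 0 := by exact_mod_cast hp.ne'
  have hs : g.1 1 0 * conj (g.1 1 0) + g.1 1 1 * conj (g.1 1 1) = (rowNorm g : ℂ) ^ 2 :=
    rowNorm_sq g
  have hd := g.2
  rw [Matrix.det_fin_two] at hd
  have hh : 0 < height g := by unfold height; positivity
  have hsq : √(height g) = (rowNorm g)⁻¹ := by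
    unfold height
    rw [← inv_pow, Real.sqrt_sq (by positivity)]
  refine ⟨(g.1 0 0 * conj (g.1 1 0) + g.1 0 1 * conj (g.1 1 1)) / (rowNorm g : ℂ) ^ 2, ?_⟩
  ext i j
  rw [Matrix.SpecialLinearGroup.coe_mul, Matrix.SpecialLinearGroup.coe_mul]
  fin_cases i <;> fin_cases j <;>
    simp [unip, torus, hh, hsq, toSL, kPart, Matrix.mul_apply, Fin.sum_univ_two] <;>
    field_simp
  · linear_combination (-g.1 0 0) * hs + conj (g.1 1 1) * hd
  · linear_combination (-g.1 0 1) * hs - conj (g.1 1 0) * hd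

/-! ## Measures -/

/-- The measure `dy^× = dy / y` on the positive half line. -/
noncomputable def mulHaar : Measure ℝ :=
  (volume.restrict (Set.Ioi 0)).withDensity fun y => ENNReal.ofReal y⁻¹

/-- The Haar measure `dḡ = y⁻² dx dy^× dk` of `Ḡ` in the coordinates `g = n(x) a(y) κ`, where
`dx` is Lebesgue measure on `ℂ`.  (The angular variable of `a(y)`, `y ∈ ℂ^×`, is absorbed in `K`.)
The push-forward to hyperbolic 3-space is the hyperbolic volume. -/
noncomputable def haarG : Measure (ℂ × ℝ × SU2) :=
  (volume : Measure ℂ).prod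
    ((mulHaar.withDensity fun y => ENNReal.ofReal (y ^ 2)⁻¹).prod haarK)

/-- The element `n(x) a(y) κ` with coordinates `(x, y, κ)`. -/
noncomputable def ofCoords (p : ℂ × ℝ × SU2) : SL2 :=
  unip p.1 * torus p.2.1 * toSL p.2.2

/-! ## The representation `ρ_k` of `K` -/

/-- The `(i, j)` matrix coefficient `⟨ρ_k(κ) v_{k-2j}, v_{k-2i}⟩` of the irreducible representation
`ρ_k` of `K = SU(2)` of dimension `k + 1`.  Here `ρ_k` is the space of binary forms of degree `k`,
where `κ = (a b; c d)` acts by `X ↦ a X + c Y`, `Y ↦ b X + d Y`, with the invariant inner product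
for which the weight vectors `v_{k-2j} = i ^ j (k choose j) ^ (1/2) X ^ (k-j) Y ^ j` are an
orthonormal basis; `diag(e^{iθ}, e^{-iθ})` acts on `v_t` by `e^{itθ}`.  In the formula,
a form is dehomogenised by `X = 1`, so that the variable of the polynomial is `Y`. -/
noncomputable def rho (k : ℕ) (κ : SU2) (i j : Fin (k + 1)) : ℂ :=
  (Complex.I ^ (j : ℕ) * ((√(k.choose j) : ℝ) : ℂ)) /
      (Complex.I ^ (i : ℕ) * ((√(k.choose i) : ℝ) : ℂ)) *
    ((Polynomial.C (κ.1 0 0) + Polynomial.C (κ.1 1 0) * Polynomial.X) ^ (k - (j : ℕ)) *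
      (Polynomial.C (κ.1 0 1) + Polynomial.C (κ.1 1 1) * Polynomial.X) ^ (j : ℕ)).coeff i

/-! ## Induced representations of weight `k` and spectral parameter `r` -/

/-- The extension of a function `φ` on `K` to `SL(2, ℂ)` in the induced model:
`f(n(x) a(y) κ) = y ^ (1 + ir) φ(κ)`. -/
noncomputable def inducedExt (r : ℝ) (φ : SU2 → ℂ) (g : SL2) : ℂ :=
  (height g : ℂ) ^ (1 + Complex.I * r) * φ (kPart g)

/-- The vector `v_{k-2j}` of the minimal `K`-type `ρ_k` of the representation `I` of weight `k` and
spectral parameter `r`, in the induced model with norm `∫_K |f(κ)|² dκ`: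
its restriction to `K` is `(k + 1) ^ (1/2) ⟨ρ_k(κ) v_{k-2j}, v_k⟩`. -/
noncomputable def inducedVec (k : ℕ) (r : ℝ) (j : Fin (k + 1)) : SL2 → ℂ :=
  inducedExt r fun κ => ((√(k + 1 : ℝ) : ℝ) : ℂ) * rho k κ 0 j

/-- The diagonal matrix coefficient `⟨g f, f⟩` in the induced model, `G` acting by right
translation. -/
noncomputable def matCoeff (f : SL2 → ℂ) (g : SL2) : ℂ :=
  ∫ κ, f (toSL κ * g) * conj (f (toSL κ)) ∂haarK

/-! ## Whittaker models -/

/-- The additive character `ψ(z) = exp(2πi tr z)` of `ℂ`. -/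
noncomputable def addChar (z : ℂ) : ℂ :=
  Complex.exp (2 * Real.pi * Complex.I * (z + conj z))

/-- The Jacquet integral `∫ f(w n(x) g) ψ(x)⁻¹ dx`, truncated to `|x| ≤ R`. -/
noncomputable def jacquetTrunc (f : SL2 → ℂ) (g : SL2) (R : ℝ) : ℂ :=
  ∫ x in Metric.closedBall (0 : ℂ) R, f (weyl * unip x * g) * conj (addChar x)

/-- `W`, with `W j` the function attached to `v_{k-2j}`, is the normalised Whittaker embedding of
the minimal `K`-type `ρ_k` of the representation of weight `k` and spectral parameter `r` in its
Whittaker model with respect to `ψ`.  That is, `W` is the restriction to `ρ_k` of a multiple of the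
intertwining map from the induced model given by the (conditionally convergent) Jacquet integral;
it is unitary for `⟨W, W'⟩ = ∫_{ℝ⁺} W(a(y)) conj W'(a(y)) dy^×`, and its phase is
fixed by `W(a(y))(v_k) > 0` for large `y`. -/
def IsWhittakerEmbedding (k : ℕ) (r : ℝ) (W : Fin (k + 1) → SL2 → ℂ) : Prop :=
  ∃ c : ℂ,
    (∀ j g, Tendsto (fun R : ℝ => c * jacquetTrunc (inducedVec k r j) g R) atTop (𝓝 (W j g))) ∧
    ∫ y, ‖W 0 (torus y)‖ ^ 2 ∂mulHaar = 1 ∧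
    ∀ᶠ y : ℝ in atTop, ∃ t : ℝ, 0 < t ∧ W 0 (torus y) = t

/-- The modified Bessel function `K_ν(x) = ∫_0^∞ exp(-x cosh t) cosh(νt) dt`, `x > 0`. -/
noncomputable def besselK (ν : ℂ) (x : ℝ) : ℂ :=
  ∫ t in Set.Ioi (0 : ℝ), (Real.exp (-x * Real.cosh t) : ℂ) * Complex.cosh (ν * t)

/-- The `ρ_k`-valued function
`𝐖₂(y) = y ^ (k/2 + 1) ∑_j (k choose j) ^ (1/2) K_{k/2 - j}(4πy) v_{k-2j}`, in coordinates. -/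
noncomputable def boldW (k : ℕ) (y : ℝ) : EuclideanSpace ℂ (Fin (k + 1)) :=
  WithLp.toLp 2 fun j => ((y ^ ((k : ℝ) / 2 + 1) * √(k.choose j) : ℝ) : ℂ) *
    besselK ((k : ℂ) / 2 - (j : ℕ)) (4 * Real.pi * y)

/-! ## The triple product integrals

`k` is the weight of `I`, whose spectral parameter is `0`, and `r'` is the spectral parameter of the
spherical representation `I'`. -/

/-- The integrand `⟨g v_k, v_k⟩ ⟨g v_{-k}, v_{-k}⟩ ⟨g u, u⟩`. -/
noncomputable def integrandS (k : ℕ) (r' : ℝ) (p : ℂ × ℝ × SU2) : ℂ :=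
  matCoeff (inducedVec k 0 0) (ofCoords p) *
    matCoeff (inducedVec k 0 (Fin.last k)) (ofCoords p) *
    matCoeff (inducedVec 0 r' 0) (ofCoords p)

/-- `𝒮 = ∫_Ḡ ⟨g v_k, v_k⟩ ⟨g v_{-k}, v_{-k}⟩ ⟨g u, u⟩ dḡ`. -/
noncomputable def tripleS (k : ℕ) (r' : ℝ) : ℂ :=
  ∫ p, integrandS k r' p ∂haarG

/-- The integrand `A(a(y) κ) conj B(a(y) κ) f(a(y) κ) y⁻²` of a Whittaker triple integral. -/
noncomputable def whittakerIntegrand (A B f : SL2 → ℂ) (p : ℝ × SU2) : ℂ :=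
  A (torus p.1 * toSL p.2) * conj (B (torus p.1 * toSL p.2)) * f (torus p.1 * toSL p.2) *
    (((p.1 ^ 2)⁻¹ : ℝ) : ℂ)

/-- `∫_0^∞ ∫_K A(a(y) κ) conj B(a(y) κ) f(a(y) κ) y⁻² dy^× dκ`. -/
noncomputable def whittakerTriple (A B f : SL2 → ℂ) : ℂ :=
  ∫ p, whittakerIntegrand A B f p ∂(mulHaar.prod haarK)

/-- `𝒯₁ = ∫_0^∞ ∫_K W₁(a(y) κ)(u) conj (W₂(a(y) κ)(v_k)) f(a(y) κ) y⁻² dy^× dκ`, where `f` is `v_k`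
in the induced model of `I`. -/
noncomputable def tripleT1 (k : ℕ) (W₁ : Fin (0 + 1) → SL2 → ℂ) (W₂ : Fin (k + 1) → SL2 → ℂ) : ℂ :=
  whittakerTriple (W₁ 0) (W₂ 0) (inducedVec k 0 0)

/-- The integrand `y ^ (1 + ir') |𝐖₂(y)|² y⁻²`. -/
noncomputable def integrandT2 (k : ℕ) (r' : ℝ) (y : ℝ) : ℂ :=
  (y : ℂ) ^ (1 + Complex.I * r') * ((‖boldW k y‖ ^ 2 : ℝ) : ℂ) * (((y ^ 2)⁻¹ : ℝ) : ℂ)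

/-- `𝒯₂ = 32π² · (2π)^k / Γ(k/2 + 1)² · ∫_0^∞ y ^ (1 + ir') |𝐖₂(y)|² y⁻² dy^×`.  The factor `32π²` is
the absolute constant that belongs to unit Whittaker vectors. -/
noncomputable def tripleT2 (k : ℕ) (r' : ℝ) : ℂ :=
  ((32 * Real.pi ^ 2 * ((2 * Real.pi) ^ k / Real.Gamma ((k : ℝ) / 2 + 1) ^ 2) : ℝ) : ℂ) *
    ∫ y, integrandT2 k r' y ∂mulHaar

/-- `Γ((1+k±ir')/2) Γ((1±ir')/2) / (Γ(1+k/2)² |Γ(1+ir')|)`, products over both signs. -/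
noncomputable def gammaRatio (k : ℕ) (r' : ℝ) : ℂ :=
  Complex.Gamma ((1 + k + Complex.I * r') / 2) * Complex.Gamma ((1 + k - Complex.I * r') / 2) *
      (Complex.Gamma ((1 + Complex.I * r') / 2) * Complex.Gamma ((1 - Complex.I * r') / 2)) /
    ((Real.Gamma (1 + (k : ℝ) / 2) ^ 2 * ‖Complex.Gamma (1 + Complex.I * r')‖ : ℝ) : ℂ)

end TripleWeight

open TripleWeight

/-!
The Whittaker functions are modified Bessel functions, and everything is computed from them.

*Whittaker embeddings.* In terms of the bottom row `(c, d)` of `g`, a vector of the minimal `K`-type is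
a monomial in `c̄`, `d̄` times a power of `|c|² + |d|²` (`inducedVec_eq_rowVec`).  On the unipotent
orbit of the Weyl element the Jacquet integral is therefore the Fourier integral of
`x̄ ^ m (|x|² + y²) ^ (-s)`.  This function is a superposition of the functions
`x̄ ^ m exp(-t |x|²)`, whose Fourier transforms are again Gaussians (`fourier_conjGauss`), and
integrating these in `t` gives a Bessel function (`besselKernel`).  The integral converges only
conditionally when `m = k`; there the truncated integrals are dominated, uniformly in the truncation, by
comparing a disc with its translate by a half period of the character (`tendsto_truncated_fourier`).
The `L²` norm on the torus is a Mellin transform of a product of two Bessel functions, so unitarity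
fixes the modulus of the normalising constant, and positivity fixes its phase
(`existsUnique_isWhittakerEmbedding`).

*The Whittaker integrals.* Schur orthogonality on `K` (`integral_prod_sum_mul_rho`) reduces
`whittakerTriple` to integrals over the torus, each of them a Mellin transform of `K_μ K_ν`
(`mellin_besselK_mul_besselK`).  For `𝒯₁` a single term survives; for `𝒯₂` the sum over the weights is a
Vandermonde identity for Gamma functions (`sum_choose_mul_Gamma_mul_Gamma`).  In the
numerator of `𝒯₂` each Gamma factor is squared where in `𝒯₁` it is multiplied by its complex conjugate,
so `|𝒯₁| = |𝒯₂|`.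

*The integral of matrix coefficients.* Let `Φ` be the coefficient `⟨g v_k, v_k⟩`.  Since `K_{-ν} = K_ν`,
the coefficient `⟨g v_{-k}, v_{-k}⟩` is the conjugate of `Φ` (`crossCoeff_last_last`), so that `𝒮` is the
integral of `|Φ|²` against a spherical function, and the latter is the mean over `κ ∈ K` of
`height (κ g) ^ (1 + ir')` (`matCoeff_spherical`).  Invariance of the measure under `K` on both sides
replaces `|Φ|²` by the mean of the squares of all matrix coefficients of the minimal `K`-type, and
`height (κ g)` by `height g` (`lintegral_crossCoeff_mul_height`).  On `n(x) a(y)` each coefficient is the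
Fourier transform, in `x`, of a product of two Whittaker functions (`crossCoeff_borelElt`), so
Plancherel's theorem in `x` (`sum_lintegral_crossCoeff`) leaves the multiplicative convolution, at `y`, of
the density `y⁻¹ |𝐖₂(y)|²` with its reflection.  Probabilistically, up to a constant the height is
distributed like the quotient of two independent variables with the density `y⁻¹ |𝐖₂(y)|² dy^×`
(`map_height_eq`).  The expectation of `height ^ (ir')` is then the product of an integral and its complex
conjugate, which gives `𝒮 = |𝒯₂|² / 8π` (`tripleS_eq`).  All of this is done for nonnegative functions
first, and so yields the absolute convergence of `𝒮`.
-/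

open TripleWeight

namespace TripleWeight

open scoped FourierTransform RealInnerProductSpace

/-! ### The modified Bessel function -/

theorem one_add_sq_div_two_le_cosh (t : ℝ) : 1 + t ^ 2 / 2 ≤ Real.cosh t := by
  have h : Real.cosh t = 1 + 2 * Real.sinh (t / 2) ^ 2 := by
    have := Real.cosh_two_mul (t / 2)
    rw [show 2 * (t / 2) = t by ring, Real.cosh_sq] at this
    linarith
  have h2 : (t / 2) ^ 2 ≤ Real.sinh (t / 2) ^ 2 := by
    rcases le_total 0 (t / 2) with h0 | h0
    · exact pow_le_pow_left₀ h0 (Real.self_le_sinh_iff.2 h0) 2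
    · have := Real.sinh_le_self_iff.2 h0
      nlinarith
  rw [h]; nlinarith

theorem integrable_exp_neg_mul_cosh {x : ℝ} (hx : 0 < x) (ν : ℂ) :
    Integrable fun t : ℝ => (Real.exp (-x * Real.cosh t) : ℂ) * Complex.exp (ν * t) := by
  have hg : Integrable fun t : ℝ =>
      Complex.exp (-((x / 2 : ℝ) : ℂ) * t ^ 2 + (ν.re : ℂ) * t + 0) :=
    integrable_cexp_quadratic' (by simpa using hx) _ _
  refine hg.mono (by fun_prop) (ae_of_all _ fun t => ?_)
  rw [norm_mul, Complex.norm_exp, Complex.norm_exp, Complex.norm_real, Real.norm_eq_abs,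
    Real.abs_exp, ← Real.exp_add, Real.exp_le_exp]
  have := one_add_sq_div_two_le_cosh t
  have h2 : ((-((x / 2 : ℝ) : ℂ) * t ^ 2 + (ν.re : ℂ) * t + 0)).re
      = -(x / 2) * t ^ 2 + ν.re * t := by
    norm_cast
    simp
  rw [h2]
  simp only [Complex.mul_re, Complex.ofReal_re, Complex.ofReal_im, mul_zero, sub_zero]
  nlinarith

/-- The Bessel function as an integral over the whole line. -/
theorem besselK_eq_integral {x : ℝ} (hx : 0 < x) (ν : ℂ) :
    besselK ν x =
      (1 / 2) * ∫ t : ℝ, (Real.exp (-x * Real.cosh t) : ℂ) * Complex.exp (ν * t) := by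
  have hi := integrable_exp_neg_mul_cosh hx ν
  have hi' := integrable_exp_neg_mul_cosh hx (-ν)
  have h1 : ∫ t in Set.Iic (0 : ℝ), (Real.exp (-x * Real.cosh t) : ℂ) * Complex.exp (ν * t)
      = ∫ t in Set.Ioi (0 : ℝ), (Real.exp (-x * Real.cosh t) : ℂ) * Complex.exp (-ν * t) := by
    have := integral_comp_neg_Ioi (0 : ℝ)
      (fun t : ℝ => (Real.exp (-x * Real.cosh t) : ℂ) * Complex.exp (ν * t))
    rw [neg_zero] at this
    rw [← this]
    simp
  have h2 := integral_add_compl (μ := volume) (measurableSet_Iic (a := (0 : ℝ))) hi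
  rw [Set.compl_Iic, h1, ← integral_add hi'.integrableOn hi.integrableOn] at h2
  rw [← h2, ← integral_const_mul, besselK]
  refine integral_congr_ae (ae_of_all _ fun t => ?_)
  simp only [Complex.cosh]
  ring_nf

theorem besselK_neg (ν : ℂ) (x : ℝ) : besselK (-ν) x = besselK ν x := by
  unfold besselK
  simp [neg_mul, Complex.cosh_neg]

theorem besselK_conj (ν : ℂ) (x : ℝ) : conj (besselK ν x) = besselK (conj ν) x := by
  unfold besselK
  rw [← integral_conj]
  congr 1
  ext t
  simp [← Complex.cosh_conj, -Complex.ofReal_exp]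

/-- Both terms `exp(-at)` and `exp(-b/t)` are balanced by the substitution `t = √(b/a) e^u`. -/
theorem integral_cpow_mul_exp_eq_besselK {a b : ℝ} (ha : 0 < a) (hb : 0 < b) (ν : ℂ) :
    ∫ t in Set.Ioi (0 : ℝ), (t : ℂ) ^ (ν - 1) * (Real.exp (-a * t - b / t) : ℂ) =
      2 * ((b / a : ℝ) : ℂ) ^ (ν / 2) * besselK ν (2 * √(a * b)) := by
  set c := √(b / a) with hc
  have hc0 : 0 < c := Real.sqrt_pos.2 (by positivity)
  have hac : a * c = √(a * b) := by
    rw [hc, Real.sqrt_div hb.le, Real.sqrt_mul ha.le]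
    have := Real.mul_self_sqrt ha.le
    field_simp
    nlinarith [Real.sqrt_nonneg a, Real.sqrt_nonneg b]
  have hbc : b / c = √(a * b) := by
    rw [div_eq_iff hc0.ne', ← hac, mul_assoc, ← sq, hc, Real.sq_sqrt (by positivity)]
    field_simp
  have himg : (fun u : ℝ => c * Real.exp u) '' Set.univ = Set.Ioi 0 := by
    ext t
    simp only [Set.image_univ, Set.mem_range, Set.mem_Ioi]
    constructor
    · rintro ⟨u, rfl⟩; positivity
    · intro ht
      exact ⟨Real.log (t / c), by rw [Real.exp_log (by positivity)]; field_simp⟩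
  have hinj : Set.InjOn (fun u : ℝ => c * Real.exp u) Set.univ := by
    intro u _ v _ h
    exact Real.exp_injective (mul_left_cancel₀ hc0.ne' h)
  have hcv := integral_image_eq_integral_abs_deriv_smul (s := Set.univ)
    (f := fun u : ℝ => c * Real.exp u) (f' := fun u => c * Real.exp u) MeasurableSet.univ
    (fun u _ => ((Real.hasDerivAt_exp u).const_mul c).hasDerivWithinAt) hinj
    (fun t : ℝ => (t : ℂ) ^ (ν - 1) * (Real.exp (-a * t - b / t) : ℂ))
  rw [himg] at hcv
  rw [hcv, besselK_eq_integral (by positivity), setIntegral_univ, ← mul_assoc,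
    ← integral_const_mul]
  refine integral_congr_ae (ae_of_all _ fun u => ?_)
  have hp : 0 < c * Real.exp u := by positivity
  have e1 : -a * (c * Real.exp u) - b / (c * Real.exp u) = -(2 * √(a * b)) * Real.cosh u := by
    rw [← div_div, hbc, Real.cosh_eq, Real.exp_neg, ← hac]; field_simp; ring
  have e2 : ((c * Real.exp u : ℝ) : ℂ) ^ ν = ((b / a : ℝ) : ℂ) ^ (ν / 2) * Complex.exp (ν * u) := by
    have hcc : (c : ℂ) ^ ν = ((b / a : ℝ) : ℂ) ^ (ν / 2) := by
      have : ((b / a : ℝ) : ℂ) = (c : ℂ) ^ 2 := by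
        rw [← Complex.ofReal_pow, hc, Real.sq_sqrt (by positivity)]
      rw [this, ← Complex.cpow_nat_mul' (by
          rw [Complex.arg_ofReal_of_nonneg hc0.le]; simp [Real.pi_pos]) (by
          rw [Complex.arg_ofReal_of_nonneg hc0.le]; simp [Real.pi_nonneg])]
      congr 1; push_cast; ring
    rw [Complex.ofReal_mul, Complex.mul_cpow_ofReal_nonneg hc0.le (Real.exp_pos u).le, hcc,
      Complex.cpow_def_of_ne_zero (x := (Real.exp u : ℂ)) (by simp), ← Complex.ofReal_log (Real.exp_pos u).le,
      Real.log_exp, mul_comm (u : ℂ)]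
  simp only [abs_of_pos hp, e1, Complex.real_smul]
  rw [Complex.cpow_sub _ _ (by exact_mod_cast hp.ne'), e2, Complex.cpow_one]
  have : ((c * Real.exp u : ℝ) : ℂ) ≠ 0 := by exact_mod_cast hp.ne'
  field_simp

/-- The function `t exp(-x cosh t)` and the parts of its derivative are integrable, as integration by
parts requires. -/
theorem integrable_self_mul_exp_neg_cosh {x : ℝ} (hx : 0 < x) :
    Integrable (fun t : ℝ => t * Real.exp (-x * Real.cosh t)) ∧
      Integrable fun t : ℝ => t * (Real.sinh t * Real.exp (-x * Real.cosh t)) := by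
  have hI (c : ℝ) : Integrable fun t : ℝ => Real.exp (-x * Real.cosh t) * Real.exp (c * t) := by
    have := (integrable_exp_neg_mul_cosh hx (c : ℂ)).norm
    refine this.congr (ae_of_all _ fun t => ?_)
    simp [Complex.norm_exp]
  have habs (t : ℝ) : |t| ≤ |Real.sinh t| := by
    rcases le_total 0 t with h | h
    · rw [abs_of_nonneg h]; exact (Real.self_le_sinh_iff.2 h).trans (le_abs_self _)
    · rw [abs_of_nonpos h]
      exact (neg_le_neg (Real.sinh_le_self_iff.2 h)).trans (neg_le_abs _)
  have hs (t : ℝ) : |Real.sinh t| ≤ Real.exp t + Real.exp (-t) := by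
    rw [Real.sinh_eq, abs_le]
    constructor <;> nlinarith [Real.exp_pos t, Real.exp_pos (-t)]
  constructor
  · refine ((hI 1).add (hI (-1))).mono (by fun_prop) (ae_of_all _ fun t => ?_)
    refine le_trans ?_ (le_abs_self _)
    have h1 := (habs t).trans (hs t)
    simp only [Pi.add_apply, one_mul, neg_one_mul, Real.norm_eq_abs]
    rw [abs_mul, Real.abs_exp, ← mul_add, mul_comm]
    gcongr
  · refine (((hI 2).add (hI (-2))).add ((hI 0).add (hI 0))).mono (by fun_prop)
      (ae_of_all _ fun t => ?_)
    refine le_trans ?_ (le_abs_self _)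
    have h1 : |t| * |Real.sinh t| ≤ (Real.exp t + Real.exp (-t)) ^ 2 := by
      rw [sq]
      exact mul_le_mul ((habs t).trans (hs t)) (hs t) (abs_nonneg _) (by positivity)
    have h2 : (Real.exp t + Real.exp (-t)) ^ 2 = Real.exp (2 * t) + Real.exp (-2 * t) + (1 + 1) := by
      rw [add_sq, mul_assoc, ← Real.exp_add, ← Real.exp_nat_mul, ← Real.exp_nat_mul]
      norm_num; ring
    have h0 := Real.exp_pos (-x * Real.cosh t)
    rw [h2] at h1
    simp only [Pi.add_apply, zero_mul, Real.exp_zero, mul_one, Real.norm_eq_abs]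
    rw [abs_mul, abs_mul, Real.abs_exp]
    calc |t| * (|Real.sinh t| * Real.exp (-x * Real.cosh t))
        = (|t| * |Real.sinh t|) * Real.exp (-x * Real.cosh t) := by ring
      _ ≤ _ := mul_le_mul_of_nonneg_right h1 h0.le
      _ = _ := by ring

theorem integrable_exp_neg_cosh {x : ℝ} (hx : 0 < x) :
    Integrable fun t : ℝ => Real.exp (-x * Real.cosh t) := by
  have := (integrable_exp_neg_mul_cosh hx 0).norm
  refine this.congr (ae_of_all _ fun t => ?_)
  simp only [zero_mul, Complex.exp_zero, mul_one, Complex.norm_real, Real.norm_eq_abs,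
    Real.abs_exp]

/-- Integration by parts with `d/dt exp(-x cosh t) = -x sinh t exp(-x cosh t)`. -/
theorem integral_self_mul_sinh_mul_exp_neg_cosh {x : ℝ} (hx : 0 < x) :
    x * ∫ t : ℝ, t * (Real.sinh t * Real.exp (-x * Real.cosh t)) =
      ∫ t : ℝ, Real.exp (-x * Real.cosh t) := by
  obtain ⟨h1, h2⟩ := integrable_self_mul_exp_neg_cosh hx
  have h0 := integrable_exp_neg_cosh hx
  have hd (t : ℝ) : HasDerivAt (fun t : ℝ => t * Real.exp (-x * Real.cosh t))
      (Real.exp (-x * Real.cosh t) - x * (t * (Real.sinh t * Real.exp (-x * Real.cosh t)))) t := by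
    have := (hasDerivAt_id t).mul (((Real.hasDerivAt_cosh t).const_mul (-x)).exp)
    refine this.congr_deriv ?_
    simp only [id]; ring
  have := integral_eq_zero_of_hasDerivAt_of_integrable hd (h0.sub (h2.const_mul x)) h1
  rw [integral_sub h0 (h2.const_mul x), integral_const_mul] at this
  linarith

theorem besselK_re {x : ℝ} (hx : 0 < x) (ν : ℂ) :
    (besselK ν x).re =
      (1 / 2) * ∫ t : ℝ, Real.exp (-x * Real.cosh t) * (Complex.exp (ν * t)).re := by
  rw [besselK_eq_integral hx, show ((1 / 2 : ℂ)) = ((1 / 2 : ℝ) : ℂ) by push_cast; rfl,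
    Complex.re_ofReal_mul]
  congr 1
  have := integral_re (integrable_exp_neg_mul_cosh hx ν)
  simp only [RCLike.re_to_complex, Complex.re_ofReal_mul] at this
  exact this.symm

/-- The Bessel function is real for real and for imaginary order. -/
theorem exists_besselK_eq_ofReal {ν : ℂ} (hν : conj ν = ν ∨ conj ν = -ν) (x : ℝ) :
    besselK ν x = ((besselK ν x).re : ℂ) := by
  apply (Complex.conj_eq_iff_re.1 _).symm
  rw [besselK_conj]
  rcases hν with h | h <;> rw [h]
  exact besselK_neg _ _

theorem besselK_re_pos_of_real {x : ℝ} (hx : 0 < x) (ν : ℝ) : 0 < (besselK ν x).re := by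
  rw [besselK_re hx]
  have hI := (integrable_exp_neg_mul_cosh hx (ν : ℂ)).re
  simp only [RCLike.re_to_complex, Complex.re_ofReal_mul] at hI
  have : 0 < ∫ t : ℝ, Real.exp (-x * Real.cosh t) * (Complex.exp (ν * t)).re := by
    have hre (t : ℝ) : (Complex.exp (ν * t)).re = Real.exp (ν * t) := by
      rw [← Complex.ofReal_mul, ← Complex.ofReal_exp, Complex.ofReal_re]
    simp only [hre] at hI ⊢
    rw [integral_pos_iff_support_of_nonneg _ hI]
    · have : (Function.support fun t : ℝ =>
          Real.exp (-x * Real.cosh t) * Real.exp (ν * t)) = Set.univ := by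
        ext t
        simp [Real.exp_ne_zero]
      rw [this]; simp
    · intro t
      simp only [Pi.zero_apply]; positivity
  positivity

/-- `K_{ir}(x)` is positive once `2x > r²`: compare `cos(rt) ≥ 1 - r² t sinh(t) / 2`. -/
theorem besselK_re_pos_of_imag {x r : ℝ} (hx : r ^ 2 / 2 < x) :
    0 < (besselK (Complex.I * r) x).re := by
  have hx0 : 0 < x := lt_of_le_of_lt (by positivity) hx
  rw [besselK_re hx0]
  have hI := (integrable_exp_neg_mul_cosh hx0 (Complex.I * r)).re
  simp only [RCLike.re_to_complex, Complex.re_ofReal_mul] at hI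
  obtain ⟨-, h2⟩ := integrable_self_mul_exp_neg_cosh hx0
  have h0 := integrable_exp_neg_cosh hx0
  have hE : 0 < ∫ t : ℝ, Real.exp (-x * Real.cosh t) := integral_exp_pos h0
  have hle : ∫ t : ℝ, (Real.exp (-x * Real.cosh t) -
      r ^ 2 / 2 * (t * (Real.sinh t * Real.exp (-x * Real.cosh t)))) ≤
      ∫ t : ℝ, Real.exp (-x * Real.cosh t) * (Complex.exp (Complex.I * r * t)).re := by
    refine integral_mono (h0.sub (h2.const_mul _)) hI fun t => ?_
    have hre : (Complex.exp (Complex.I * r * t)).re = Real.cos (r * t) := by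
      rw [show Complex.I * r * t = ((r * t : ℝ) : ℂ) * Complex.I by push_cast; ring,
        Complex.exp_ofReal_mul_I_re]
    have hcos := Real.one_sub_sq_div_two_le_cos (x := r * t)
    have ht : t ^ 2 ≤ t * Real.sinh t := by
      rcases le_total 0 t with h | h
      · nlinarith [Real.self_le_sinh_iff.2 h]
      · nlinarith [Real.sinh_le_self_iff.2 h]
    have hp := Real.exp_pos (-x * Real.cosh t)
    simp only [hre]
    have : 1 - r ^ 2 / 2 * (t * Real.sinh t) ≤ Real.cos (r * t) := by
      nlinarith [mul_le_mul_of_nonneg_left ht (sq_nonneg r)]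
    nlinarith
  rw [integral_sub h0 (h2.const_mul _), integral_const_mul] at hle
  have hid := integral_self_mul_sinh_mul_exp_neg_cosh hx0
  set A := ∫ t : ℝ, t * (Real.sinh t * Real.exp (-x * Real.cosh t))
  have hA : 0 < A := by
    by_contra h
    nlinarith
  have : 0 < (x - r ^ 2 / 2) * A := mul_pos (by linarith) hA
  linarith

/-! ### The Mellin transform of a product of two Bessel functions -/

theorem ofReal_cpow_mul_exp {r : ℝ} (hr : 0 < r) (p : ℝ) (u : ℂ) :
    ((Real.exp p * r : ℝ) : ℂ) ^ u = Complex.exp (u * p) * (r : ℂ) ^ u := by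
  rw [Complex.ofReal_mul, Complex.mul_cpow_ofReal_nonneg (Real.exp_pos p).le hr.le,
    Complex.cpow_def_of_ne_zero (x := (Real.exp p : ℂ)) (by simp),
    ← Complex.ofReal_log (Real.exp_pos p).le, Real.log_exp, mul_comm u]

/-- The beta integral in the variable `x = e^p / (2 cosh p)`. -/
theorem integral_cosh_cpow {s α : ℂ} (h : |α.re| < s.re) :
    Integrable (fun p : ℝ => ((2 * Real.cosh p : ℝ) : ℂ) ^ (-s) * Complex.exp (α * p)) ∧
    ∫ p : ℝ, ((2 * Real.cosh p : ℝ) : ℂ) ^ (-s) * Complex.exp (α * p) =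
      Complex.Gamma ((s + α) / 2) * Complex.Gamma ((s - α) / 2) / (2 * Complex.Gamma s) := by
  obtain ⟨h1, h2⟩ := abs_lt.1 h
  have hu : 0 < ((s + α) / 2).re := by simp; linarith
  have hv : 0 < ((s - α) / 2).re := by simp; linarith
  set u := (s + α) / 2
  set v := (s - α) / 2
  have huv : u + v = s := by simp only [u, v]; ring
  have huv' : u - v = α := by simp only [u, v]; ring
  set f : ℝ → ℝ := fun p => Real.sigmoid (2 * p)
  have himg : f '' Set.univ = Set.Ioo 0 1 := by
    rw [← Real.range_sigmoid, Set.image_univ]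
    ext t
    constructor
    · rintro ⟨p, rfl⟩; exact ⟨2 * p, rfl⟩
    · rintro ⟨p, rfl⟩; exact ⟨p / 2, by simp only [f]; congr 1; ring⟩
  have hinj : Set.InjOn f Set.univ := fun p _ q _ hpq => by
    have := Real.sigmoid_injective hpq
    linarith
  have hder (p : ℝ) (_ : p ∈ Set.univ) : HasDerivWithinAt f (2 * (f p * (1 - f p))) Set.univ p := by
    have := (Real.hasDerivAt_sigmoid (2 * p)).comp p ((hasDerivAt_id p).const_mul 2)
    refine (this.congr_deriv ?_).hasDerivWithinAt
    simp only [f]; ring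
  have hf1 (p : ℝ) : f p = Real.exp p * (2 * Real.cosh p)⁻¹ := by
    simp only [f]
    rw [Real.sigmoid_def, ← div_eq_mul_inv, inv_eq_one_div, div_eq_div_iff (by positivity) (by positivity),
      Real.cosh_eq, mul_add, ← Real.exp_add]
    ring_nf
  have hf2 (p : ℝ) : 1 - f p = Real.exp (-p) * (2 * Real.cosh p)⁻¹ := by
    rw [hf1, Real.cosh_eq]
    have := Real.exp_pos p
    have := Real.exp_pos (-p)
    field_simp
    ring
  have hkey (p : ℝ) : |2 * (f p * (1 - f p))| •
      ((f p : ℂ) ^ (u - 1) * (1 - (f p : ℂ)) ^ (v - 1)) =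
      2 * (((2 * Real.cosh p : ℝ) : ℂ) ^ (-s) * Complex.exp (α * p)) := by
    have hc : 0 < (2 * Real.cosh p)⁻¹ := by positivity
    have hp1 : 0 < f p := by rw [hf1]; positivity
    have hp2 : 0 < 1 - f p := by rw [hf2]; positivity
    rw [abs_of_pos (by positivity), Complex.real_smul,
      show (1 - (f p : ℂ)) = ((1 - f p : ℝ) : ℂ) by push_cast; rfl,
      Complex.cpow_sub _ _ (by exact_mod_cast hp1.ne'),
      Complex.cpow_sub _ _ (by exact_mod_cast hp2.ne'), Complex.cpow_one, Complex.cpow_one]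
    have e1 : (f p : ℂ) ^ u * ((1 - f p : ℝ) : ℂ) ^ v =
        ((2 * Real.cosh p : ℝ) : ℂ) ^ (-s) * Complex.exp (α * p) := by
      rw [hf2 p, hf1 p, ofReal_cpow_mul_exp hc, ofReal_cpow_mul_exp hc]
      have : ((2 * Real.cosh p : ℝ) : ℂ) ^ (-s) = (((2 * Real.cosh p)⁻¹ : ℝ) : ℂ) ^ s := by
        rw [Complex.cpow_neg, Complex.ofReal_inv, Complex.inv_cpow]
        rw [Complex.arg_ofReal_of_nonneg (by positivity)]
        exact Real.pi_pos.ne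
      rw [this, ← huv, Complex.cpow_add _ _ (by exact_mod_cast hc.ne'), ← huv']
      have : Complex.exp ((u - v) * p) = Complex.exp (u * p) * Complex.exp (v * (-p : ℝ)) := by
        rw [← Complex.exp_add]; push_cast; ring_nf
      rw [this]; ring
    have n1 : (f p : ℂ) ≠ 0 := by exact_mod_cast hp1.ne'
    have n2 : ((1 - f p : ℝ) : ℂ) ≠ 0 := by exact_mod_cast hp2.ne'
    rw [← e1, Complex.ofReal_mul, Complex.ofReal_mul]
    field_simp
    push_cast
    ring
  have hb := (Complex.betaIntegral_convergent hu hv)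
  rw [intervalIntegrable_iff_integrableOn_Ioo_of_le zero_le_one, ← himg,
    integrableOn_image_iff_integrableOn_abs_deriv_smul MeasurableSet.univ hder hinj,
    integrableOn_univ] at hb
  simp only [hkey] at hb
  have hval : Complex.betaIntegral u v =
      2 * ∫ p : ℝ, ((2 * Real.cosh p : ℝ) : ℂ) ^ (-s) * Complex.exp (α * p) := by
    rw [Complex.betaIntegral, intervalIntegral.integral_of_le zero_le_one,
      integral_Ioc_eq_integral_Ioo, ← himg,
      integral_image_eq_integral_abs_deriv_smul MeasurableSet.univ hder hinj, setIntegral_univ]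
    simp only [hkey]
    rw [integral_const_mul]
  refine ⟨(integrable_const_mul_iff (by simp) _).1 hb, ?_⟩
  have hG := Complex.Gamma_mul_Gamma_eq_betaIntegral hu hv
  have hs : Complex.Gamma s ≠ 0 := Complex.Gamma_ne_zero_of_re_pos (by
    rw [← huv, Complex.add_re]; linarith)
  rw [huv, hval] at hG
  rw [hG]
  field_simp

/-- The change of variables `t = p + q`, `u = p - q` on the plane. -/
theorem map_add_sub_volume :
    MeasurableEmbedding (fun x : ℝ × ℝ => (x.1 + x.2, x.1 - x.2)) ∧
    Measure.map (fun x : ℝ × ℝ => (x.1 + x.2, x.1 - x.2)) volume =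
      ENNReal.ofReal (1 / 2) • (volume : Measure (ℝ × ℝ)) := by
  let L : ℝ × ℝ →ₗ[ℝ] ℝ × ℝ :=
    (LinearMap.fst ℝ ℝ ℝ + LinearMap.snd ℝ ℝ ℝ).prod (LinearMap.fst ℝ ℝ ℝ - LinearMap.snd ℝ ℝ ℝ)
  have hL : (L : ℝ × ℝ → ℝ × ℝ) = fun x => (x.1 + x.2, x.1 - x.2) := by
    ext x <;> simp [L]
  have hdet : LinearMap.det L = -2 := by
    rw [← LinearMap.det_toMatrix (Module.Basis.finTwoProd ℝ), Matrix.det_fin_two]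
    simp [LinearMap.toMatrix_apply, hL]
    norm_num
  constructor
  · refine Continuous.measurableEmbedding (by fun_prop) ?_
    rintro ⟨a, b⟩ ⟨c, d⟩ h
    simp only [Prod.mk.injEq] at h ⊢
    constructor <;> linarith [h.1, h.2]
  · rw [← hL, Measure.map_linearMap_addHaar_eq_smul_addHaar _ (by rw [hdet]; norm_num), hdet]
    norm_num

theorem integrable_cpow_mul_exp_neg_mul {s : ℂ} {r : ℝ} (hs : 0 < s.re) (hr : 0 < r) :
    IntegrableOn (fun x : ℝ => (x : ℂ) ^ (s - 1) * Complex.exp (-(r * x))) (Set.Ioi 0) := by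
  by_contra h
  have := Complex.integral_cpow_mul_exp_neg_mul_Ioi hs hr
  rw [integral_undef h] at this
  have h1 : (1 / (r : ℂ)) ^ s ≠ 0 := by
    rw [Ne, Complex.cpow_eq_zero_iff]
    have : (r : ℂ) ≠ 0 := by exact_mod_cast hr.ne'
    simp [this]
  exact mul_ne_zero h1 (Complex.Gamma_ne_zero_of_re_pos hs) this.symm

/-- In the coordinates `t = p + q`, `u = p - q` the integrand is a product, since
`cosh t + cosh u = 2 cosh p cosh q`. -/
theorem integral_cosh_add_cosh_cpow {s μ ν : ℂ} (h : |μ.re| + |ν.re| < s.re) :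
    Integrable (fun p : ℝ × ℝ => ((Real.cosh p.1 + Real.cosh p.2 : ℝ) : ℂ) ^ (-s) *
      (Complex.exp (μ * p.1) * Complex.exp (ν * p.2))) ∧
    ∫ p : ℝ × ℝ, ((Real.cosh p.1 + Real.cosh p.2 : ℝ) : ℂ) ^ (-s) *
      (Complex.exp (μ * p.1) * Complex.exp (ν * p.2)) =
      2 ^ (s - 1) / Complex.Gamma s ^ 2 *
        (Complex.Gamma ((s + (μ + ν)) / 2) * Complex.Gamma ((s - (μ + ν)) / 2) *
          (Complex.Gamma ((s + (μ - ν)) / 2) * Complex.Gamma ((s - (μ - ν)) / 2))) := by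
  obtain ⟨hemb, hmap⟩ := map_add_sub_volume
  obtain ⟨i1, e1⟩ := integral_cosh_cpow (s := s) (α := μ + ν)
    (lt_of_le_of_lt (by rw [Complex.add_re]; exact abs_add_le _ _) h)
  obtain ⟨i2, e2⟩ := integral_cosh_cpow (s := s) (α := μ - ν)
    (lt_of_le_of_lt (by rw [Complex.sub_re]; exact abs_sub _ _) h)
  set F : ℝ × ℝ → ℂ := fun p => ((Real.cosh p.1 + Real.cosh p.2 : ℝ) : ℂ) ^ (-s) *
      (Complex.exp (μ * p.1) * Complex.exp (ν * p.2)) with hF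
  have hFc (x : ℝ × ℝ) : F (x.1 + x.2, x.1 - x.2) = 2 ^ s *
      ((((2 * Real.cosh x.1 : ℝ) : ℂ) ^ (-s) * Complex.exp ((μ + ν) * x.1)) *
        (((2 * Real.cosh x.2 : ℝ) : ℂ) ^ (-s) * Complex.exp ((μ - ν) * x.2))) := by
    have h1 : Real.cosh (x.1 + x.2) + Real.cosh (x.1 - x.2) =
        2⁻¹ * ((2 * Real.cosh x.1) * (2 * Real.cosh x.2)) := by
      rw [Real.cosh_add, Real.cosh_sub]; ring
    have h2 : Complex.exp (μ * (x.1 + x.2 : ℝ)) * Complex.exp (ν * (x.1 - x.2 : ℝ)) =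
        Complex.exp ((μ + ν) * x.1) * Complex.exp ((μ - ν) * x.2) := by
      rw [← Complex.exp_add, ← Complex.exp_add]; push_cast; ring_nf
    have h3 : ((2⁻¹ : ℝ) : ℂ) ^ (-s) = 2 ^ s := by
      rw [Complex.ofReal_inv, Complex.inv_cpow _ _ (by
        rw [Complex.arg_ofReal_of_nonneg (by norm_num)]; exact Real.pi_pos.ne), Complex.cpow_neg,
        inv_inv]
      norm_num
    simp only [hF]
    rw [h1, h2, Complex.ofReal_mul, Complex.mul_cpow_ofReal_nonneg (by norm_num) (by positivity),
      h3, Complex.ofReal_mul, Complex.mul_cpow_ofReal_nonneg (by positivity) (by positivity)]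
    ring
  have hprod := i1.mul_prod i2
  constructor
  · have : Integrable F (ENNReal.ofReal (1 / 2) • (volume : Measure (ℝ × ℝ))) := by
      rw [← hmap, hemb.integrable_map_iff]
      refine (hprod.const_mul (2 ^ s)).congr (ae_of_all _ fun x => ?_)
      exact (hFc x).symm
    rwa [integrable_smul_measure (by simp) (by simp)] at this
  · have h1 : ∫ p, F p ∂(ENNReal.ofReal (1 / 2) • (volume : Measure (ℝ × ℝ))) =
        2 ^ s * ((∫ p : ℝ, ((2 * Real.cosh p : ℝ) : ℂ) ^ (-s) * Complex.exp ((μ + ν) * p)) *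
          ∫ p : ℝ, ((2 * Real.cosh p : ℝ) : ℂ) ^ (-s) * Complex.exp ((μ - ν) * p)) := by
      rw [← hmap, hemb.integral_map, ← integral_prod_mul, ← integral_const_mul]
      exact integral_congr_ae (ae_of_all _ hFc)
    rw [integral_smul_measure, e1, e2, ENNReal.toReal_ofReal (by norm_num),
      Complex.real_smul] at h1
    have hs : Complex.Gamma s ≠ 0 := Complex.Gamma_ne_zero_of_re_pos
      (lt_of_le_of_lt (by positivity) h)
    have h2 : (∫ p, F p) = 2 * (((1 / 2 : ℝ) : ℂ) * ∫ p, F p) := by push_cast; ring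
    rw [h2, h1, Complex.cpow_sub _ _ (by norm_num), Complex.cpow_one]
    field_simp

/-- The Mellin transform of `K_μ K_ν`. -/
theorem mellin_besselK_mul_besselK {s μ ν : ℂ} (h : |μ.re| + |ν.re| < s.re) :
    IntegrableOn (fun x : ℝ => (x : ℂ) ^ (s - 1) * (besselK μ x * besselK ν x)) (Set.Ioi 0) ∧
    ∫ x in Set.Ioi (0 : ℝ), (x : ℂ) ^ (s - 1) * (besselK μ x * besselK ν x) =
      2 ^ (s - 3) / Complex.Gamma s *
        (Complex.Gamma ((s + (μ + ν)) / 2) * Complex.Gamma ((s - (μ + ν)) / 2) *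
          (Complex.Gamma ((s + (μ - ν)) / 2) * Complex.Gamma ((s - (μ - ν)) / 2))) := by
  have hs : 0 < s.re := lt_of_le_of_lt (by positivity) h
  obtain ⟨iJ, eJ⟩ := integral_cosh_add_cosh_cpow h
  set F : ℝ × (ℝ × ℝ) → ℂ := fun p => (p.1 : ℂ) ^ (s - 1) *
    (((Real.exp (-p.1 * Real.cosh p.2.1) : ℂ) * Complex.exp (μ * p.2.1)) *
      ((Real.exp (-p.1 * Real.cosh p.2.2) : ℂ) * Complex.exp (ν * p.2.2))) with hF
  have hF' (x : ℝ) (q : ℝ × ℝ) : F (x, q) = ((x : ℂ) ^ (s - 1) *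
      Complex.exp (-((Real.cosh q.1 + Real.cosh q.2 : ℝ) * x))) *
        (Complex.exp (μ * q.1) * Complex.exp (ν * q.2)) := by
    have : Complex.exp (-((Real.cosh q.1 + Real.cosh q.2 : ℝ) * x)) =
        (Real.exp (-x * Real.cosh q.1) : ℂ) * (Real.exp (-x * Real.cosh q.2) : ℂ) := by
      rw [Complex.ofReal_exp, Complex.ofReal_exp, ← Complex.exp_add]; push_cast; ring_nf
    simp only [hF, this]; ring
  have hpos (q : ℝ × ℝ) : 0 < Real.cosh q.1 + Real.cosh q.2 := by positivity
  have hFm : AEStronglyMeasurable F ((volume.restrict (Set.Ioi 0)).prod volume) := by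
    apply Measurable.aestronglyMeasurable
    fun_prop
  have hsec (q : ℝ × ℝ) : IntegrableOn (fun x : ℝ => F (x, q)) (Set.Ioi 0) := by
    simp only [hF']
    exact (integrable_cpow_mul_exp_neg_mul hs (hpos q)).mul_const _
  have hval (q : ℝ × ℝ) : ∫ x in Set.Ioi (0 : ℝ), F (x, q) =
      Complex.Gamma s * (((Real.cosh q.1 + Real.cosh q.2 : ℝ) : ℂ) ^ (-s) *
      (Complex.exp (μ * q.1) * Complex.exp (ν * q.2))) := by
    simp only [hF']
    rw [integral_mul_const, Complex.integral_cpow_mul_exp_neg_mul_Ioi hs (hpos q), one_div,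
      Complex.inv_cpow _ _ (by
        rw [Complex.arg_ofReal_of_nonneg (hpos q).le]; exact Real.pi_pos.ne), Complex.cpow_neg]
    ring
  have hnorm (q : ℝ × ℝ) : ∫ x in Set.Ioi (0 : ℝ), ‖F (x, q)‖ =
      Real.Gamma s.re * ‖((Real.cosh q.1 + Real.cosh q.2 : ℝ) : ℂ) ^ (-s) *
      (Complex.exp (μ * q.1) * Complex.exp (ν * q.2))‖ := by
    rw [norm_mul, Complex.norm_cpow_eq_rpow_re_of_pos (hpos q), ← mul_assoc, mul_comm (Real.Gamma _),
      Complex.neg_re, Real.rpow_neg (hpos q).le, ← Real.inv_rpow (hpos q).le, ← one_div,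
      ← Real.integral_rpow_mul_exp_neg_mul_Ioi hs (hpos q), ← integral_mul_const]
    refine setIntegral_congr_fun measurableSet_Ioi fun x hx => ?_
    simp only [hF']
    rw [norm_mul, norm_mul, Complex.norm_cpow_eq_rpow_re_of_pos hx, Complex.norm_exp]
    norm_num
  have hint : Integrable F ((volume.restrict (Set.Ioi 0)).prod volume) := by
    rw [integrable_prod_iff' hFm]
    refine ⟨ae_of_all _ hsec, ?_⟩
    simp only [hnorm]
    exact iJ.norm.const_mul _
  have hK (x : ℝ) (hx : x ∈ Set.Ioi (0 : ℝ)) :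
      ∫ q, F (x, q) = 4 * ((x : ℂ) ^ (s - 1) * (besselK μ x * besselK ν x)) := by
    simp only [hF]
    rw [integral_const_mul, besselK_eq_integral hx, besselK_eq_integral hx, Measure.volume_eq_prod,
      integral_prod_mul (fun t : ℝ => (Real.exp (-x * Real.cosh t) : ℂ) * Complex.exp (μ * t))
        (fun t : ℝ => (Real.exp (-x * Real.cosh t) : ℂ) * Complex.exp (ν * t))]
    ring
  constructor
  · have h1 := hint.integral_prod_left
    have h2 : IntegrableOn (fun x : ℝ => 4 * ((x : ℂ) ^ (s - 1) * (besselK μ x * besselK ν x)))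
        (Set.Ioi 0) := IntegrableOn.congr_fun h1 hK measurableSet_Ioi
    exact (integrable_const_mul_iff (by simp) _).1 h2
  · have h1 := integral_integral_swap (f := fun x q => F (x, q)) hint
    simp only [hval] at h1
    rw [integral_const_mul, eJ, setIntegral_congr_fun measurableSet_Ioi hK, integral_const_mul] at h1
    have hG : Complex.Gamma s ≠ 0 := Complex.Gamma_ne_zero_of_re_pos hs
    have h4 : (2 : ℂ) ^ (s - 1) = 4 * 2 ^ (s - 3) := by
      rw [show s - 1 = (s - 3) + (2 : ℕ) by push_cast; ring, Complex.cpow_add _ _ (by norm_num),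
        Complex.cpow_natCast]
      norm_num; ring
    rw [h4] at h1
    have := mul_left_cancel₀ (a := (4 : ℂ)) (by norm_num) (h1.trans (by
      rw [show Complex.Gamma s * (4 * 2 ^ (s - 3) / Complex.Gamma s ^ 2 *
        (Complex.Gamma ((s + (μ + ν)) / 2) * Complex.Gamma ((s - (μ + ν)) / 2) *
          (Complex.Gamma ((s + (μ - ν)) / 2) * Complex.Gamma ((s - (μ - ν)) / 2)))) =
        4 * (2 ^ (s - 3) / Complex.Gamma s *
        (Complex.Gamma ((s + (μ + ν)) / 2) * Complex.Gamma ((s - (μ + ν)) / 2) *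
          (Complex.Gamma ((s + (μ - ν)) / 2) * Complex.Gamma ((s - (μ - ν)) / 2)))) by
        field_simp]))
    exact this

/-! ### Gaussians on the complex plane -/

theorem integrable_cexp_mul_I_mul {α : Type*} [MeasurableSpace α] {μ : Measure α} {f : α → ℂ}
    (hf : Integrable f μ) {c : α → ℝ} (hc : Measurable c) :
    Integrable (fun x => Complex.exp ((c x : ℂ) * Complex.I) * f x) μ := by
  refine hf.mono (AEStronglyMeasurable.mul (by fun_prop) hf.1) (ae_of_all _ fun x => ?_)
  rw [norm_mul, Complex.norm_exp_ofReal_mul_I, one_mul]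

/-- The function `x̄ ^ m exp(-t |x|²)` on `ℂ`. -/
noncomputable def conjGauss (m : ℕ) (t : ℝ) (x : ℂ) : ℂ :=
  conj x ^ m * Complex.exp (-(t * (x * conj x)))

theorem norm_conjGauss (m : ℕ) (t : ℝ) (x : ℂ) :
    ‖conjGauss m t x‖ = ‖x‖ ^ m * Real.exp (-t * ‖x‖ ^ 2) := by
  rw [conjGauss, norm_mul, norm_pow, Complex.norm_exp, RCLike.norm_conj, Complex.mul_conj,
    Complex.normSq_eq_norm_sq, ← Complex.ofReal_mul, ← Complex.ofReal_neg, Complex.ofReal_re, neg_mul]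

theorem integral_pow_mul_gauss (m : ℕ) {t : ℝ} (ht : 0 < t) :
    ∫ x : ℂ, ‖x‖ ^ m * Real.exp (-t * ‖x‖ ^ 2) =
      Real.pi * t ^ (-((m : ℝ) + 2) / 2) * Real.Gamma (((m : ℝ) + 2) / 2) := by
  have := Complex.integral_rpow_mul_exp_neg_mul_rpow (p := 2) (q := m) (b := t) (by norm_num)
    (by have : (0 : ℝ) ≤ m := by positivity
        linarith) ht
  simp only [Real.rpow_natCast, Real.rpow_ofNat] at this
  rw [this]
  ring

theorem integrable_pow_mul_gauss (m : ℕ) {t : ℝ} (ht : 0 < t) :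
    Integrable fun x : ℂ => ‖x‖ ^ m * Real.exp (-t * ‖x‖ ^ 2) := by
  by_contra h
  have h1 := integral_pow_mul_gauss m ht
  rw [integral_undef h] at h1
  have h2 : 0 < Real.Gamma (((m : ℝ) + 2) / 2) := Real.Gamma_pos_of_pos (by positivity)
  have : 0 < Real.pi * t ^ (-((m : ℝ) + 2) / 2) * Real.Gamma (((m : ℝ) + 2) / 2) := by positivity
  linarith

theorem continuous_conjGauss (m : ℕ) (t : ℝ) : Continuous (conjGauss m t) := by
  unfold conjGauss; fun_prop

theorem integrable_conjGauss (m : ℕ) {t : ℝ} (ht : 0 < t) : Integrable (conjGauss m t) := by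
  refine (integrable_pow_mul_gauss m ht).mono' (continuous_conjGauss m t).aestronglyMeasurable
    (ae_of_all _ fun x => (norm_conjGauss m t x).le)

theorem hasFDerivAt_conjGauss (m : ℕ) (t : ℝ) (x : ℂ) :
    HasFDerivAt (conjGauss m t)
      ((m * conj x ^ (m - 1) * Complex.exp (-(t * (x * conj x)))) •
          (Complex.conjCLE : ℂ →L[ℝ] ℂ) +
        (-(t * conjGauss m t x)) •
          (x • (Complex.conjCLE : ℂ →L[ℝ] ℂ) + conj x • ContinuousLinearMap.id ℝ ℂ)) x := by
  have h1 : HasFDerivAt (fun x : ℂ => conj x) (Complex.conjCLE : ℂ →L[ℝ] ℂ) x :=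
    Complex.conjCLE.hasFDerivAt
  have h2 := h1.pow m
  have h3 := ((((hasFDerivAt_id (𝕜 := ℝ) x).mul h1).const_mul (t : ℂ)).neg).cexp
  refine (h2.mul h3).congr_fderiv ?_
  ext v
  simp [conjGauss]
  ring

theorem fderiv_conjGauss_one_sub (m : ℕ) (t : ℝ) (x : ℂ) :
    fderiv ℝ (conjGauss m t) x 1 - Complex.I * fderiv ℝ (conjGauss m t) x Complex.I =
      -(2 * t) * conjGauss (m + 1) t x := by
  rw [(hasFDerivAt_conjGauss m t x).fderiv]
  simp [conjGauss, pow_succ]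
  linear_combination ((m * conj x ^ (m - 1) * Complex.exp (-(t * (x * conj x)))) +
   t * conj x ^ m * Complex.exp (-(t * (x * conj x))) * (conj x - x)) * Complex.I_mul_I

theorem norm_fderiv_conjGauss_le (m : ℕ) {t : ℝ} (ht : 0 < t) (x : ℂ) :
    ‖fderiv ℝ (conjGauss m t) x‖ ≤
      m * (‖x‖ ^ (m - 1) * Real.exp (-t * ‖x‖ ^ 2)) +
        2 * t * (‖x‖ ^ (m + 1) * Real.exp (-t * ‖x‖ ^ 2)) := by
  rw [(hasFDerivAt_conjGauss m t x).fderiv]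
  refine ContinuousLinearMap.opNorm_le_bound _ (by positivity) fun v => ?_
  simp only [add_apply, smul_apply, smul_eq_mul]
  have hE : ‖Complex.exp (-(t * (x * conj x)))‖ = Real.exp (-t * ‖x‖ ^ 2) := by
    have := norm_conjGauss 0 t x
    simpa [conjGauss] using this
  refine (norm_add_le _ _).trans ?_
  rw [add_mul]
  gcongr
  · rw [norm_mul, norm_mul, norm_mul, hE, norm_pow, RCLike.norm_conj]
    simp [mul_assoc]
  · rw [norm_mul, norm_neg, norm_mul, norm_conjGauss, Complex.norm_real, Real.norm_eq_abs,
      abs_of_pos ht]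
    have : ‖x * (Complex.conjCLE : ℂ →L[ℝ] ℂ) v + conj x * ContinuousLinearMap.id ℝ ℂ v‖ ≤
        2 * (‖x‖ * ‖v‖) := by
      refine (norm_add_le _ _).trans ?_
      simp
      linarith
    calc _ ≤ t * (‖x‖ ^ m * Real.exp (-t * ‖x‖ ^ 2)) * (2 * (‖x‖ * ‖v‖)) := by gcongr
      _ = _ := by ring

theorem contDiff_conjGauss (m : ℕ) (t : ℝ) : ContDiff ℝ 1 (conjGauss m t) := by
  have h : ContDiff ℝ 1 (fun x : ℂ => conj x) := Complex.conjCLE.contDiff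
  unfold conjGauss
  exact (h.pow m).mul ((contDiff_const.mul (contDiff_id.mul h)).neg.cexp)

theorem integrable_fderiv_conjGauss (m : ℕ) {t : ℝ} (ht : 0 < t) :
    Integrable (fderiv ℝ (conjGauss m t)) := by
  refine Integrable.mono' (((integrable_pow_mul_gauss (m - 1) ht).const_mul m).add
    ((integrable_pow_mul_gauss (m + 1) ht).const_mul (2 * t)))
    ((contDiff_conjGauss m t).continuous_fderiv (by norm_num)).aestronglyMeasurable
    (ae_of_all _ fun x => norm_fderiv_conjGauss_le m ht x)

/-- The Fourier transform of `x̄ ^ m exp(-t |x|²)`.  Since `-2t x̄` is the logarithmic Wirtinger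
derivative of the Gaussian, raising `m` amounts to multiplication by `-πi ζ̄ / t`. -/
theorem fourier_conjGauss (m : ℕ) {t : ℝ} (ht : 0 < t) (ζ : ℂ) :
    𝓕 (conjGauss m t) ζ = (Real.pi / t : ℂ) * (-(Real.pi * Complex.I * conj ζ / t)) ^ m *
      Complex.exp (-(Real.pi ^ 2 * ‖ζ‖ ^ 2 / t)) := by
  have ht' : (t : ℂ) ≠ 0 := by exact_mod_cast ht.ne'
  induction m with
  | zero =>
    have := fourier_gaussian_innerProductSpace (V := ℂ) (b := t) (by simpa using ht) ζ
    have h2 : conjGauss 0 t = fun v : ℂ => Complex.exp (-(t : ℂ) * ‖v‖ ^ 2) := by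
      ext v
      rw [conjGauss, Complex.mul_conj, Complex.normSq_eq_norm_sq]
      push_cast
      ring_nf
    rw [h2, this]
    simp
    left
    ring_nf
  | succ m ih =>
    have hf := integrable_conjGauss m ht
    have hf' := integrable_fderiv_conjGauss m ht
    have key := Real.fourier_fderiv hf ((contDiff_conjGauss m t).differentiable (by norm_num)) hf'
    have hv (v : ℂ) : 𝓕 (fun x => fderiv ℝ (conjGauss m t) x v) ζ =
        2 * Real.pi * Complex.I * ((⟪v, ζ⟫ : ℝ) : ℂ) * 𝓕 (conjGauss m t) ζ := by
      rw [← Real.fourier_continuousLinearMap_apply hf', key]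
      rw [VectorFourier.fourierSMulRight_apply]
      have : (-innerSL ℝ) ζ v = -⟪v, ζ⟫ := by rw [real_inner_comm]; rfl
      erw [this]
      simp only [neg_smul, smul_eq_mul, Complex.real_smul]
      ring
    have h1 : 𝓕 (fun x => -(2 * t : ℂ) * conjGauss (m + 1) t x) ζ =
        𝓕 (fun x => fderiv ℝ (conjGauss m t) x 1) ζ -
          Complex.I * 𝓕 (fun x => fderiv ℝ (conjGauss m t) x Complex.I) ζ := by
      simp only [Real.fourier_eq', ← fderiv_conjGauss_one_sub, smul_eq_mul]
      have hi (v : ℂ) := integrable_cexp_mul_I_mul (hf'.apply_continuousLinearMap v)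
        (c := fun x : ℂ => -2 * Real.pi * ⟪x, ζ⟫) (by fun_prop)
      rw [← integral_const_mul, ← integral_sub (hi 1) ((hi Complex.I).const_mul _)]
      congr 1; ext x; ring
    have h2 : 𝓕 (fun x => -(2 * t : ℂ) * conjGauss (m + 1) t x) ζ =
        -(2 * t : ℂ) * 𝓕 (conjGauss (m + 1) t) ζ := by
      simp only [Real.fourier_eq', smul_eq_mul]
      rw [← integral_const_mul]
      congr 1; ext x; ring
    have hz : ((⟪(1 : ℂ), ζ⟫ : ℝ) : ℂ) - Complex.I * ((⟪Complex.I, ζ⟫ : ℝ) : ℂ) = conj ζ := by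
      rw [Complex.inner, Complex.inner]
      apply Complex.ext <;> simp
    rw [h2, hv, hv] at h1
    have h3 : 𝓕 (conjGauss (m + 1) t) ζ =
        -(Real.pi * Complex.I * conj ζ / t) * 𝓕 (conjGauss m t) ζ := by
      rw [← hz]
      field_simp
      linear_combination -h1 / 2
    rw [h3, ih]
    ring

/-! ### The Fourier transform of `x̄ ^ m (|x|² + y²) ^ (-s)` -/

/-- The Fourier transform of `x ↦ x̄ ^ m (|x|² + y²) ^ (-s)` on `ℂ`, as a multiple of a modified
Bessel function. -/
noncomputable def besselKernel (m : ℕ) (s : ℂ) (y : ℝ) (ζ : ℂ) : ℂ :=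
  2 * Real.pi * (-(Real.pi * Complex.I * conj ζ)) ^ m / Complex.Gamma s *
    (((Real.pi * ‖ζ‖ / y : ℝ) : ℂ) ^ (s - 1 - m) * besselK (s - 1 - m) (2 * (Real.pi * ‖ζ‖ * y)))

/-- The weight with which the Gaussian `exp(-t |x|²)` enters `(|x|² + y²) ^ (-s)`. -/
noncomputable def gammaWeight (s : ℂ) (y t : ℝ) : ℂ :=
  (t : ℂ) ^ (s - 1) * Complex.exp (-((y ^ 2 : ℝ) * t))

theorem norm_gammaWeight (s : ℂ) (y : ℝ) {t : ℝ} (ht : 0 < t) :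
    ‖gammaWeight s y t‖ = t ^ (s.re - 1) * Real.exp (-(y ^ 2 * t)) := by
  rw [gammaWeight, norm_mul, Complex.norm_cpow_eq_rpow_re_of_pos ht, Complex.norm_exp,
    ← Complex.ofReal_mul, ← Complex.ofReal_neg, Complex.ofReal_re]
  simp

theorem integral_gammaWeight_mul_conjGauss (m : ℕ) {s : ℂ} (hs : 0 < s.re) {y : ℝ} (hy : 0 < y)
    (x : ℂ) :
    ∫ t in Set.Ioi (0 : ℝ), gammaWeight s y t * conjGauss m t x =
      Complex.Gamma s * (conj x ^ m * ((‖x‖ ^ 2 + y ^ 2 : ℝ) : ℂ) ^ (-s)) := by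
  have hp : 0 < ‖x‖ ^ 2 + y ^ 2 := by positivity
  have h1 (t : ℝ) : gammaWeight s y t * conjGauss m t x =
      conj x ^ m * ((t : ℂ) ^ (s - 1) * Complex.exp (-((‖x‖ ^ 2 + y ^ 2 : ℝ) * t))) := by
    have : Complex.exp (-((‖x‖ ^ 2 + y ^ 2 : ℝ) * t)) =
        Complex.exp (-((y ^ 2 : ℝ) * t)) * Complex.exp (-(t * (x * conj x))) := by
      rw [← Complex.exp_add, Complex.mul_conj, Complex.normSq_eq_norm_sq]; push_cast; ring_nf
    rw [gammaWeight, conjGauss, this]; ring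
  simp only [h1]
  rw [integral_const_mul, Complex.integral_cpow_mul_exp_neg_mul_Ioi hs hp, one_div,
    Complex.inv_cpow _ _ (by
      rw [Complex.arg_ofReal_of_nonneg hp.le]; exact Real.pi_pos.ne), Complex.cpow_neg]
  ring

theorem integral_gammaWeight_mul_fourier (m : ℕ) {s : ℂ} (hs : 0 < s.re) {y : ℝ} (hy : 0 < y)
    {ζ : ℂ} (hζ : ζ ≠ 0) :
    ∫ t in Set.Ioi (0 : ℝ), gammaWeight s y t * 𝓕 (conjGauss m t) ζ =
      Complex.Gamma s * besselKernel m s y ζ := by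
  have hn : 0 < ‖ζ‖ := norm_pos_iff.2 hζ
  have hb : 0 < (Real.pi * ‖ζ‖) ^ 2 := by positivity
  have key := integral_cpow_mul_exp_eq_besselK (pow_pos hy 2) hb (s - 1 - m)
  have h1 : ∀ t ∈ Set.Ioi (0 : ℝ), gammaWeight s y t * 𝓕 (conjGauss m t) ζ =
      Real.pi * (-(Real.pi * Complex.I * conj ζ)) ^ m * ((t : ℂ) ^ (s - 1 - m - 1) *
        (Real.exp (-y ^ 2 * t - (Real.pi * ‖ζ‖) ^ 2 / t) : ℂ)) := by
    intro t ht
    have ht' : (t : ℂ) ≠ 0 := by exact_mod_cast (ne_of_gt ht)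
    have e1 : (t : ℂ) ^ (s - 1 - m - 1) = (t : ℂ) ^ (s - 1) / t ^ m / t := by
      rw [Complex.cpow_sub _ _ ht', Complex.cpow_sub _ _ ht', Complex.cpow_natCast, Complex.cpow_one]
    have e2 : (Real.exp (-y ^ 2 * t - (Real.pi * ‖ζ‖) ^ 2 / t) : ℂ) =
        Complex.exp (-((y ^ 2 : ℝ) * t)) * Complex.exp (-(Real.pi ^ 2 * ‖ζ‖ ^ 2 / t)) := by
      rw [← Complex.exp_add, Complex.ofReal_exp]; push_cast; ring_nf
    rw [gammaWeight, fourier_conjGauss m ht, e1, e2, ← neg_div, div_pow]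
    field_simp
  rw [setIntegral_congr_fun measurableSet_Ioi h1, integral_const_mul, key, besselKernel]
  have e3 : √(y ^ 2 * (Real.pi * ‖ζ‖) ^ 2) = Real.pi * ‖ζ‖ * y := by
    rw [← mul_pow, Real.sqrt_sq (by positivity)]; ring
  have e4 : (((Real.pi * ‖ζ‖) ^ 2 / y ^ 2 : ℝ) : ℂ) ^ ((s - 1 - m) / 2) =
      ((Real.pi * ‖ζ‖ / y : ℝ) : ℂ) ^ (s - 1 - m) := by
    have hp : 0 < Real.pi * ‖ζ‖ / y := by positivity
    rw [← div_pow, Complex.ofReal_pow, ← Complex.cpow_nat_mul' (by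
          rw [Complex.arg_ofReal_of_nonneg hp.le]; simp [Real.pi_pos]) (by
          rw [Complex.arg_ofReal_of_nonneg hp.le]; simp [Real.pi_nonneg])]
    congr 1; push_cast; ring
  have hG : Complex.Gamma s ≠ 0 := Complex.Gamma_ne_zero_of_re_pos hs
  rw [e3, e4]
  field_simp

theorem norm_fourier_conjGauss (m : ℕ) {t : ℝ} (ht : 0 < t) (ζ : ℂ) :
    ‖𝓕 (conjGauss m t) ζ‖ =
      (Real.pi / t) ^ (m + 1) * (‖ζ‖ ^ m * Real.exp (-(Real.pi ^ 2 / t) * ‖ζ‖ ^ 2)) := by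
  rw [fourier_conjGauss m ht, norm_mul, norm_mul, norm_pow, norm_neg, Complex.norm_exp]
  have : (-(Real.pi ^ 2 * ‖ζ‖ ^ 2 / t : ℂ)).re = -(Real.pi ^ 2 / t) * ‖ζ‖ ^ 2 := by
    norm_cast; simp; ring
  rw [this]
  simp only [norm_div, norm_mul, Complex.norm_real, Complex.norm_I, RCLike.norm_conj,
    Real.norm_eq_abs, abs_of_pos Real.pi_pos, abs_of_pos ht, mul_one]
  rw [mul_div_right_comm, mul_pow, pow_succ]
  ring

theorem continuous_fourier_conjGauss (m : ℕ) {t : ℝ} (ht : 0 < t) :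
    Continuous (𝓕 (conjGauss m t)) := by
  have : 𝓕 (conjGauss m t) = fun ζ => (Real.pi / t : ℂ) *
      (-(Real.pi * Complex.I * conj ζ / t)) ^ m * Complex.exp (-(Real.pi ^ 2 * ‖ζ‖ ^ 2 / t)) :=
    funext (fourier_conjGauss m ht)
  rw [this]; fun_prop

theorem integrable_fourier_conjGauss (m : ℕ) {t : ℝ} (ht : 0 < t) :
    Integrable (𝓕 (conjGauss m t)) := by
  refine ((integrable_pow_mul_gauss m (t := Real.pi ^ 2 / t) (by positivity)).const_mul
    ((Real.pi / t) ^ (m + 1))).mono' (continuous_fourier_conjGauss m ht).aestronglyMeasurable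
    (ae_of_all _ fun ζ => (norm_fourier_conjGauss m ht ζ).le)

theorem integral_norm_fourier_conjGauss (m : ℕ) {t : ℝ} (ht : 0 < t) :
    ∫ ζ, ‖𝓕 (conjGauss m t) ζ‖ =
      Real.Gamma (((m : ℝ) + 2) / 2) * t ^ (-(m : ℝ) / 2) := by
  simp only [norm_fourier_conjGauss m ht]
  rw [integral_const_mul, integral_pow_mul_gauss m (by positivity)]
  have h1 : (Real.pi ^ 2 / t) ^ (-((m : ℝ) + 2) / 2) =
      (Real.pi ^ (m + 2))⁻¹ * (t ^ (m + 1) * t ^ (-(m : ℝ) / 2)) := by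
    rw [Real.div_rpow (by positivity) ht.le, ← Real.rpow_natCast, ← Real.rpow_mul Real.pi_pos.le,
      ← Real.rpow_natCast, ← Real.rpow_neg Real.pi_pos.le, div_eq_mul_inv, ← Real.rpow_neg ht.le,
      ← Real.rpow_natCast, ← Real.rpow_add ht]
    push_cast
    ring_nf
  rw [h1, div_pow]
  field_simp
  ring

theorem integrable_gammaWeight_mul_fourier (m : ℕ) {s : ℂ} (hs : (m : ℝ) / 2 < s.re) {y : ℝ}
    (hy : 0 < y) :
    Integrable (fun p : ℂ × ℝ => gammaWeight s y p.2 * 𝓕 (conjGauss m p.2) p.1)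
      ((volume : Measure ℂ).prod (volume.restrict (Set.Ioi (0 : ℝ)))) := by
  have hmeas : AEStronglyMeasurable
      (fun p : ℂ × ℝ => gammaWeight s y p.2 * 𝓕 (conjGauss m p.2) p.1)
      ((volume : Measure ℂ).prod (volume.restrict (Set.Ioi (0 : ℝ)))) := by
    have h1 : Measurable fun p : ℂ × ℝ => gammaWeight s y p.2 * ((Real.pi / p.2 : ℂ) *
        (-(Real.pi * Complex.I * conj p.1 / p.2)) ^ m *
          Complex.exp (-(Real.pi ^ 2 * ‖p.1‖ ^ 2 / p.2))) := by
      have : Measurable fun p : ℂ × ℝ => conj p.1 := Complex.continuous_conj.measurable.comp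
        measurable_fst
      unfold gammaWeight; fun_prop
    refine h1.aestronglyMeasurable.congr ?_
    have : ∀ᵐ p ∂((volume : Measure ℂ).prod (volume.restrict (Set.Ioi (0 : ℝ)))),
        p.2 ∈ Set.Ioi (0 : ℝ) := by
      have := ae_restrict_mem (μ := (volume : Measure ℝ)) (measurableSet_Ioi (a := (0 : ℝ)))
      exact Measure.quasiMeasurePreserving_snd.ae this
    filter_upwards [this] with p hp
    rw [fourier_conjGauss m hp]
  rw [integrable_prod_iff' hmeas]
  constructor
  · filter_upwards [ae_restrict_mem measurableSet_Ioi] with t ht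
    exact (integrable_fourier_conjGauss m ht).const_mul _
  · have h2 : ∀ t ∈ Set.Ioi (0 : ℝ), ∫ ζ, ‖gammaWeight s y t * 𝓕 (conjGauss m t) ζ‖ =
        Real.Gamma (((m : ℝ) + 2) / 2) *
          ‖(t : ℂ) ^ (s - (m : ℂ) / 2 - 1) * Complex.exp (-((y ^ 2 : ℝ) * t))‖ := by
      intro t ht
      simp only [norm_mul, norm_gammaWeight s y ht]
      rw [integral_const_mul, integral_norm_fourier_conjGauss m ht,
        Complex.norm_cpow_eq_rpow_re_of_pos ht, Complex.norm_exp]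
      have e1 : (s - (m : ℂ) / 2 - 1).re = (s.re - 1) + (-(m : ℝ) / 2) := by
        simp; ring
      have e2 : (-((y ^ 2 : ℝ) * t : ℂ)).re = -(y ^ 2 * t) := by norm_cast
      rw [e1, Real.rpow_add ht, e2]
      ring
    have h3 : IntegrableOn (fun t : ℝ => Real.Gamma (((m : ℝ) + 2) / 2) *
          ‖(t : ℂ) ^ (s - (m : ℂ) / 2 - 1) * Complex.exp (-((y ^ 2 : ℝ) * t))‖) (Set.Ioi 0) :=
      (integrable_cpow_mul_exp_neg_mul (s := s - (m : ℂ) / 2) (by simp; linarith)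
        (by positivity)).norm.const_mul _
    exact h3.congr_fun (fun t ht => (h2 t ht).symm) measurableSet_Ioi

theorem integrable_besselKernel (m : ℕ) {s : ℂ} (hs : (m : ℝ) / 2 < s.re) {y : ℝ} (hy : 0 < y) :
    Integrable (besselKernel m s y) := by
  have hs0 : 0 < s.re := lt_of_le_of_lt (by positivity) hs
  have hG : Complex.Gamma s ≠ 0 := Complex.Gamma_ne_zero_of_re_pos hs0
  have h1 := (integrable_gammaWeight_mul_fourier m hs hy).integral_prod_left
  refine (h1.const_mul (Complex.Gamma s)⁻¹).congr ?_
  have h0 : ∀ᵐ ζ : ℂ, ζ ≠ 0 := by simp [ae_iff]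
  filter_upwards [h0] with ζ hζ
  rw [integral_gammaWeight_mul_fourier m hs0 hy hζ, inv_mul_cancel_left₀ hG]

/-- Fourier inversion for the kernel, by superposition of Gaussians. -/
theorem fourierInv_besselKernel (m : ℕ) {s : ℂ} (hs : (m : ℝ) / 2 < s.re) {y : ℝ} (hy : 0 < y)
    (x : ℂ) :
    𝓕⁻ (besselKernel m s y) x = conj x ^ m * ((‖x‖ ^ 2 + y ^ 2 : ℝ) : ℂ) ^ (-s) := by
  have hs0 : 0 < s.re := lt_of_le_of_lt (by positivity) hs
  have hG : Complex.Gamma s ≠ 0 := Complex.Gamma_ne_zero_of_re_pos hs0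
  apply mul_left_cancel₀ hG
  rw [← integral_gammaWeight_mul_conjGauss m hs0 hy, Real.fourierInv_eq', ← integral_const_mul]
  have hint := integrable_cexp_mul_I_mul (integrable_gammaWeight_mul_fourier m hs hy)
    (c := fun p : ℂ × ℝ => 2 * Real.pi * ⟪p.1, x⟫) (by fun_prop)
  have hswap := integral_integral_swap (f := fun (ζ : ℂ) (t : ℝ) =>
    Complex.exp (((2 * Real.pi * ⟪ζ, x⟫ : ℝ) : ℂ) * Complex.I) *
      (gammaWeight s y t * 𝓕 (conjGauss m t) ζ)) hint
  have h0 : ∀ᵐ ζ : ℂ, ζ ≠ 0 := by simp [ae_iff]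
  have h1 : ∫ ζ : ℂ, Complex.Gamma s * (Complex.exp (((2 * Real.pi * ⟪ζ, x⟫ : ℝ) : ℂ) * Complex.I) •
      besselKernel m s y ζ) = ∫ ζ : ℂ, ∫ t in Set.Ioi (0 : ℝ),
        Complex.exp (((2 * Real.pi * ⟪ζ, x⟫ : ℝ) : ℂ) * Complex.I) *
          (gammaWeight s y t * 𝓕 (conjGauss m t) ζ) := by
    refine integral_congr_ae ?_
    filter_upwards [h0] with ζ hζ
    rw [integral_const_mul, integral_gammaWeight_mul_fourier m hs0 hy hζ, smul_eq_mul]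
    ring
  rw [h1, hswap]
  refine setIntegral_congr_fun measurableSet_Ioi fun t ht => ?_
  have hinv := (continuous_conjGauss m t).fourierInv_fourier_eq (integrable_conjGauss m ht)
    (integrable_fourier_conjGauss m ht)
  have := congrFun hinv x
  rw [← this, Real.fourierInv_eq', ← integral_const_mul]
  congr 1; ext ζ; rw [smul_eq_mul]; ring

theorem norm_besselKernel_norm (m : ℕ) (s : ℂ) (y : ℝ) (ζ : ℂ) :
    ‖besselKernel m s y (‖ζ‖ : ℂ)‖ = ‖besselKernel m s y ζ‖ := by
  simp [besselKernel]

theorem norm_besselKernel_ofReal_sq (m : ℕ) (s : ℂ) {y ρ : ℝ} (hy : 0 < y) (hρ : 0 < ρ) :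
    ‖besselKernel m s y (ρ : ℂ)‖ ^ 2 =
      4 * Real.pi ^ 2 / ‖Complex.Gamma s‖ ^ 2 * y ^ (2 * (m : ℝ) + 2 - 2 * s.re) *
        ((Real.pi * ρ) ^ (2 * s.re - 2) *
          ‖besselK (s - 1 - m) (2 * Real.pi * y * ρ)‖ ^ 2) := by
  have e1 : 2 * (Real.pi * ‖(ρ : ℂ)‖ * y) = 2 * Real.pi * y * ρ := by
    rw [Complex.norm_real, Real.norm_eq_abs, abs_of_pos hρ]; ring
  have hp : 0 < Real.pi * ρ := by positivity
  have e2 : (Real.pi * ρ) ^ (2 * s.re - 2) * y ^ (2 * (m : ℝ) + 2 - 2 * s.re) =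
      ((Real.pi * ρ) ^ m) ^ 2 * ((Real.pi * ρ / y) ^ (s.re - 1 - m)) ^ 2 := by
    rw [← Real.rpow_natCast ((Real.pi * ρ) ^ m), ← Real.rpow_natCast (_ ^ (s.re - 1 - m)),
      ← Real.rpow_natCast (Real.pi * ρ), ← Real.rpow_mul hp.le, ← Real.rpow_mul (by positivity),
      Real.div_rpow hp.le hy.le, div_eq_mul_inv, ← Real.rpow_neg hy.le, ← mul_assoc,
      ← Real.rpow_add hp]
    push_cast
    ring_nf
  rw [besselKernel, e1, norm_mul, norm_mul, norm_div,
    Complex.norm_cpow_eq_rpow_re_of_pos (by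
      rw [Complex.norm_real, Real.norm_eq_abs, abs_of_pos hρ]; positivity)]
  have e3 : (s - 1 - m).re = s.re - 1 - m := by simp
  rw [e3]
  simp only [norm_mul, norm_pow, norm_neg, Complex.norm_real, Complex.norm_I, RCLike.norm_conj,
    Real.norm_eq_abs, abs_of_pos Real.pi_pos, abs_of_pos hρ, mul_one, Complex.norm_ofNat]
  calc _ = 4 * Real.pi ^ 2 / ‖Complex.Gamma s‖ ^ 2 *
      (((Real.pi * ρ) ^ m) ^ 2 * ((Real.pi * ρ / y) ^ (s.re - 1 - m)) ^ 2) *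
        ‖besselK (s - 1 - m) (2 * Real.pi * y * ρ)‖ ^ 2 := by ring
    _ = _ := by rw [← e2]; ring

/-- The kernel is square integrable: in polar coordinates its square is the integrand of a Mellin
transform of `|K_ν|²`. -/
theorem memLp_two_besselKernel (m : ℕ) {s : ℂ} (hs : ((m : ℝ) + 1) / 2 < s.re) {y : ℝ}
    (hy : 0 < y) : MemLp (besselKernel m s y) 2 := by
  have hI := integrable_besselKernel m (s := s) (by linarith) hy
  rw [memLp_two_iff_integrable_sq_norm hI.1]
  have h1 : (fun ζ => ‖besselKernel m s y ζ‖ ^ 2) =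
      fun ζ => (fun ρ : ℝ => ‖besselKernel m s y (ρ : ℂ)‖ ^ 2) ‖ζ‖ := by
    ext ζ; simp only [norm_besselKernel_norm]
  rw [h1, integrable_fun_norm_addHaar (E := ℂ) volume (f := fun ρ : ℝ => ‖besselKernel m s y (ρ : ℂ)‖ ^ 2)]
  set ν := s - 1 - m with hν
  have hre : |ν.re| + |(conj ν).re| < ((2 * s.re : ℝ) : ℂ).re := by
    have : |ν.re| < s.re := by
      rw [hν, abs_lt]
      constructor <;> simp <;> linarith [Nat.cast_nonneg (α := ℝ) m]
    rw [Complex.conj_re, Complex.ofReal_re]; linarith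
  have hM := (mellin_besselK_mul_besselK hre).1.norm
  have hc : 0 < 2 * Real.pi * y := by positivity
  rw [← mul_zero (2 * Real.pi * y)] at hM
  have hM' := (integrableOn_Ioi_comp_mul_left_iff
    (fun x : ℝ => ‖(x : ℂ) ^ (((2 * s.re : ℝ) : ℂ) - 1) * (besselK ν x * besselK (conj ν) x)‖)
      0 hc).2 hM
  refine IntegrableOn.congr_fun (hM'.const_mul (4 * Real.pi ^ 2 / ‖Complex.Gamma s‖ ^ 2 *
      y ^ (2 * (m : ℝ) + 2 - 2 * s.re) * (Real.pi ^ (2 * s.re - 2) *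
        (2 * Real.pi * y) ^ (1 - 2 * s.re)))) (fun ρ hρ => ?_) measurableSet_Ioi
  have hρ' : 0 < ρ := hρ
  rw [norm_besselKernel_ofReal_sq m s hy hρ', ← besselK_conj, norm_mul, norm_mul, RCLike.norm_conj,
    Complex.norm_cpow_eq_rpow_re_of_pos (by positivity), ← hν]
  have e1 : (((2 * s.re : ℝ) : ℂ) - 1).re = 2 * s.re - 1 := by simp
  rw [e1, Real.mul_rpow hc.le hρ'.le, Real.mul_rpow Real.pi_pos.le hρ'.le]
  have e2 : (2 * Real.pi * y) ^ (1 - 2 * s.re) * (2 * Real.pi * y) ^ (2 * s.re - 1) = 1 := by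
    rw [← Real.rpow_add hc]; simp
  have e3 : ρ ^ (2 * s.re - 1) = ρ * ρ ^ (2 * s.re - 2) := by
    rw [show 2 * s.re - 1 = 1 + (2 * s.re - 2) by ring, Real.rpow_add hρ', Real.rpow_one]
  rw [e3]
  simp only [Complex.finrank_real_complex, smul_eq_mul]
  norm_num
  linear_combination (4 * Real.pi ^ 2 / ‖Complex.Gamma s‖ ^ 2 *
      y ^ (2 * (m : ℝ) + 2 - 2 * s.re) * Real.pi ^ (2 * s.re - 2) * ρ * ρ ^ (2 * s.re - 2) *
      ‖besselK ν (2 * Real.pi * y * ρ)‖ ^ 2) * e2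

/-! ### Plancherel's formula for integrable square integrable functions -/

theorem continuous_fourier_of_integrable {f : ℂ → ℂ} (hf : Integrable f) : Continuous (𝓕 f) :=
  VectorFourier.fourierIntegral_continuous Real.continuous_fourierChar
    (innerSL ℝ).continuous₂ hf

theorem integral_inner_fourier_left {f g : ℂ → ℂ} (hf : Integrable f) (hg : Integrable g) :
    ∫ x, inner ℂ (𝓕 f x) (g x) = ∫ x, inner ℂ (f x) (𝓕⁻ g x) := by
  have := VectorFourier.integral_sesq_fourierIntegral_eq_neg_flip (innerSL ℂ (E := ℂ))
    (L := innerₗ ℂ) (μ := volume) (ν := volume) Real.continuous_fourierChar continuous_inner hf hg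
  simpa using! this

/-- The Fourier integral of a function in `L¹ ∩ L²` represents its `L²` Fourier transform. -/
theorem coeFn_fourier_toLp {f : ℂ → ℂ} (h1 : Integrable f) (h2 : MemLp f 2) :
    (𝓕 (h2.toLp f) : Lp ℂ 2 (volume : Measure ℂ)) =ᵐ[volume] 𝓕 f := by
  have hFc : Continuous (𝓕 f) := continuous_fourier_of_integrable h1
  refine ae_eq_of_integral_contDiff_smul_eq ?_ hFc.locallyIntegrable ?_
  · exact (Lp.memLp _).locallyIntegrable (by norm_num)
  · intro g hg hgc
    have hg' : ContDiff ℝ (⊤ : ℕ∞) fun x => ((g x : ℝ) : ℂ) :=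
      Complex.ofRealCLM.contDiff.comp hg
    have hgc' : HasCompactSupport fun x => ((g x : ℝ) : ℂ) :=
      hgc.comp_left (g := fun r : ℝ => (r : ℂ)) (by simp)
    set φ : SchwartzMap ℂ ℂ := hgc'.toSchwartzMap hg' with hφ
    have hφx (x : ℂ) : φ x = (g x : ℂ) := rfl
    have hinv : 𝓕 (𝓕⁻ φ) = φ := FourierTransform.fourier_fourierInv_eq φ
    have key : inner ℂ (𝓕 (h2.toLp f)) (𝓕 ((𝓕⁻ φ).toLp 2 (volume : Measure ℂ))) =
        inner ℂ (h2.toLp f) ((𝓕⁻ φ).toLp 2 (volume : Measure ℂ)) := Lp.inner_fourier_eq _ _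
    rw [SchwartzMap.toLp_fourier_eq, hinv] at key
    have e1 : inner ℂ (𝓕 (h2.toLp f)) (φ.toLp 2 (volume : Measure ℂ)) =
        conj (∫ x, g x • (𝓕 (h2.toLp f) : Lp ℂ 2 (volume : Measure ℂ)) x) := by
      rw [L2.inner_def, ← integral_conj]
      refine integral_congr_ae ?_
      filter_upwards [φ.coeFn_toLp 2 (volume : Measure ℂ)] with x hx
      rw [hx, hφx]
      simp
    have e2 : inner ℂ (h2.toLp f) ((𝓕⁻ φ).toLp 2 (volume : Measure ℂ)) =
        conj (∫ x, g x • 𝓕 f x) := by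
      rw [L2.inner_def, ← integral_conj]
      have h3 := integral_inner_fourier_left h1 φ.integrable
      have h4 : ∫ x, inner ℂ (𝓕 f x) (φ x) = ∫ x, conj (g x • 𝓕 f x) := by
        congr 1; ext x; rw [hφx]; simp
      rw [← h4, h3]
      refine integral_congr_ae ?_
      filter_upwards [(𝓕⁻ φ).coeFn_toLp 2 (volume : Measure ℂ), h2.coeFn_toLp] with x hx hx2
      rw [hx, hx2, SchwartzMap.fourierInv_coe]
    rw [e1, e2] at key
    exact (starRingEnd ℂ).injective key

theorem memLp_two_fourier {f : ℂ → ℂ} (h1 : Integrable f) (h2 : MemLp f 2) : MemLp (𝓕 f) 2 :=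
  (memLp_congr_ae (coeFn_fourier_toLp h1 h2)).1 (Lp.memLp _)

theorem integral_inner_fourier {f g : ℂ → ℂ} (hf1 : Integrable f) (hf2 : MemLp f 2)
    (hg1 : Integrable g) (hg2 : MemLp g 2) :
    ∫ x, inner ℂ (𝓕 f x) (𝓕 g x) = ∫ x, inner ℂ (f x) (g x) := by
  have key : inner ℂ (𝓕 (hf2.toLp f)) (𝓕 (hg2.toLp g)) = inner ℂ (hf2.toLp f) (hg2.toLp g) :=
    Lp.inner_fourier_eq _ _
  rw [L2.inner_def, L2.inner_def] at key
  have e1 : ∫ x, inner ℂ (𝓕 f x) (𝓕 g x) =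
      ∫ x, inner ℂ ((𝓕 (hf2.toLp f) : Lp ℂ 2 (volume : Measure ℂ)) x)
        ((𝓕 (hg2.toLp g) : Lp ℂ 2 (volume : Measure ℂ)) x) := by
    refine integral_congr_ae ?_
    filter_upwards [coeFn_fourier_toLp hf1 hf2, coeFn_fourier_toLp hg1 hg2] with x h h'
    rw [h, h']
  rw [e1, key]
  refine integral_congr_ae ?_
  filter_upwards [hf2.coeFn_toLp, hg2.coeFn_toLp] with x h h'
  rw [h, h']

/-- Parseval's formula for the inverse Fourier transform. -/
theorem integral_fourierInv_mul_conj {f g : ℂ → ℂ} (hf1 : Integrable f) (hf2 : MemLp f 2)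
    (hg1 : Integrable g) (hg2 : MemLp g 2) :
    ∫ x, 𝓕⁻ f x * conj (𝓕⁻ g x) = ∫ x, f x * conj (g x) := by
  have h := integral_inner_fourier hg1 hg2 hf1 hf2
  rw [← integral_neg_eq_self] at h
  simp only [← Real.fourierInv_eq_fourier_neg] at h
  simpa [RCLike.inner_apply] using h

theorem lintegral_enorm_fourierInv_sq {f : ℂ → ℂ} (hf1 : Integrable f) (hf2 : MemLp f 2) :
    ∫⁻ x, ‖𝓕⁻ f x‖ₑ ^ 2 = ∫⁻ x, ‖f x‖ₑ ^ 2 := by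
  have hm : MemLp (𝓕⁻ f) 2 := by
    have h0 := memLp_two_fourier hf1 hf2
    rw [funext (Real.fourierInv_eq_fourier_neg f)]
    exact h0.comp_measurePreserving (Measure.measurePreserving_neg _)
  have h := integral_fourierInv_mul_conj hf1 hf2 hf1 hf2
  have e (u : ℂ → ℂ) : (fun x => u x * conj (u x)) = fun x => ((‖u x‖ ^ 2 : ℝ) : ℂ) := by
    ext x; rw [Complex.mul_conj, Complex.normSq_eq_norm_sq]
  rw [e, e, integral_complex_ofReal, integral_complex_ofReal] at h
  have h' := congrArg ENNReal.ofReal (Complex.ofReal_injective h)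
  rw [ofReal_integral_eq_lintegral_ofReal ((memLp_two_iff_integrable_sq_norm hm.1).1 hm)
      (ae_of_all _ fun x => by positivity),
    ofReal_integral_eq_lintegral_ofReal ((memLp_two_iff_integrable_sq_norm hf2.1).1 hf2)
      (ae_of_all _ fun x => by positivity)] at h'
  simpa [ENNReal.ofReal_pow] using h'

/-! ### Convergence of the truncated Fourier integral -/

theorem conj_addChar (x : ℂ) :
    conj (addChar x) = Complex.exp (((-2 * Real.pi * ⟪x, 2⟫ : ℝ) : ℂ) * Complex.I) := by
  rw [addChar, ← Complex.exp_conj, Complex.inner]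
  congr 1
  apply Complex.ext
  · simp
  · simp; ring

theorem norm_addChar (x : ℂ) : ‖addChar x‖ = 1 := by
  rw [← RCLike.norm_conj, conj_addChar, Complex.norm_exp_ofReal_mul_I]

theorem addChar_add (x y : ℂ) : addChar (x + y) = addChar x * addChar y := by
  rw [addChar, addChar, addChar, ← Complex.exp_add, map_add]; ring_nf

theorem continuous_addChar : Continuous addChar := by unfold addChar; fun_prop

theorem conj_addChar_add_quarter (x : ℂ) : conj (addChar (x + 1 / 4)) = -conj (addChar x) := by
  have : addChar (1 / 4) = -1 := by
    rw [addChar, ← Complex.exp_pi_mul_I]; congr 1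
    rw [show (1 / 4 : ℂ) = ((1 / 4 : ℝ) : ℂ) by push_cast; rfl, Complex.conj_ofReal]
    push_cast; ring
  rw [addChar_add, this]; simp

/-- A Gaussian tail dominates every power. -/
theorem pow_mul_exp_neg_sq_le (n : ℕ) {w : ℝ} (hw : 0 ≤ w) :
    w ^ n * Real.exp (-(w ^ 2 / 4)) ≤ 1 + 4 ^ n * n.factorial := by
  have h1 : (w ^ 2 / 4) ^ n / n.factorial ≤ Real.exp (w ^ 2 / 4) :=
    Real.pow_div_factorial_le_exp _ (by positivity) n
  have h2 : w ^ n ≤ 1 + (w ^ 2) ^ n := by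
    rcases le_total w 1 with h | h
    · have := pow_le_one₀ hw h (n := n); nlinarith [pow_nonneg (sq_nonneg w) n]
    · have : w ^ n ≤ (w ^ 2) ^ n := pow_le_pow_left₀ hw (by nlinarith) n
      linarith
  have h3 : (w ^ 2) ^ n ≤ 4 ^ n * n.factorial * Real.exp (w ^ 2 / 4) := by
    rw [div_le_iff₀ (by positivity), div_pow, div_le_iff₀ (by positivity)] at h1
    linarith
  rw [Real.exp_neg, ← div_eq_mul_inv, div_le_iff₀ (Real.exp_pos _)]
  have h4 : 1 ≤ Real.exp (w ^ 2 / 4) := Real.one_le_exp (by positivity)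
  nlinarith

theorem integral_norm_fderiv_conjGauss_le (m : ℕ) : ∃ C : ℝ, 0 ≤ C ∧ ∀ t : ℝ, 0 < t →
    ∫ x, ‖fderiv ℝ (conjGauss m t) x‖ ≤ C * t ^ (-((m : ℝ) + 1) / 2) := by
  refine ⟨m * (Real.pi * Real.Gamma (((m - 1 : ℕ) + 2 : ℝ) / 2)) +
    2 * (Real.pi * Real.Gamma (((m + 1 : ℕ) + 2 : ℝ) / 2)), ?_, fun t ht => ?_⟩
  · have h1 := (Real.Gamma_pos_of_pos (s := ((m - 1 : ℕ) + 2 : ℝ) / 2) (by positivity)).le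
    have h2 := (Real.Gamma_pos_of_pos (s := ((m + 1 : ℕ) + 2 : ℝ) / 2) (by positivity)).le
    positivity
  · refine (integral_mono (integrable_fderiv_conjGauss m ht).norm
      (((integrable_pow_mul_gauss (m - 1) ht).const_mul m).add
        ((integrable_pow_mul_gauss (m + 1) ht).const_mul (2 * t)))
      (norm_fderiv_conjGauss_le m ht)).trans (le_of_eq ?_)
    simp only [Pi.add_apply]
    rw [integral_add ((integrable_pow_mul_gauss (m - 1) ht).const_mul m)
      ((integrable_pow_mul_gauss (m + 1) ht).const_mul (2 * t)), integral_const_mul,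
      integral_const_mul, integral_pow_mul_gauss _ ht, integral_pow_mul_gauss _ ht]
    have e1 : t * t ^ (-((m + 1 : ℕ) + 2 : ℝ) / 2) = t ^ (-((m : ℝ) + 1) / 2) := by
      rw [← Real.rpow_one_add' ht.le]
      · congr 1; push_cast; ring
      · push_cast
        have : (0 : ℝ) ≤ m := by positivity
        linarith
    have e2 : (m : ℝ) * t ^ (-((m - 1 : ℕ) + 2 : ℝ) / 2) = m * t ^ (-((m : ℝ) + 1) / 2) := by
      rcases Nat.eq_zero_or_pos m with h | h
      · simp [h]
      · congr 2; rw [Nat.cast_sub h]; push_cast; ring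
    linear_combination (Real.pi * Real.Gamma (((m - 1 : ℕ) + 2 : ℝ) / 2)) * e2 +
      2 * (Real.pi * Real.Gamma (((m + 1 : ℕ) + 2 : ℝ) / 2)) * e1

/-- The `L¹` modulus of continuity is controlled by the `L¹` norm of the derivative. -/
theorem integral_norm_sub_translate_le {h : ℂ → ℂ} (hh : ContDiff ℝ 1 h)
    (hi : Integrable (fderiv ℝ h)) :
    ∫ x, ‖h x - h (x + 1 / 4)‖ ≤ ∫ x, ‖fderiv ℝ h x‖ := by
  have hD : Continuous (fderiv ℝ h) := hh.continuous_fderiv (by norm_num)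
  have hpt (x : ℂ) : ‖h x - h (x + 1 / 4)‖ₑ ≤
      ∫⁻ u in Set.Ioc (0 : ℝ) (1 / 4), ‖fderiv ℝ h (x + (u : ℂ))‖ₑ := by
    have hd (u : ℝ) : HasDerivAt (fun u : ℝ => h (x + (u : ℂ))) (fderiv ℝ h (x + (u : ℂ)) 1) u := by
      have h1 : HasDerivAt (fun u : ℝ => x + (u : ℂ)) 1 u :=
        (Complex.ofRealCLM.hasDerivAt (x := u)).const_add x
      exact ((hh.differentiable (by norm_num) (x + (u : ℂ))).hasFDerivAt).comp_hasDerivAt u h1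
    have hint : IntervalIntegrable (fun u : ℝ => fderiv ℝ h (x + (u : ℂ)) 1) volume 0 (1 / 4) := by
      apply Continuous.intervalIntegrable
      fun_prop
    have := intervalIntegral.integral_eq_sub_of_hasDerivAt (fun u _ => hd u) hint
    have e : h x - h (x + 1 / 4) = -∫ u in (0 : ℝ)..(1 / 4), fderiv ℝ h (x + (u : ℂ)) 1 := by
      rw [this]; simp
    rw [e, enorm_neg, intervalIntegral.integral_of_le (by norm_num)]
    refine (enorm_integral_le_lintegral_enorm _).trans (lintegral_mono fun u => ?_)
    have := (fderiv ℝ h (x + (u : ℂ))).le_opNorm 1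
    rw [norm_one, mul_one] at this
    exact enorm_le_iff_norm_le.2 this
  have hle : ∫⁻ x, ‖h x - h (x + 1 / 4)‖ₑ ≤ ∫⁻ x, ‖fderiv ℝ h x‖ₑ := by
    refine (lintegral_mono hpt).trans ?_
    rw [lintegral_lintegral_swap (by
      apply Measurable.aemeasurable
      apply Measurable.enorm
      exact (hD.comp (by fun_prop : Continuous fun p : ℂ × ℝ => p.1 + (p.2 : ℂ))).measurable)]
    have (u : ℝ) : ∫⁻ x : ℂ, ‖fderiv ℝ h (x + (u : ℂ))‖ₑ = ∫⁻ x, ‖fderiv ℝ h x‖ₑ :=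
      lintegral_add_right_eq_self (fun x => ‖fderiv ℝ h x‖ₑ) (u : ℂ)
    simp only [this]
    rw [lintegral_const, Measure.restrict_apply MeasurableSet.univ, Set.univ_inter,
      Real.volume_Ioc]
    refine mul_le_of_le_one_right zero_le ?_
    rw [ENNReal.ofReal_le_one]; norm_num
  rw [integral_norm_eq_lintegral_enorm hi.1,
    integral_norm_eq_lintegral_enorm (by
      have := hh.continuous
      exact Continuous.aestronglyMeasurable (by fun_prop))]
  exact ENNReal.toReal_mono hi.2.ne hle

/-- Integrals over the disc of radius `R` and over its translate by a half period of the character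
differ by an integral over an annulus. -/
theorem norm_two_mul_integral_closedBall_le {h : ℂ → ℂ} (hh : ContDiff ℝ 1 h)
    (hi : Integrable h) (hi' : Integrable (fderiv ℝ h)) (R : ℝ) :
    ‖2 * ∫ x in Metric.closedBall (0 : ℂ) R, h x * conj (addChar x)‖ ≤
      (∫ x, ‖fderiv ℝ h x‖) +
        ∫ x in Metric.closedBall (0 : ℂ) (R + 1 / 4) \ Metric.ball (0 : ℂ) (R - 1 / 4), ‖h x‖ := by
  set B := Metric.closedBall (0 : ℂ) R
  set B' := Metric.closedBall (1 / 4 : ℂ) R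
  set A := Metric.closedBall (0 : ℂ) (R + 1 / 4) \ Metric.ball (0 : ℂ) (R - 1 / 4)
  set F : ℂ → ℂ := fun x => h x * conj (addChar x) with hF
  have hBm : MeasurableSet B := measurableSet_closedBall
  have hBm' : MeasurableSet B' := measurableSet_closedBall
  have hAm : MeasurableSet A := measurableSet_closedBall.diff measurableSet_ball
  have hFi : Integrable F := by
    have := integrable_cexp_mul_I_mul hi (c := fun x : ℂ => -2 * Real.pi * ⟪x, 2⟫) (by fun_prop)
    refine this.congr (ae_of_all _ fun x => ?_)
    simp only [hF, conj_addChar]; ring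
  have hFn (x : ℂ) : ‖F x‖ = ‖h x‖ := by
    simp only [hF]; rw [norm_mul, RCLike.norm_conj, norm_addChar, mul_one]
  have htr : ∫ x in B, F (x + 1 / 4) = ∫ x in B', F x := by
    rw [← integral_indicator hBm, ← integral_indicator hBm',
      ← integral_add_right_eq_self (B'.indicator F) (1 / 4 : ℂ)]
    congr 1; ext x
    have : x + 1 / 4 ∈ B' ↔ x ∈ B := by simp [B, B']
    by_cases hx : x ∈ B
    · rw [Set.indicator_of_mem hx, Set.indicator_of_mem (this.2 hx)]
    · rw [Set.indicator_of_notMem hx, Set.indicator_of_notMem (fun h => hx (this.1 h))]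
  have hFt : Integrable fun x => F (x + 1 / 4) := hFi.comp_add_right _
  have e1 : ∫ x in B, (h x - h (x + 1 / 4)) * conj (addChar x) = (∫ x in B, F x) + ∫ x in B', F x := by
    rw [← htr, ← integral_add hFi.integrableOn hFt.integrableOn]
    congr 1; ext x
    simp only [hF, conj_addChar_add_quarter]; ring
  have e2 : 2 * ∫ x in B, F x = (∫ x in B, (h x - h (x + 1 / 4)) * conj (addChar x)) +
      ∫ x, (B.indicator F x - B'.indicator F x) := by
    rw [e1, integral_sub (hFi.indicator hBm) (hFi.indicator hBm'), integral_indicator hBm,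
      integral_indicator hBm']
    ring
  rw [e2]
  refine (norm_add_le _ _).trans (add_le_add ?_ ?_)
  · refine (norm_integral_le_integral_norm _).trans ?_
    have e3 : (fun x => ‖(h x - h (x + 1 / 4)) * conj (addChar x)‖) =
        fun x => ‖h x - h (x + 1 / 4)‖ := by
      ext x; rw [norm_mul, RCLike.norm_conj, norm_addChar, mul_one]
    rw [e3]
    refine le_trans (setIntegral_le_integral (hi.sub (hi.comp_add_right _)).norm
      (ae_of_all _ fun x => norm_nonneg _)) (integral_norm_sub_translate_le hh hi')
  · refine (norm_integral_le_integral_norm _).trans ?_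
    rw [← integral_indicator hAm]
    refine integral_mono_of_nonneg (ae_of_all _ fun x => norm_nonneg _) (hi.norm.indicator hAm)
      (ae_of_all _ fun x => ?_)
    simp only
    have hquarter : ‖(1 / 4 : ℂ)‖ = 1 / 4 := by norm_num
    by_cases hx : x ∈ A
    · rw [Set.indicator_of_mem hx, ← hFn]
      by_cases h1 : x ∈ B <;> by_cases h2 : x ∈ B' <;> simp [h1, h2]
    · rw [Set.indicator_of_notMem hx]
      have hBB : x ∈ B ↔ x ∈ B' := by
        simp only [A, Set.mem_sdiff, Metric.mem_closedBall, Metric.mem_ball, dist_zero_right, not_and,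
          not_not] at hx
        simp only [B, B', Metric.mem_closedBall, dist_eq_norm, sub_zero]
        have t1 := norm_sub_le x (1 / 4 : ℂ)
        have t2 := norm_sub_norm_le x (1 / 4 : ℂ)
        rw [hquarter] at t1 t2
        constructor
        · intro h1
          have := hx (by linarith)
          linarith
        · intro h1
          have := hx (by linarith)
          linarith
      by_cases h1 : x ∈ B
      · simp [h1, hBB.1 h1]
      · simp [h1, show x ∉ B' from fun h => h1 (hBB.2 h)]

theorem volume_real_annulus {R : ℝ} (hR : 1 ≤ R) :
    (volume : Measure ℂ).real
      (Metric.closedBall (0 : ℂ) (R + 1 / 4) \ Metric.ball (0 : ℂ) (R - 1 / 4)) = Real.pi * R := by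
  rw [measureReal_sdiff (Metric.ball_subset_closedBall.trans
      (Metric.closedBall_subset_closedBall (by linarith))) measurableSet_ball
      (h₁ := measure_closedBall_lt_top.ne),
    Measure.real, Measure.real, Complex.volume_closedBall, Complex.volume_ball,
    ENNReal.toReal_mul, ENNReal.toReal_mul, ENNReal.toReal_pow, ENNReal.toReal_pow,
    ENNReal.toReal_ofReal (by linarith), ENNReal.toReal_ofReal (by linarith)]
  simp only [ENNReal.coe_toReal, NNReal.coe_real_pi]
  ring

/-- The bound that makes the truncated integrals of `x̄ ^ m exp(-t |x|²)` against the character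
integrable at `t = 0` with respect to the weight `t ^ (m / 2) dt`; without the oscillation of the
character the exponent would be `-(m + 2) / 2`. -/
theorem exists_norm_truncated_conjGauss_le (m : ℕ) : ∃ C : ℝ, ∀ x₀ : ℂ, ∀ R : ℝ,
    1 + 4 * ‖x₀‖ ≤ R → ∀ t : ℝ, 0 < t →
    ‖∫ x in Metric.closedBall (0 : ℂ) R, conjGauss m t (x + x₀) * conj (addChar x)‖ ≤
      C * t ^ (-((m : ℝ) + 1) / 2) := by
  obtain ⟨C, hC0, hC⟩ := integral_norm_fderiv_conjGauss_le m
  refine ⟨C + Real.pi * (2 ^ m * (1 + 4 ^ (m + 1) * (m + 1).factorial)), fun x₀ R hR t ht => ?_⟩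
  have hx₀ := norm_nonneg x₀
  have hder : fderiv ℝ (fun x => conjGauss m t (x + x₀)) =
      fun x => fderiv ℝ (conjGauss m t) (x + x₀) := by
    ext1 x; exact fderiv_comp_add_right x₀
  have h1 := norm_two_mul_integral_closedBall_le (h := fun x => conjGauss m t (x + x₀))
    ((contDiff_conjGauss m t).comp (contDiff_id.add contDiff_const))
    ((integrable_conjGauss m ht).comp_add_right x₀)
    (by rw [hder]; exact (integrable_fderiv_conjGauss m ht).comp_add_right x₀) R
  rw [hder, integral_add_right_eq_self (fun x => ‖fderiv ℝ (conjGauss m t) x‖) x₀, norm_mul] at h1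
  have h2 : ∫ x in Metric.closedBall (0 : ℂ) (R + 1 / 4) \ Metric.ball (0 : ℂ) (R - 1 / 4),
      ‖conjGauss m t (x + x₀)‖ ≤
        Real.pi * (2 ^ m * (1 + 4 ^ (m + 1) * (m + 1).factorial)) * t ^ (-((m : ℝ) + 1) / 2) := by
    have hb : ∀ x ∈ Metric.closedBall (0 : ℂ) (R + 1 / 4) \ Metric.ball (0 : ℂ) (R - 1 / 4),
        ‖‖conjGauss m t (x + x₀)‖‖ ≤ (2 * R) ^ m * Real.exp (-t * (R / 2) ^ 2) := by
      intro x hx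
      simp only [Set.mem_sdiff, Metric.mem_closedBall, Metric.mem_ball, dist_zero_right,
        not_lt] at hx
      have t1 := norm_add_le x x₀
      have t2 := norm_sub_le (x + x₀) x₀
      rw [add_sub_cancel_right] at t2
      rw [norm_norm, norm_conjGauss]
      have hlow : R / 2 ≤ ‖x + x₀‖ := by linarith
      have hup : ‖x + x₀‖ ≤ 2 * R := by linarith
      have : -t * ‖x + x₀‖ ^ 2 ≤ -t * (R / 2) ^ 2 := by
        have := pow_le_pow_left₀ (by linarith) hlow 2
        nlinarith
      have hR0 : 0 ≤ 2 * R := by linarith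
      gcongr
    have := norm_setIntegral_le_of_norm_le_const (μ := volume) (by
      refine lt_of_le_of_lt (measure_mono Set.sdiff_subset) measure_closedBall_lt_top) hb
    rw [volume_real_annulus (by linarith)] at this
    refine (le_abs_self _).trans (this.trans ?_)
    set w := √t * R with hw
    have hw0 : 0 ≤ w := by have := Real.sqrt_nonneg t; nlinarith
    have hw2 : w ^ 2 = t * R ^ 2 := by rw [hw, mul_pow, Real.sq_sqrt ht.le]
    have hwp : R ^ (m + 1) = w ^ (m + 1) * t ^ (-((m : ℝ) + 1) / 2) := by
      have e : t ^ (-((m : ℝ) + 1) / 2) = (√t ^ (m + 1))⁻¹ := by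
        rw [Real.sqrt_eq_rpow, ← Real.rpow_natCast, ← Real.rpow_mul ht.le, ← Real.rpow_neg ht.le]
        congr 1; push_cast; ring
      have := Real.sqrt_pos.2 ht
      rw [e, hw, mul_pow]; field_simp
    have hkey := pow_mul_exp_neg_sq_le (m + 1) hw0
    have hexp : -t * (R / 2) ^ 2 = -(w ^ 2 / 4) := by rw [hw2]; ring
    rw [hexp]
    have htp : 0 ≤ t ^ (-((m : ℝ) + 1) / 2) := by positivity
    calc (2 * R) ^ m * Real.exp (-(w ^ 2 / 4)) * (Real.pi * R)
        = Real.pi * 2 ^ m * (R ^ (m + 1) * Real.exp (-(w ^ 2 / 4))) := by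
          rw [mul_pow, pow_succ]; ring
      _ = Real.pi * 2 ^ m * t ^ (-((m : ℝ) + 1) / 2) *
          (w ^ (m + 1) * Real.exp (-(w ^ 2 / 4))) := by rw [hwp]; ring
      _ ≤ Real.pi * 2 ^ m * t ^ (-((m : ℝ) + 1) / 2) * (1 + 4 ^ (m + 1) * (m + 1).factorial) := by
          gcongr
      _ = _ := by ring
  have h3 := hC t ht
  simp only [Complex.norm_ofNat] at h1
  have h4 := norm_nonneg
    (∫ x in Metric.closedBall (0 : ℂ) R, conjGauss m t (x + x₀) * conj (addChar x))
  nlinarith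

/-- The conditionally convergent Fourier integral of `x̄ ^ m (|x|² + y²) ^ (-s)` at the character
`ψ`, with discs centered at an arbitrary point. -/
theorem tendsto_truncated_fourier (m : ℕ) {s : ℂ} (hs : (m : ℝ) / 2 + 1 ≤ s.re) {y : ℝ} (hy : 0 < y)
    (x₀ : ℂ) :
    Tendsto (fun R : ℝ => ∫ x in Metric.closedBall (0 : ℂ) R,
      (conj (x + x₀) ^ m * ((‖x + x₀‖ ^ 2 + y ^ 2 : ℝ) : ℂ) ^ (-s)) * conj (addChar x)) atTop
      (𝓝 (addChar x₀ * besselKernel m s y 2)) := by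
  have hm0 : (0 : ℝ) ≤ m := by positivity
  have hs0 : 0 < s.re := by linarith
  have hG : Complex.Gamma s ≠ 0 := Complex.Gamma_ne_zero_of_re_pos hs0
  obtain ⟨C, hC⟩ := exists_norm_truncated_conjGauss_le m
  set G : ℝ → ℝ → ℂ := fun R t =>
    ∫ x in Metric.closedBall (0 : ℂ) R, conjGauss m t (x + x₀) * conj (addChar x) with hGdef
  have hint (R : ℝ) : Integrable (fun p : ℂ × ℝ =>
      (gammaWeight s y p.2 * conjGauss m p.2 (p.1 + x₀)) * conj (addChar p.1))
      ((volume.restrict (Metric.closedBall (0 : ℂ) R)).prod (volume.restrict (Set.Ioi (0 : ℝ)))) := by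
    have hfin : IsFiniteMeasure (volume.restrict (Metric.closedBall (0 : ℂ) R)) :=
      ⟨by rw [Measure.restrict_apply_univ]; exact measure_closedBall_lt_top⟩
    have i1 : Integrable (fun t : ℝ => gammaWeight s y t) (volume.restrict (Set.Ioi (0 : ℝ))) :=
      integrable_cpow_mul_exp_neg_mul hs0 (by positivity)
    have i2 : IntegrableOn (fun x : ℂ => ‖x + x₀‖ ^ m) (Metric.closedBall (0 : ℂ) R) :=
      (Continuous.continuousOn (by fun_prop)).integrableOn_compact (isCompact_closedBall _ _)
    refine (i2.mul_prod i1.norm).mono ?_ ?_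
    · apply Measurable.aestronglyMeasurable
      have h1 := continuous_addChar.measurable
      have h2 : Measurable fun x : ℂ => conj x := Complex.continuous_conj.measurable
      have h3 : Measurable fun p : ℂ × ℝ => conj (addChar p.1) := h2.comp (h1.comp measurable_fst)
      have h4 : Measurable fun p : ℂ × ℝ => conj (p.1 + x₀) := h2.comp (by fun_prop)
      unfold gammaWeight conjGauss
      fun_prop
    · have : ∀ᵐ p ∂((volume.restrict (Metric.closedBall (0 : ℂ) R)).prod
          (volume.restrict (Set.Ioi (0 : ℝ)))), p.2 ∈ Set.Ioi (0 : ℝ) := by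
        have := ae_restrict_mem (μ := (volume : Measure ℝ)) (measurableSet_Ioi (a := (0 : ℝ)))
        exact Measure.quasiMeasurePreserving_snd.ae this
      filter_upwards [this] with p hp
      have hp' : 0 < p.2 := hp
      rw [norm_mul, RCLike.norm_conj, norm_addChar, mul_one, norm_mul, norm_conjGauss, norm_mul,
        norm_pow, norm_norm, norm_norm, mul_comm (‖p.1 + x₀‖ ^ m) ‖gammaWeight s y p.2‖]
      refine mul_le_mul_of_nonneg_left ?_ (norm_nonneg _)
      refine mul_le_of_le_one_right (by positivity) ?_
      rw [Real.exp_le_one_iff]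
      nlinarith [sq_nonneg ‖p.1 + x₀‖]
  -- the truncated integral as a superposition of truncated Gaussian integrals
  have hswap (R : ℝ) : ∫ x in Metric.closedBall (0 : ℂ) R,
      (conj (x + x₀) ^ m * ((‖x + x₀‖ ^ 2 + y ^ 2 : ℝ) : ℂ) ^ (-s)) * conj (addChar x) =
      (Complex.Gamma s)⁻¹ * ∫ t in Set.Ioi (0 : ℝ), gammaWeight s y t * G R t := by
    have h1 := integral_integral_swap (f := fun (x : ℂ) (t : ℝ) =>
      (gammaWeight s y t * conjGauss m t (x + x₀)) * conj (addChar x)) (hint R)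
    have h2 (x : ℂ) : ∫ t in Set.Ioi (0 : ℝ),
        (gammaWeight s y t * conjGauss m t (x + x₀)) * conj (addChar x) = Complex.Gamma s *
        ((conj (x + x₀) ^ m * ((‖x + x₀‖ ^ 2 + y ^ 2 : ℝ) : ℂ) ^ (-s)) * conj (addChar x)) := by
      rw [integral_mul_const, integral_gammaWeight_mul_conjGauss m hs0 hy]; ring
    simp only [h2] at h1
    rw [integral_const_mul] at h1
    rw [eq_inv_mul_iff_mul_eq₀ hG, h1]
    congr 1; ext t
    simp only [hGdef, mul_assoc]
    rw [integral_const_mul]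
  have hlimG (t : ℝ) (ht : 0 < t) :
      Tendsto (fun R => G R t) atTop (𝓝 (addChar x₀ * 𝓕 (conjGauss m t) 2)) := by
    have hi : Integrable fun x => conjGauss m t (x + x₀) * conj (addChar x) := by
      have := integrable_cexp_mul_I_mul ((integrable_conjGauss m ht).comp_add_right x₀)
        (c := fun x : ℂ => -2 * Real.pi * ⟪x, 2⟫) (by fun_prop)
      refine this.congr (ae_of_all _ fun x => ?_)
      simp only [conj_addChar]; ring
    have h1 := (aecover_closedBall (μ := (volume : Measure ℂ)) (x := (0 : ℂ))
      tendsto_id).integral_tendsto_of_countably_generated hi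
    have h2 : ∫ x, conjGauss m t (x + x₀) * conj (addChar x) =
        addChar x₀ * 𝓕 (conjGauss m t) 2 := by
      rw [Real.fourier_eq', ← integral_const_mul,
        ← integral_add_right_eq_self (μ := volume) (fun v : ℂ => addChar x₀ *
          (Complex.exp (((-2 * Real.pi * ⟪v, 2⟫ : ℝ) : ℂ) * Complex.I) • conjGauss m t v)) x₀]
      congr 1; ext x
      rw [← conj_addChar, addChar_add, map_mul, smul_eq_mul]
      have : addChar x₀ * conj (addChar x₀) = 1 := by
        rw [Complex.mul_conj, Complex.normSq_eq_norm_sq, norm_addChar]; simp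
      linear_combination (-conjGauss m t (x + x₀) * conj (addChar x)) * this
    rw [← h2]
    exact h1
  have hlim : Tendsto (fun R => ∫ t in Set.Ioi (0 : ℝ), gammaWeight s y t * G R t) atTop
      (𝓝 (∫ t in Set.Ioi (0 : ℝ), gammaWeight s y t * (addChar x₀ * 𝓕 (conjGauss m t) 2))) := by
    refine tendsto_integral_filter_of_dominated_convergence
      (fun t => C * ‖(t : ℂ) ^ (s - ((m : ℂ) + 1) / 2 - 1) * Complex.exp (-((y ^ 2 : ℝ) * t))‖)
      ?_ ?_ ?_ ?_
    · refine Eventually.of_forall fun R => ?_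
      have := (hint R).1.prod_swap.integral_prod_right'
      refine this.congr (ae_of_all _ fun t => ?_)
      simp only [hGdef, Prod.swap, mul_assoc]
      rw [integral_const_mul]
    · filter_upwards [eventually_ge_atTop (1 + 4 * ‖x₀‖)] with R hR
      filter_upwards [ae_restrict_mem measurableSet_Ioi] with t ht
      have ht' : 0 < t := ht
      have e1 : (s - ((m : ℂ) + 1) / 2 - 1).re = (s.re - 1) + (-((m : ℝ) + 1) / 2) := by
        simp; ring
      have e2 : (-((y ^ 2 : ℝ) * t : ℂ)).re = -(y ^ 2 * t) := by norm_cast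
      rw [norm_mul, norm_gammaWeight s y ht', norm_mul, Complex.norm_cpow_eq_rpow_re_of_pos ht',
        Complex.norm_exp, e1, e2, Real.rpow_add ht']
      calc _ ≤ t ^ (s.re - 1) * Real.exp (-(y ^ 2 * t)) * (C * t ^ (-((m : ℝ) + 1) / 2)) :=
            mul_le_mul_of_nonneg_left (hC x₀ R hR t ht') (by positivity)
        _ = _ := by ring
    · exact (integrable_cpow_mul_exp_neg_mul (s := s - ((m : ℂ) + 1) / 2) (by simp; linarith)
        (by positivity)).norm.const_mul _
    · filter_upwards [ae_restrict_mem measurableSet_Ioi] with t ht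
      exact (hlimG t ht).const_mul _
  have hval : ∫ t in Set.Ioi (0 : ℝ), gammaWeight s y t * (addChar x₀ * 𝓕 (conjGauss m t) 2) =
      Complex.Gamma s * (addChar x₀ * besselKernel m s y 2) := by
    have h1 := integral_gammaWeight_mul_fourier m hs0 hy (ζ := 2) (by norm_num)
    calc _ = addChar x₀ * ∫ t in Set.Ioi (0 : ℝ), gammaWeight s y t * 𝓕 (conjGauss m t) 2 := by
          rw [← integral_const_mul]; congr 1; ext t; ring
      _ = _ := by rw [h1]; ring
  simp only [hswap]
  have := hlim.const_mul (Complex.Gamma s)⁻¹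
  rwa [hval, inv_mul_cancel_left₀ hG] at this

/-! ### The minimal `K`-type in the induced model -/

/-- A power series identity in homogeneous coordinates: the binary form of degree `n + m` with the
dehomogenisation `(α + β X) ^ n (γ + δ X) ^ m`. -/
theorem sum_coeff_mul_pow_mul_pow (α β γ δ a b : ℂ) (n m : ℕ) :
    ∑ i ∈ Finset.range (n + m + 1),
      ((Polynomial.C α + Polynomial.C β * Polynomial.X) ^ n *
        (Polynomial.C γ + Polynomial.C δ * Polynomial.X) ^ m).coeff i * a ^ (n + m - i) * b ^ i =
      (α * a + β * b) ^ n * (γ * a + δ * b) ^ m := by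
  have key (p : Polynomial ℂ) (N : ℕ) : ∑ i ∈ Finset.range (N + 1), p.coeff i * a ^ (N - i) * b ^ i =
      MvPolynomial.eval ![b, a] (p.homogenize N) := by
    rw [Polynomial.homogenize, map_sum, Finset.Nat.sum_antidiagonal_eq_sum_range_succ_mk]
    refine Finset.sum_congr rfl fun i _ => ?_
    simp [MvPolynomial.eval_monomial, Finsupp.prod_fintype]
    ring
  have hlin (α β : ℂ) : MvPolynomial.eval ![b, a]
      ((Polynomial.C α + Polynomial.C β * Polynomial.X).homogenize 1) = α * a + β * b := by
    simp [Polynomial.homogenize_add, Polynomial.homogenize_C_mul, Polynomial.homogenize_X]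
  have hdeg (α β : ℂ) : (Polynomial.C α + Polynomial.C β * Polynomial.X).natDegree ≤ 1 := by
    rw [add_comm]; exact Polynomial.natDegree_linear_le
  have hpow (α β : ℂ) (n : ℕ) : MvPolynomial.eval ![b, a]
      (((Polynomial.C α + Polynomial.C β * Polynomial.X) ^ n).homogenize n) =
        (α * a + β * b) ^ n := by
    induction n with
    | zero => simp
    | succ n ih =>
      rw [pow_succ, Polynomial.homogenize_mul _ _ (Polynomial.natDegree_pow_le_of_le n (hdeg α β)|>.trans (by simp))
        (hdeg α β), map_mul, ih, hlin, pow_succ]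
  rw [key, Polynomial.homogenize_mul _ _
    ((Polynomial.natDegree_pow_le_of_le n (hdeg α β)).trans (by simp))
    ((Polynomial.natDegree_pow_le_of_le m (hdeg γ δ)).trans (by simp)), map_mul, hpow, hpow]

/-- The value of `v_{k-2j}` in the induced model at an element with bottom row `(c, d)`. -/
noncomputable def rowVec (k : ℕ) (r : ℝ) (j : ℕ) (c d : ℂ) : ℂ :=
  ((√(k + 1 : ℝ) : ℝ) : ℂ) * ((-Complex.I) ^ j * ((√(k.choose j) : ℝ) : ℂ)) *
    (conj d ^ (k - j) * conj c ^ j) *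
    ((‖c‖ ^ 2 + ‖d‖ ^ 2 : ℝ) : ℂ) ^ (-(1 + (k : ℂ) / 2 + Complex.I * r))

theorem rho_zero_left (k : ℕ) (κ : SU2) (j : Fin (k + 1)) :
    rho k κ 0 j = Complex.I ^ (j : ℕ) * ((√(k.choose j) : ℝ) : ℂ) *
      (κ.1 0 0 ^ (k - (j : ℕ)) * κ.1 0 1 ^ (j : ℕ)) := by
  unfold rho
  rw [Fin.val_zero, Polynomial.coeff_zero_eq_eval_zero]
  simp

theorem sqrt_choose_ne_zero {k j : ℕ} (h : j ≤ k) : ((√(k.choose j) : ℝ) : ℂ) ≠ 0 := by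
  have : 0 < (k.choose j : ℝ) := by exact_mod_cast Nat.choose_pos h
  exact_mod_cast (Real.sqrt_pos.2 this).ne'

theorem sqrt_choose_mul_self (k j : ℕ) :
    ((√(k.choose j) : ℝ) : ℂ) * ((√(k.choose j) : ℝ) : ℂ) = k.choose j := by
  rw [← Complex.ofReal_mul, Real.mul_self_sqrt (by positivity)]; simp

theorem coeff_linear_pow {k i : ℕ} (hi : i ≤ k) (a c : ℂ) :
    ((Polynomial.C a + Polynomial.C c * Polynomial.X) ^ k).coeff i =
      a ^ (k - i) * c ^ i * k.choose i := by
  have hterm (b : ℕ) : (Polynomial.C c * Polynomial.X) ^ b * Polynomial.C a ^ (k - b) *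
      (k.choose b : Polynomial ℂ) =
      Polynomial.C (a ^ (k - b) * c ^ b * k.choose b) * Polynomial.X ^ b := by
    simp only [mul_pow, map_mul, map_pow, map_natCast]; ring
  rw [add_comm, add_pow, Polynomial.finsetSum_coeff]
  simp only [hterm, Polynomial.coeff_C_mul_X_pow]
  rw [Finset.sum_eq_single i]
  · simp
  · intro b _ hb
    rw [if_neg hb.symm]
  · intro h; exact absurd (Finset.mem_range.2 (Nat.lt_succ_iff.2 hi)) h

theorem rho_zero_right (k : ℕ) (κ : SU2) (i : Fin (k + 1)) :
    rho k κ i 0 = (-Complex.I) ^ (i : ℕ) * ((√(k.choose i) : ℝ) : ℂ) *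
      (κ.1 0 0 ^ (k - (i : ℕ)) * κ.1 1 0 ^ (i : ℕ)) := by
  have h0 := sqrt_choose_ne_zero (Nat.lt_succ_iff.1 i.2)
  have hI : (-Complex.I) ^ (i : ℕ) = (Complex.I ^ (i : ℕ))⁻¹ := by
    rw [← inv_pow, Complex.inv_I]
  unfold rho
  simp only [Fin.val_zero, Nat.choose_zero_right, Nat.cast_one, Real.sqrt_one, pow_zero, Nat.sub_zero,
    mul_one, Complex.ofReal_one]
  rw [coeff_linear_pow (Nat.lt_succ_iff.1 i.2), hI, ← sqrt_choose_mul_self]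
  have hI0 : Complex.I ^ (i : ℕ) ≠ 0 := pow_ne_zero _ Complex.I_ne_zero
  field_simp

theorem ofReal_cpow_eq_exp {x : ℝ} (hx : 0 < x) (s : ℂ) :
    (x : ℂ) ^ s = Complex.exp (Real.log x * s) := by
  rw [Complex.cpow_def_of_ne_zero (by exact_mod_cast hx.ne'), Complex.ofReal_log hx.le]

theorem height_pos (g : SL2) : 0 < height g := by
  have := rowNorm_pos g
  unfold height; positivity

theorem rowNorm_sq_eq (g : SL2) : rowNorm g ^ 2 = ‖g.1 1 0‖ ^ 2 + ‖g.1 1 1‖ ^ 2 :=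
  Real.sq_sqrt (by positivity)

theorem inducedVec_eq_rowVec (k : ℕ) (r : ℝ) (j : Fin (k + 1)) (g : SL2) :
    inducedVec k r j g = rowVec k r j (g.1 1 0) (g.1 1 1) := by
  have hN := rowNorm_pos g
  have hN0 : ((rowNorm g : ℝ) : ℂ) ≠ 0 := by exact_mod_cast hN.ne'
  have hk : (j : ℕ) ≤ k := Nat.lt_succ_iff.1 j.2
  have e1 : ((height g : ℝ) : ℂ) ^ (1 + Complex.I * r) =
      ((‖g.1 1 0‖ ^ 2 + ‖g.1 1 1‖ ^ 2 : ℝ) : ℂ) ^ (-(1 + (k : ℂ) / 2 + Complex.I * r)) *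
        (rowNorm g : ℂ) ^ k := by
    rw [← rowNorm_sq_eq, ← Complex.cpow_natCast, height, ofReal_cpow_eq_exp (by positivity),
      ofReal_cpow_eq_exp (by positivity), ofReal_cpow_eq_exp hN, ← Complex.exp_add, Real.log_inv,
      Real.log_pow]
    congr 1; push_cast; ring
  unfold inducedVec inducedExt rowVec
  beta_reduce
  rw [e1, rho_zero_left]
  simp only [kPart, Matrix.cons_val', Matrix.cons_val_zero, Matrix.cons_val_one, Matrix.of_apply]
  have hI : (-Complex.I) ^ (j : ℕ) = Complex.I ^ (j : ℕ) * (-1) ^ (j : ℕ) := by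
    rw [← mul_pow]; ring
  have hp : (rowNorm g : ℂ) ^ k = (rowNorm g : ℂ) ^ (k - (j : ℕ)) * (rowNorm g : ℂ) ^ (j : ℕ) := by
    rw [← pow_add]; congr 1; omega
  rw [hI, hp, neg_div, neg_pow, div_pow, div_pow]
  field_simp

theorem SU2.one_one_eq (κ : SU2) : κ.1 1 1 = conj (κ.1 0 0) := by
  have h := Matrix.mem_specialUnitaryGroup_iff.1 κ.2
  have h1 := Matrix.mem_unitaryGroup_iff'.1 h.1
  have h2 := h.2
  rw [Matrix.det_fin_two] at h2
  have h3 := congrFun (congrFun h1 0) 0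
  have h4 := congrFun (congrFun h1 0) 1
  simp [Matrix.mul_apply, Matrix.star_apply, Fin.sum_univ_two] at h3 h4
  linear_combination (-κ.1 1 1) * h3 + conj (κ.1 0 0) * h2 + κ.1 1 0 * h4

theorem SU2.one_zero_eq (κ : SU2) : κ.1 1 0 = -conj (κ.1 0 1) := by
  have h := Matrix.mem_specialUnitaryGroup_iff.1 κ.2
  have h1 := Matrix.mem_unitaryGroup_iff'.1 h.1
  have h2 := h.2
  rw [Matrix.det_fin_two] at h2
  have h3 := congrFun (congrFun h1 1) 0
  have h4 := congrFun (congrFun h1 1) 1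
  simp [Matrix.mul_apply, Matrix.star_apply, Fin.sum_univ_two] at h3 h4
  linear_combination (-κ.1 1 0) * h4 - conj (κ.1 0 1) * h2 + κ.1 1 1 * h3

/-- The last column of `ρ_k` is determined by the first one. -/
theorem rho_last_right (k : ℕ) (κ : SU2) (i : Fin (k + 1)) :
    rho k κ i (Fin.last k) = (-1) ^ (k - (i : ℕ)) * conj (rho k κ i.rev 0) := by
  have hi : (i : ℕ) ≤ k := Nat.lt_succ_iff.1 i.2
  have h0 := sqrt_choose_ne_zero hi
  have hI0 : Complex.I ^ (i : ℕ) ≠ 0 := pow_ne_zero _ Complex.I_ne_zero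
  have hrev : ((i.rev : Fin (k + 1)) : ℕ) = k - i := by rw [Fin.val_rev]; omega
  have hIk : Complex.I ^ k = Complex.I ^ (i : ℕ) * Complex.I ^ (k - (i : ℕ)) := by
    rw [← pow_add]; congr 1; omega
  have hs : (-1 : ℂ) ^ (k - (i : ℕ)) * (-1) ^ (k - (i : ℕ)) = 1 := by rw [← mul_pow]; simp
  rw [rho_zero_right, hrev, Nat.choose_symm hi, Nat.sub_sub_self hi, SU2.one_zero_eq]
  unfold rho
  simp only [Fin.val_last, Nat.sub_self, pow_zero, one_mul, Nat.choose_self, Nat.cast_one,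
    Real.sqrt_one, Complex.ofReal_one, mul_one]
  rw [coeff_linear_pow hi, SU2.one_one_eq, ← sqrt_choose_mul_self, hIk]
  simp only [map_mul, map_pow, map_neg, Complex.conj_I, Complex.conj_ofReal, neg_neg, Complex.conj_conj,
    neg_pow (κ.1 0 1)]
  field_simp
  linear_combination (-(κ.1 0 1 ^ (k - (i : ℕ)) * conj (κ.1 0 0) ^ (i : ℕ))) * hs

theorem SU2.norm_row_zero (κ : SU2) : ‖κ.1 0 0‖ ^ 2 + ‖κ.1 0 1‖ ^ 2 = 1 := by
  have h2 := (Matrix.mem_specialUnitaryGroup_iff.1 κ.2).2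
  rw [Matrix.det_fin_two, SU2.one_one_eq, SU2.one_zero_eq, mul_neg, sub_neg_eq_add, Complex.mul_conj,
    Complex.mul_conj, Complex.normSq_eq_norm_sq, Complex.normSq_eq_norm_sq] at h2
  exact_mod_cast h2

theorem SU2.norm_row_one (κ : SU2) : ‖κ.1 1 0‖ ^ 2 + ‖κ.1 1 1‖ ^ 2 = 1 := by
  rw [SU2.one_one_eq, SU2.one_zero_eq, norm_neg, RCLike.norm_conj, RCLike.norm_conj, add_comm]
  exact SU2.norm_row_zero κ

/-- `(c, d) ↦ (c, d) κ` preserves the length. -/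
theorem SU2.norm_row_mul (κ : SU2) (c d : ℂ) :
    ‖c * κ.1 0 0 + d * κ.1 1 0‖ ^ 2 + ‖c * κ.1 0 1 + d * κ.1 1 1‖ ^ 2 = ‖c‖ ^ 2 + ‖d‖ ^ 2 := by
  have h := SU2.norm_row_zero κ
  rw [SU2.one_one_eq, SU2.one_zero_eq]
  have key : (((‖c * κ.1 0 0 + d * -conj (κ.1 0 1)‖ ^ 2 + ‖c * κ.1 0 1 + d * conj (κ.1 0 0)‖ ^ 2 : ℝ))
      : ℂ) = ((‖κ.1 0 0‖ ^ 2 + ‖κ.1 0 1‖ ^ 2 : ℝ) : ℂ) * ((‖c‖ ^ 2 + ‖d‖ ^ 2 : ℝ) : ℂ) := by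
    simp only [← Complex.normSq_eq_norm_sq, Complex.ofReal_add, ← Complex.mul_conj, map_add, map_mul,
      map_neg, Complex.conj_conj]
    ring
  rw [h] at key
  rw [Complex.ofReal_one, one_mul] at key
  exact Complex.ofReal_injective key

theorem SU2.norm_toSL_row_mul (κ : SU2) (c d : ℂ) :
    ((‖c * κ.1 0 0 + d * κ.1 1 0‖ ^ 2 + ‖c * κ.1 0 1 + d * κ.1 1 1‖ ^ 2 : ℝ) : ℂ) =
      ((‖c‖ ^ 2 + ‖d‖ ^ 2 : ℝ) : ℂ) := by rw [SU2.norm_row_mul]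

/-- Right translation by `K` acts on the vectors of the minimal `K`-type through `ρ_k`. -/
theorem rowVec_mul (k : ℕ) (r : ℝ) (j : Fin (k + 1)) (κ : SU2) (c d : ℂ) :
    rowVec k r j (c * κ.1 0 0 + d * κ.1 1 0) (c * κ.1 0 1 + d * κ.1 1 1) =
      ∑ i, rho k κ i j * rowVec k r i c d := by
  have hk : (j : ℕ) ≤ k := Nat.lt_succ_iff.1 j.2
  have hsum := sum_coeff_mul_pow_mul_pow (κ.1 0 0) (κ.1 1 0) (κ.1 0 1) (κ.1 1 1) (conj d) (-conj c)
    (k - j) j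
  rw [Nat.sub_add_cancel hk, Finset.sum_range] at hsum
  have hD : conj (c * κ.1 0 1 + d * κ.1 1 1) = κ.1 0 0 * conj d + κ.1 1 0 * -conj c := by
    rw [SU2.one_one_eq, SU2.one_zero_eq]; simp; ring
  have hC : conj (c * κ.1 0 0 + d * κ.1 1 0) = -(κ.1 0 1 * conj d + κ.1 1 1 * -conj c) := by
    rw [SU2.one_one_eq, SU2.one_zero_eq]; simp; ring
  unfold rowVec
  rw [SU2.norm_toSL_row_mul, hD, hC, neg_pow (κ.1 0 1 * conj d + κ.1 1 1 * -conj c)]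
  have hterm (i : Fin (k + 1)) : rho k κ i j * (((√(k + 1 : ℝ) : ℝ) : ℂ) *
      ((-Complex.I) ^ (i : ℕ) * ((√(k.choose i) : ℝ) : ℂ)) * (conj d ^ (k - (i : ℕ)) * conj c ^ (i : ℕ)) *
      ((‖c‖ ^ 2 + ‖d‖ ^ 2 : ℝ) : ℂ) ^ (-(1 + (k : ℂ) / 2 + Complex.I * r))) =
      (((√(k + 1 : ℝ) : ℝ) : ℂ) * (Complex.I ^ (j : ℕ) * ((√(k.choose j) : ℝ) : ℂ)) *
      ((‖c‖ ^ 2 + ‖d‖ ^ 2 : ℝ) : ℂ) ^ (-(1 + (k : ℂ) / 2 + Complex.I * r))) *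
      (((Polynomial.C (κ.1 0 0) + Polynomial.C (κ.1 1 0) * Polynomial.X) ^ (k - (j : ℕ)) *
      (Polynomial.C (κ.1 0 1) + Polynomial.C (κ.1 1 1) * Polynomial.X) ^ (j : ℕ)).coeff i *
        conj d ^ (k - (i : ℕ)) * (-conj c) ^ (i : ℕ)) := by
    have h0 := sqrt_choose_ne_zero (Nat.lt_succ_iff.1 i.2)
    have hI0 : Complex.I ^ (i : ℕ) ≠ 0 := pow_ne_zero _ Complex.I_ne_zero
    unfold rho
    rw [neg_pow Complex.I, neg_pow (conj c)]
    field_simp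
  simp only [hterm]
  rw [← Finset.mul_sum, hsum]
  have hI : (-Complex.I) ^ (j : ℕ) * (-1) ^ (j : ℕ) = Complex.I ^ (j : ℕ) := by
    rw [← mul_pow]; simp
  rw [← hI]; ring

theorem toSL_mul (κ κ' : SU2) : toSL (κ * κ') = toSL κ * toSL κ' := rfl

theorem inducedVec_mul_toSL (k : ℕ) (r : ℝ) (j : Fin (k + 1)) (g : SL2) (κ : SU2) :
    inducedVec k r j (g * toSL κ) = ∑ i, rho k κ i j * inducedVec k r i g := by
  simp only [inducedVec_eq_rowVec]
  rw [← rowVec_mul, Matrix.SpecialLinearGroup.coe_mul]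
  simp [toSL, Matrix.mul_apply, Fin.sum_univ_two]

/-! ### Haar measure on `K` and orthogonality relations -/

instance : IsProbabilityMeasure haarK := by
  constructor
  have := Measure.haarMeasure_self (K₀ := (⊤ : TopologicalSpace.PositiveCompacts SU2))
  simpa [haarK] using this

instance : haarK.IsHaarMeasure := by unfold haarK; infer_instance

instance : haarK.IsMulRightInvariant := by
  constructor
  intro g
  have h := Measure.isMulInvariant_eq_smul_of_compactSpace (Measure.map (· * g) haarK) haarK
  have hp : IsProbabilityMeasure (Measure.map (· * g) haarK) :=
    Measure.isProbabilityMeasure_map (by fun_prop)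
  have h1 := congrArg (fun μ => μ Set.univ) h
  simp only [measure_univ, Measure.smul_apply] at h1
  rw [h]
  set c := Measure.haarScalarFactor (Measure.map (· * g) haarK) haarK
  have hc : c = 1 := by
    rw [ENNReal.smul_def, smul_eq_mul, mul_one] at h1
    exact_mod_cast h1.symm
  rw [hc, one_smul]

theorem continuous_entry (i j : Fin 2) : Continuous fun κ : SU2 => κ.1 i j :=
  (continuous_apply_apply i j).comp continuous_subtype_val

theorem continuous_rho_zero_right (k : ℕ) (i : Fin (k + 1)) : Continuous fun κ => rho k κ i 0 := by
  simp only [rho_zero_right]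
  exact continuous_const.mul (((continuous_entry 0 0).pow _).mul ((continuous_entry 1 0).pow _))

/-- The element of `SU(2)` with top row `(a, b)`. -/
def SU2.ofRow (a b : ℂ) (h : ‖a‖ ^ 2 + ‖b‖ ^ 2 = 1) : SU2 :=
  ⟨!![a, b; -conj b, conj a], by
    have h' : a * conj a + b * conj b = 1 := by
      rw [Complex.mul_conj, Complex.mul_conj, Complex.normSq_eq_norm_sq, Complex.normSq_eq_norm_sq]
      exact_mod_cast h
    rw [Matrix.mem_specialUnitaryGroup_iff, Matrix.mem_unitaryGroup_iff]
    constructor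
    · ext i j
      fin_cases i <;> fin_cases j <;>
        simp [Matrix.mul_apply, Matrix.star_apply, Fin.sum_univ_two] <;>
        first | linear_combination h' | ring
    · rw [Matrix.det_fin_two]
      simp
      linear_combination h'⟩

theorem integrable_of_continuous_SU2 {f : SU2 → ℂ} (hf : Continuous f) : Integrable f haarK :=
  hf.integrable_of_hasCompactSupport (HasCompactSupport.of_compactSpace f)

/-- Left translation by a suitable element of the diagonal torus changes the sign of the integrand. -/
theorem integral_rho_mul_conj_eq_zero (k : ℕ) {i j : Fin (k + 1)} (h : i ≠ j) :
    ∫ κ, rho k κ i 0 * conj (rho k κ j 0) ∂haarK = 0 := by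
  have hij : ((j : ℂ) - i) ≠ 0 := by
    rw [sub_ne_zero]; exact_mod_cast (Fin.val_ne_of_ne h).symm
  -- The integrand has weight `2(j - i)` under `diag(e^{iθ}, e^{-iθ})`, hence the sign `e^{iπ} = -1`.
  set θ : ℝ := Real.pi / (2 * ((j : ℝ) - i)) with hθ
  set κ₀ : SU2 := SU2.ofRow (Complex.exp (θ * Complex.I)) 0 (by
    rw [Complex.norm_exp_ofReal_mul_I]; simp) with hκ₀
  have h1 (κ : SU2) : rho k (κ₀ * κ) i 0 * conj (rho k (κ₀ * κ) j 0) =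
      -(rho k κ i 0 * conj (rho k κ j 0)) := by
    have hi : (i : ℕ) ≤ k := Nat.lt_succ_iff.1 i.2
    have hj : (j : ℕ) ≤ k := Nat.lt_succ_iff.1 j.2
    have e0 : (κ₀ * κ).1 0 0 = Complex.exp (θ * Complex.I) * κ.1 0 0 := by
      simp [hκ₀, SU2.ofRow, Matrix.mul_apply, Fin.sum_univ_two]
    have e1 : (κ₀ * κ).1 1 0 = Complex.exp (-(θ * Complex.I)) * κ.1 1 0 := by
      simp [hκ₀, SU2.ofRow, Matrix.mul_apply, Fin.sum_univ_two, ← Complex.exp_conj]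
    simp only [rho_zero_right, e0, e1, mul_pow, map_mul, map_pow, ← Complex.exp_conj, map_neg,
      Complex.conj_I, Complex.conj_ofReal, ← Complex.exp_nat_mul, map_natCast]
    have hexp : Complex.exp (((k - (i : ℕ) : ℕ) : ℂ) * (θ * Complex.I)) *
        Complex.exp ((i : ℕ) * (-(θ * Complex.I))) *
        (Complex.exp (((k - (j : ℕ) : ℕ) : ℂ) * (θ * -Complex.I)) *
        Complex.exp ((j : ℕ) * (-(θ * -Complex.I)))) = -1 := by
      rw [← Complex.exp_add, ← Complex.exp_add, ← Complex.exp_add, ← Complex.exp_pi_mul_I]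
      congr 1
      rw [Nat.cast_sub hi, Nat.cast_sub hj, hθ]
      push_cast
      field_simp
      ring
    linear_combination ((-Complex.I) ^ (i : ℕ) * ((√(k.choose i) : ℝ) : ℂ) *
      (κ.1 0 0 ^ (k - (i : ℕ)) * κ.1 1 0 ^ (i : ℕ)) * ((- -Complex.I) ^ (j : ℕ) *
      ((√(k.choose j) : ℝ) : ℂ) * (conj (κ.1 0 0) ^ (k - (j : ℕ)) * conj (κ.1 1 0) ^ (j : ℕ)))) * hexp
  have h2 := integral_mul_left_eq_self (μ := haarK)
    (fun κ => rho k κ i 0 * conj (rho k κ j 0)) κ₀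
  simp only [h1] at h2
  rw [integral_neg] at h2
  linear_combination (-1 / 2 : ℂ) * h2

/-- Schur orthogonality for the matrix coefficients of `ρ_k` in the first column. -/
theorem integral_rho_mul_conj (k : ℕ) (i j : Fin (k + 1)) :
    ∫ κ, rho k κ i 0 * conj (rho k κ j 0) ∂haarK = if i = j then ((k : ℂ) + 1)⁻¹ else 0 := by
  split_ifs with h
  swap
  · exact integral_rho_mul_conj_eq_zero k h
  subst h
  have hcont (i j : Fin (k + 1)) : Continuous fun κ => rho k κ i 0 * conj (rho k κ j 0) :=
    (continuous_rho_zero_right k i).mul (Complex.continuous_conj.comp (continuous_rho_zero_right k j))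
  set M : Fin (k + 1) → ℂ := fun i => ∫ κ, rho k κ i 0 * conj (rho k κ i 0) ∂haarK with hM
  -- invariance under rotations compares the diagonal entries
  have hrot (x : ℝ) (hx : 0 ≤ x) :
      ∑ i : Fin (k + 1), (x : ℂ) ^ (i : ℕ) * (k.choose i) * M i = (1 + (x : ℂ)) ^ k * M 0 := by
    set N : ℝ := (√(1 + x))⁻¹ with hN
    have hN0 : 0 < N := by positivity
    have hNx : N ^ 2 * (1 + x) = 1 := by
      rw [hN, inv_pow, Real.sq_sqrt (by positivity)]; field_simp
    set κ₀ : SU2 := SU2.ofRow (N : ℂ) ((N * √x : ℝ) : ℂ) (by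
      rw [Complex.norm_real, Complex.norm_real, Real.norm_eq_abs, Real.norm_eq_abs, sq_abs, sq_abs,
        mul_pow, Real.sq_sqrt hx]; linarith) with hκ₀
    set t : Fin (k + 1) → ℂ := fun i =>
      Complex.I ^ (i : ℕ) * ((√(k.choose i) : ℝ) : ℂ) * ((N : ℂ) ^ k * ((√x : ℝ) : ℂ) ^ (i : ℕ)) with ht
    have e (κ : SU2) : rho k (κ₀ * κ) 0 0 = ∑ i, t i * rho k κ i 0 := by
      have e0 : (κ₀ * κ).1 0 0 = (N : ℂ) * (√x : ℝ) * κ.1 1 0 + (N : ℂ) * κ.1 0 0 := by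
        simp [hκ₀, SU2.ofRow, Matrix.mul_apply, Fin.sum_univ_two, add_comm]
      rw [rho_zero_right, e0]
      simp only [Fin.val_zero, pow_zero, Nat.choose_zero_right, Nat.cast_one, Real.sqrt_one,
        Complex.ofReal_one, one_mul, mul_one, Nat.sub_zero]
      rw [add_pow, Finset.sum_range]
      refine Finset.sum_congr rfl fun i _ => ?_
      have hi : (i : ℕ) ≤ k := Nat.lt_succ_iff.1 i.2
      have hI : Complex.I ^ (i : ℕ) * (-Complex.I) ^ (i : ℕ) = 1 := by rw [← mul_pow]; simp
      have hp : (N : ℂ) ^ k = (N : ℂ) ^ (k - (i : ℕ)) * (N : ℂ) ^ (i : ℕ) := by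
        rw [← pow_add]; congr 1; omega
      rw [rho_zero_right, ← sqrt_choose_mul_self, ht, hp]
      simp only [mul_pow]
      linear_combination (-((N : ℂ) ^ (k - (i : ℕ)) * (N : ℂ) ^ (i : ℕ) * ((√x : ℝ) : ℂ) ^ (i : ℕ) *
        κ.1 0 0 ^ (k - (i : ℕ)) * κ.1 1 0 ^ (i : ℕ) *
        (((√(k.choose i) : ℝ) : ℂ) * ((√(k.choose i) : ℝ) : ℂ)))) * hI
    have h2 := integral_mul_left_eq_self (μ := haarK)
      (fun κ => rho k κ 0 0 * conj (rho k κ 0 0)) κ₀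
    simp only [e, map_sum, map_mul, Finset.sum_mul_sum] at h2
    rw [integral_finsetSum _ (fun i _ => integrable_finsetSum _ fun j _ => by
      refine integrable_of_continuous_SU2 ?_
      have h1 := continuous_rho_zero_right k i
      have h2 := Complex.continuous_conj.comp (continuous_rho_zero_right k j)
      exact (continuous_const.mul h1).mul (continuous_const.mul h2))] at h2
    have h3 (i : Fin (k + 1)) : ∫ κ, ∑ j, t i * rho k κ i 0 * (conj (t j) * conj (rho k κ j 0)) ∂haarK =
        (N : ℂ) ^ (2 * k) * ((x : ℂ) ^ (i : ℕ) * (k.choose i) * M i) := by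
      rw [integral_finsetSum]
      · have h4 (j : Fin (k + 1)) : ∫ κ, t i * rho k κ i 0 * (conj (t j) * conj (rho k κ j 0)) ∂haarK =
            t i * conj (t j) * ∫ κ, rho k κ i 0 * conj (rho k κ j 0) ∂haarK := by
          rw [← integral_const_mul]; congr 1; ext κ; ring
        simp only [h4]
        rw [Finset.sum_eq_single i]
        · have h5 : t i * conj (t i) = (N : ℂ) ^ (2 * k) * ((x : ℂ) ^ (i : ℕ) * (k.choose i)) := by
            have h6 : ((x : ℝ) : ℂ) = ((√x : ℝ) : ℂ) * ((√x : ℝ) : ℂ) := by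
              rw [← Complex.ofReal_mul, Real.mul_self_sqrt hx]
            have hI : Complex.I ^ (i : ℕ) * (-Complex.I) ^ (i : ℕ) = 1 := by rw [← mul_pow]; simp
            rw [ht, h6, ← sqrt_choose_mul_self]
            simp only [map_mul, map_pow, Complex.conj_I, Complex.conj_ofReal]
            linear_combination ((N : ℂ) ^ (2 * k) * (((√x : ℝ) : ℂ) * ((√x : ℝ) : ℂ)) ^ (i : ℕ) *
              (((√(k.choose i) : ℝ) : ℂ) * ((√(k.choose i) : ℝ) : ℂ))) * hI
          rw [h5, hM]; ring
        · intro j _ hj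
          rw [integral_rho_mul_conj_eq_zero k hj.symm, mul_zero]
        · simp
      · intro j _
        refine integrable_of_continuous_SU2 ?_
        have h1 := continuous_rho_zero_right k i
        have h2 := Complex.continuous_conj.comp (continuous_rho_zero_right k j)
        exact (continuous_const.mul h1).mul (continuous_const.mul h2)
    simp only [h3] at h2
    rw [← Finset.mul_sum] at h2
    have h7 : (N : ℂ) ^ (2 * k) * (1 + (x : ℂ)) ^ k = 1 := by
      rw [pow_mul, ← mul_pow]
      have : ((N : ℂ) ^ 2 * (1 + (x : ℂ))) = 1 := by exact_mod_cast hNx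
      rw [this, one_pow]
    have h8 : (N : ℂ) ^ (2 * k) ≠ 0 := pow_ne_zero _ (by exact_mod_cast hN0.ne')
    apply mul_left_cancel₀ h8
    rw [h2, ← mul_assoc, h7, one_mul]
  have hdiag : ∀ i, M i = M 0 := by
    intro i
    set P : Polynomial ℂ := ∑ i : Fin (k + 1), Polynomial.C ((k.choose i : ℂ) * M i) *
      Polynomial.X ^ (i : ℕ) with hP
    have hPQ : P = Polynomial.C (M 0) * (Polynomial.X + 1) ^ k := by
      refine Polynomial.eq_of_infinite_eval_eq _ _ (Set.Infinite.mono
        (s := (fun n : ℕ => (n : ℂ)) '' Set.univ) ?_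
        (Set.infinite_univ.image Nat.cast_injective.injOn))
      rintro _ ⟨n, -, rfl⟩
      have := hrot n (by positivity)
      simp only [Set.mem_ofPred_eq, hP, Polynomial.eval_finsetSum, Polynomial.eval_mul,
        Polynomial.eval_C, Polynomial.eval_pow, Polynomial.eval_X, Polynomial.eval_add,
        Polynomial.eval_one]
      rw [mul_comm (M 0), add_comm (n : ℂ)]
      push_cast at this
      rw [← this]
      exact Finset.sum_congr rfl fun i _ => by ring
    have h1 := congrArg (fun p => p.coeff (i : ℕ)) hPQ
    simp only [hP, Polynomial.finsetSum_coeff, Polynomial.coeff_C_mul, Polynomial.coeff_X_add_one_pow,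
      Polynomial.coeff_X_pow] at h1
    rw [Finset.sum_eq_single i] at h1
    · have h0 : (k.choose i : ℂ) ≠ 0 := by
        exact_mod_cast (Nat.choose_pos (Nat.lt_succ_iff.1 i.2)).ne'
      simp only [if_true, mul_one] at h1
      apply mul_left_cancel₀ h0
      rw [h1]; ring
    · intro j _ hj
      rw [if_neg (fun h => hj (Fin.ext h.symm)), mul_zero]
    · simp
  have htot : ∑ i, M i = 1 := by
    rw [hM, ← integral_finsetSum _ (fun i _ => integrable_of_continuous_SU2 (hcont i i))]
    have (κ : SU2) : ∑ i, rho k κ i 0 * conj (rho k κ i 0) = 1 := by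
      have h1 : κ.1 0 0 * conj (κ.1 0 0) + κ.1 1 0 * conj (κ.1 1 0) = 1 := by
        rw [SU2.one_zero_eq, map_neg, Complex.conj_conj, neg_mul_neg, Complex.mul_conj,
          mul_comm, Complex.mul_conj, Complex.normSq_eq_norm_sq, Complex.normSq_eq_norm_sq]
        exact_mod_cast SU2.norm_row_zero κ
      have h2 := add_pow (κ.1 1 0 * conj (κ.1 1 0)) (κ.1 0 0 * conj (κ.1 0 0)) k
      rw [add_comm, h1, one_pow, Finset.sum_range] at h2
      rw [h2]
      refine Finset.sum_congr rfl fun i _ => ?_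
      have hI : (-Complex.I) ^ (i : ℕ) * Complex.I ^ (i : ℕ) = 1 := by rw [← mul_pow]; simp
      rw [rho_zero_right, ← sqrt_choose_mul_self]
      simp only [map_mul, map_pow, map_neg, Complex.conj_I, Complex.conj_ofReal, neg_neg]
      linear_combination ((((√(k.choose i) : ℝ) : ℂ) * ((√(k.choose i) : ℝ) : ℂ)) *
        (κ.1 0 0 * conj (κ.1 0 0)) ^ (k - (i : ℕ)) * (κ.1 1 0 * conj (κ.1 1 0)) ^ (i : ℕ)) * hI
    simp [this]
  simp only [hdiag, Finset.sum_const, Finset.card_univ, Fintype.card_fin, nsmul_eq_mul] at htot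
  change M i = _
  rw [hdiag i]
  have : ((k : ℂ) + 1) ≠ 0 := by exact_mod_cast Nat.succ_ne_zero k
  push_cast at htot
  field_simp
  linear_combination htot

/-! ### Integrals over the torus -/

theorem ae_mulHaar_pos : ∀ᵐ y ∂mulHaar, 0 < y := by
  have : ∀ᵐ y ∂(volume.restrict (Set.Ioi (0 : ℝ))), 0 < y := ae_restrict_mem measurableSet_Ioi
  exact (withDensity_absolutelyContinuous _ _).ae_le this

theorem measurable_ofReal_inv : Measurable fun y : ℝ => ENNReal.ofReal y⁻¹ := by fun_prop

theorem integral_mulHaar (f : ℝ → ℂ) : ∫ y, f y ∂mulHaar = ∫ y in Set.Ioi (0 : ℝ), (y : ℂ)⁻¹ * f y := by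
  rw [mulHaar, integral_withDensity_eq_integral_toReal_smul measurable_ofReal_inv
    (ae_of_all _ fun _ => ENNReal.ofReal_lt_top)]
  refine setIntegral_congr_fun measurableSet_Ioi fun y hy => ?_
  have hy' : 0 < y := hy
  rw [ENNReal.toReal_ofReal (by positivity), Complex.real_smul, Complex.ofReal_inv]

theorem integrable_mulHaar_iff (f : ℝ → ℂ) :
    Integrable f mulHaar ↔ IntegrableOn (fun y : ℝ => (y : ℂ)⁻¹ * f y) (Set.Ioi 0) := by
  rw [mulHaar, integrable_withDensity_iff_integrable_smul' measurable_ofReal_inv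
    (ae_of_all _ fun _ => ENNReal.ofReal_lt_top)]
  refine integrableOn_congr_fun (fun y hy => ?_) measurableSet_Ioi
  have hy' : 0 < y := hy
  rw [ENNReal.toReal_ofReal (by positivity), Complex.real_smul, Complex.ofReal_inv]

theorem lintegral_mulHaar {f : ℝ → ENNReal} (hf : Measurable f) :
    ∫⁻ y, f y ∂mulHaar = ∫⁻ y in Set.Ioi (0 : ℝ), ENNReal.ofReal y⁻¹ * f y := by
  rw [mulHaar, lintegral_withDensity_eq_lintegral_mul _ measurable_ofReal_inv hf]
  rfl

/-- The Mellin transform of a product of two `K`-Bessel functions with the argument `4πy` of the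
Whittaker functions. -/
theorem integral_mulHaar_besselK_mul_besselK {s μ ν : ℂ} (h : |μ.re| + |ν.re| < s.re) :
    Integrable (fun y : ℝ => (y : ℂ) ^ s *
      (besselK μ (4 * Real.pi * y) * besselK ν (4 * Real.pi * y))) mulHaar ∧
    ∫ y, (y : ℂ) ^ s * (besselK μ (4 * Real.pi * y) * besselK ν (4 * Real.pi * y)) ∂mulHaar =
      ((2 * Real.pi : ℝ) : ℂ) ^ (-s) / 8 / Complex.Gamma s *
        (Complex.Gamma ((s + (μ + ν)) / 2) * Complex.Gamma ((s - (μ + ν)) / 2) *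
          (Complex.Gamma ((s + (μ - ν)) / 2) * Complex.Gamma ((s - (μ - ν)) / 2))) := by
  have hb : 0 < 4 * Real.pi := by positivity
  obtain ⟨hi, he⟩ := mellin_besselK_mul_besselK h
  set g : ℝ → ℂ := fun x => (x : ℂ) ^ (s - 1) * (besselK μ x * besselK ν x) with hg
  have hpt : Set.EqOn (fun y : ℝ => (y : ℂ)⁻¹ * ((y : ℂ) ^ s *
      (besselK μ (4 * Real.pi * y) * besselK ν (4 * Real.pi * y))))
      (fun y => ((4 * Real.pi : ℝ) : ℂ) ^ (1 - s) * g (4 * Real.pi * y)) (Set.Ioi 0) := by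
    intro y hy
    have hy' : 0 < y := hy
    have hy0 : (y : ℂ) ≠ 0 := by exact_mod_cast hy'.ne'
    have hb0 : ((4 * Real.pi : ℝ) : ℂ) ≠ 0 := by exact_mod_cast hb.ne'
    simp only [hg]
    have e1 : ((4 * Real.pi : ℝ) : ℂ) ^ (1 - s) * ((4 * Real.pi : ℝ) : ℂ) ^ (s - 1) = 1 := by
      rw [← Complex.cpow_add _ _ hb0, sub_add_sub_cancel, sub_self, Complex.cpow_zero]
    have e2 : (y : ℂ)⁻¹ * (y : ℂ) ^ s = (y : ℂ) ^ (s - 1) := by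
      rw [Complex.cpow_sub _ _ hy0, Complex.cpow_one]; field_simp
    rw [Complex.ofReal_mul (4 * Real.pi), Complex.mul_cpow_ofReal_nonneg hb.le hy'.le]
    linear_combination (besselK μ (4 * Real.pi * y) * besselK ν (4 * Real.pi * y)) * e2 -
      ((y : ℂ) ^ (s - 1) * besselK μ (4 * Real.pi * y) * besselK ν (4 * Real.pi * y)) * e1
  constructor
  · rw [integrable_mulHaar_iff, integrableOn_congr_fun hpt measurableSet_Ioi]
    refine Integrable.const_mul ?_ _
    have := (integrableOn_Ioi_comp_mul_left_iff g 0 hb).2 (by rwa [mul_zero])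
    exact this
  · rw [integral_mulHaar, setIntegral_congr_fun measurableSet_Ioi hpt, integral_const_mul,
      integral_comp_mul_left_Ioi g 0 hb, mul_zero, he, Complex.real_smul, Complex.ofReal_inv]
    have h2 : (0 : ℝ) < 2 := by norm_num
    have e1 : ((4 * Real.pi : ℝ) : ℂ) ^ (1 - s) * ((4 * Real.pi : ℝ) : ℂ)⁻¹ * 2 ^ (s - 3) =
        ((2 * Real.pi : ℝ) : ℂ) ^ (-s) / 8 := by
      have e2 : (2 : ℂ) ^ (s - 3) = ((2 : ℝ) : ℂ) ^ (s - 3) := by norm_num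
      have e3 : ((4 * Real.pi : ℝ) : ℂ)⁻¹ = ((4 * Real.pi : ℝ) : ℂ) ^ (-1 : ℂ) :=
        (Complex.cpow_neg_one _).symm
      have e4 : (8 : ℂ) = ((2 : ℝ) : ℂ) ^ (3 : ℂ) := by
        rw [show (3 : ℂ) = ((3 : ℕ) : ℂ) by norm_num, Complex.cpow_natCast]; norm_num
      rw [e2, e3, e4, div_eq_mul_inv, ← Complex.cpow_neg, ofReal_cpow_eq_exp hb, ofReal_cpow_eq_exp hb,
        ofReal_cpow_eq_exp h2, ofReal_cpow_eq_exp h2, ofReal_cpow_eq_exp (by positivity),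
        ← Complex.exp_add, ← Complex.exp_add, ← Complex.exp_add,
        Real.log_mul (by norm_num) Real.pi_ne_zero, Real.log_mul (by norm_num) Real.pi_ne_zero,
        show (4 : ℝ) = 2 ^ 2 by norm_num, Real.log_pow]
      congr 1; push_cast; ring
    rw [← e1]; ring

/-! ### The Jacquet integral -/

theorem unip_torus_toSL_row (x : ℂ) {y : ℝ} (hy : 0 < y) (κ : SU2) :
    (unip x * torus y * toSL κ).1 1 0 = ((√y : ℝ) : ℂ)⁻¹ * κ.1 1 0 ∧
    (unip x * torus y * toSL κ).1 1 1 = ((√y : ℝ) : ℂ)⁻¹ * κ.1 1 1 := by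
  rw [Matrix.SpecialLinearGroup.coe_mul, Matrix.SpecialLinearGroup.coe_mul]
  simp [unip, torus, hy, toSL, Matrix.mul_apply, Fin.sum_univ_two]

theorem height_unip_torus_toSL (x : ℂ) {y : ℝ} (hy : 0 < y) (κ : SU2) :
    height (unip x * torus y * toSL κ) = y := by
  obtain ⟨h0, h1⟩ := unip_torus_toSL_row x hy κ
  rw [height, rowNorm_sq_eq, h0, h1, norm_mul, norm_mul, mul_pow, mul_pow, ← mul_add,
    SU2.norm_row_one, mul_one, norm_inv, Complex.norm_real, Real.norm_eq_abs, inv_pow, sq_abs,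
    Real.sq_sqrt hy.le, inv_inv]

theorem kPart_unip_torus_toSL (x : ℂ) {y : ℝ} (hy : 0 < y) (κ : SU2) :
    kPart (unip x * torus y * toSL κ) = κ := by
  obtain ⟨h0, h1⟩ := unip_torus_toSL_row x hy κ
  have hh := height_unip_torus_toSL x hy κ
  have hN : rowNorm (unip x * torus y * toSL κ) = (√y)⁻¹ := by
    have h2 := rowNorm_pos (unip x * torus y * toSL κ)
    have : rowNorm (unip x * torus y * toSL κ) ^ 2 = ((√y)⁻¹) ^ 2 := by
      rw [height, inv_eq_iff_eq_inv] at hh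
      rw [inv_pow, Real.sq_sqrt hy.le, hh]
    exact (pow_left_inj₀ h2.le (by positivity) (by norm_num)).1 this
  have hs : ((√y : ℝ) : ℂ) ≠ 0 := by exact_mod_cast (Real.sqrt_pos.2 hy).ne'
  apply Subtype.ext
  have hval : (kPart (unip x * torus y * toSL κ)).1 =
      !![conj (((√y : ℝ) : ℂ)⁻¹ * κ.1 1 1) / (((√y)⁻¹ : ℝ) : ℂ),
        -conj (((√y : ℝ) : ℂ)⁻¹ * κ.1 1 0) / (((√y)⁻¹ : ℝ) : ℂ);
        (((√y : ℝ) : ℂ)⁻¹ * κ.1 1 0) / (((√y)⁻¹ : ℝ) : ℂ),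
        (((√y : ℝ) : ℂ)⁻¹ * κ.1 1 1) / (((√y)⁻¹ : ℝ) : ℂ)] := by
    rw [← hN, ← h0, ← h1]; rfl
  rw [hval]
  ext i j
  fin_cases i <;> fin_cases j <;> simp <;> field_simp
  · rw [SU2.one_one_eq, Complex.conj_conj]
  · rw [SU2.one_zero_eq, map_neg, Complex.conj_conj, neg_neg]

/-- The coordinates of the Whittaker function on the torus, up to a constant. For `r = 0` these are
the coordinates of `𝐖₂`. -/
noncomputable def whittakerVec (k : ℕ) (r : ℝ) (i : ℕ) (y : ℝ) : ℂ :=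
  ((y ^ ((k : ℝ) / 2 + 1) * √(k.choose i) : ℝ) : ℂ) *
    besselK ((k : ℂ) / 2 - i - Complex.I * r) (4 * Real.pi * y)

/-- The constant in the evaluation of the Jacquet integral. -/
noncomputable def jacquetConst (k : ℕ) (r : ℝ) : ℂ :=
  ((√(k + 1 : ℝ) : ℝ) : ℂ) * (-Complex.I) ^ k * (2 * Real.pi) *
    ((2 * Real.pi : ℝ) : ℂ) ^ ((k : ℂ) / 2 + Complex.I * r) /
      Complex.Gamma (1 + (k : ℂ) / 2 + Complex.I * r)

theorem rowVec_torus (k : ℕ) (r : ℝ) {i : ℕ} (hi : i ≤ k) {y : ℝ} (hy : 0 < y) (t : ℂ) :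
    rowVec k r i ((√y : ℝ) : ℂ) (t / ((√y : ℝ) : ℂ)) =
      ((√(k + 1 : ℝ) : ℝ) : ℂ) * ((-Complex.I) ^ i * ((√(k.choose i) : ℝ) : ℂ)) *
        (y : ℂ) ^ (1 + i + Complex.I * r) *
        (conj t ^ (k - i) * ((‖t‖ ^ 2 + y ^ 2 : ℝ) : ℂ) ^ (-(1 + (k : ℂ) / 2 + Complex.I * r))) := by
  have hs := Real.sqrt_pos.2 hy
  have e1 : ((‖((√y : ℝ) : ℂ)‖ ^ 2 + ‖t / ((√y : ℝ) : ℂ)‖ ^ 2 : ℝ)) = y⁻¹ * (‖t‖ ^ 2 + y ^ 2) := by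
    rw [norm_div, div_pow, Complex.norm_real, Real.norm_eq_abs, sq_abs, Real.sq_sqrt hy.le]
    field_simp; ring
  unfold rowVec
  rw [e1, Complex.ofReal_mul, Complex.mul_cpow_ofReal_nonneg (by positivity) (by positivity), map_div₀,
    Complex.conj_ofReal, div_pow]
  have e2 : (((y⁻¹ : ℝ) : ℂ)) ^ (-(1 + (k : ℂ) / 2 + Complex.I * r)) * ((√y : ℝ) : ℂ) ^ i /
      ((√y : ℝ) : ℂ) ^ (k - i) = (y : ℂ) ^ (1 + i + Complex.I * r) := by
    rw [div_eq_mul_inv, ← Complex.cpow_natCast, ← Complex.cpow_natCast, ← Complex.cpow_neg,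
      ofReal_cpow_eq_exp hs, ofReal_cpow_eq_exp hs, ofReal_cpow_eq_exp hy,
      ofReal_cpow_eq_exp (by positivity), Real.log_inv, Real.log_sqrt hy.le, ← Complex.exp_add,
      ← Complex.exp_add]
    congr 1; push_cast [Nat.cast_sub hi]; ring
  rw [← e2]; ring

theorem const_mul_besselKernel_two (k : ℕ) (r : ℝ) {i : ℕ} (hi : i ≤ k) {y : ℝ} (hy : 0 < y) :
    ((√(k + 1 : ℝ) : ℝ) : ℂ) * ((-Complex.I) ^ i * ((√(k.choose i) : ℝ) : ℂ)) *
      (y : ℂ) ^ (1 + i + Complex.I * r) *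
        besselKernel (k - i) (1 + (k : ℂ) / 2 + Complex.I * r) y 2 =
      jacquetConst k r * whittakerVec k r i y := by
  have hπ := Real.pi_pos
  unfold besselKernel jacquetConst whittakerVec
  have e0 : (1 + (k : ℂ) / 2 + Complex.I * r - 1 - ((k - i : ℕ) : ℂ)) =
      -((k : ℂ) / 2 - i - Complex.I * r) := by
    rw [Nat.cast_sub hi]; ring
  have e1 : (2 * (Real.pi * ‖(2 : ℂ)‖ * y)) = 4 * Real.pi * y := by
    rw [Complex.norm_ofNat]; ring
  have e2 : -(Real.pi * Complex.I * conj (2 : ℂ)) = ((2 * Real.pi : ℝ) : ℂ) * -Complex.I := by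
    rw [Complex.conj_ofNat]; push_cast; ring
  have e3 : (-Complex.I) ^ k = (-Complex.I) ^ i * (-Complex.I) ^ (k - i) := by
    rw [← pow_add]; congr 1; omega
  rw [e0, besselK_neg, e1, e2, e3, mul_pow, Complex.norm_ofNat]
  have e4 : (y : ℂ) ^ (1 + i + Complex.I * r) * ((2 * Real.pi : ℝ) : ℂ) ^ (k - i) *
      ((Real.pi * 2 / y : ℝ) : ℂ) ^ (-((k : ℂ) / 2 - i - Complex.I * r)) =
      ((2 * Real.pi : ℝ) : ℂ) ^ ((k : ℂ) / 2 + Complex.I * r) * ((y ^ ((k : ℝ) / 2 + 1) : ℝ) : ℂ) := by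
    rw [← Complex.cpow_natCast, Complex.ofReal_cpow hy.le, ofReal_cpow_eq_exp hy,
      ofReal_cpow_eq_exp hy, ofReal_cpow_eq_exp (by positivity), ofReal_cpow_eq_exp (by positivity),
      ofReal_cpow_eq_exp (by positivity), Real.log_div (by positivity) hy.ne', mul_comm Real.pi 2,
      ← Complex.exp_add, ← Complex.exp_add, ← Complex.exp_add]
    congr 1; push_cast [Nat.cast_sub hi]; ring
  push_cast at e4 ⊢
  linear_combination (((√(k + 1 : ℝ) : ℝ) : ℂ) * ((-Complex.I) ^ i * ((√(k.choose i) : ℝ) : ℂ)) *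
    (2 * Real.pi) * (-Complex.I) ^ (k - i) / Complex.Gamma (1 + (k : ℂ) / 2 + Complex.I * r) *
    besselK ((k : ℂ) / 2 - i - Complex.I * r) (4 * Real.pi * y)) * e4

/-- Evaluation of the Jacquet integral at `n(x₀) a(y) κ`. -/
theorem tendsto_jacquetTrunc (k : ℕ) (r : ℝ) (j : Fin (k + 1)) (x₀ : ℂ) {y : ℝ} (hy : 0 < y)
    (κ : SU2) :
    Tendsto (jacquetTrunc (inducedVec k r j) (unip x₀ * torus y * toSL κ)) atTop
      (𝓝 (jacquetConst k r * (addChar x₀ * ∑ i, rho k κ i j * whittakerVec k r i y))) := by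
  set s : ℂ := 1 + (k : ℂ) / 2 + Complex.I * r with hs
  have hsre : s.re = 1 + k / 2 := by simp [hs]
  set C : ℕ → ℂ := fun i => ((√(k + 1 : ℝ) : ℝ) : ℂ) *
    ((-Complex.I) ^ i * ((√(k.choose i) : ℝ) : ℂ)) * (y : ℂ) ^ (1 + i + Complex.I * r) with hC
  set F : ℕ → ℂ → ℂ := fun i x =>
    (conj (x + x₀) ^ (k - i) * ((‖x + x₀‖ ^ 2 + y ^ 2 : ℝ) : ℂ) ^ (-s)) * conj (addChar x) with hF
  have hpt (x : ℂ) : inducedVec k r j (weyl * unip x * (unip x₀ * torus y * toSL κ)) *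
      conj (addChar x) = ∑ i : Fin (k + 1), rho k κ i j * (C i * F i x) := by
    have e : weyl * unip x * (unip x₀ * torus y * toSL κ) =
        weyl * unip x * unip x₀ * torus y * toSL κ := by simp only [mul_assoc]
    rw [e, inducedVec_mul_toSL, Finset.sum_mul]
    refine Finset.sum_congr rfl fun i _ => ?_
    have hrow : (weyl * unip x * unip x₀ * torus y).1 1 0 = ((√y : ℝ) : ℂ) ∧
        (weyl * unip x * unip x₀ * torus y).1 1 1 = (x + x₀) / ((√y : ℝ) : ℂ) := by
      rw [Matrix.SpecialLinearGroup.coe_mul, Matrix.SpecialLinearGroup.coe_mul,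
        Matrix.SpecialLinearGroup.coe_mul]
      simp [weyl, unip, torus, hy, Matrix.mul_apply, Fin.sum_univ_two]
      ring
    rw [inducedVec_eq_rowVec, hrow.1, hrow.2, rowVec_torus k r (Nat.lt_succ_iff.1 i.2) hy]
    simp only [hC, hF]; ring
  have hcont (i : ℕ) : Continuous (F i) := by
    have h1 : Continuous fun x : ℂ => ((‖x + x₀‖ ^ 2 + y ^ 2 : ℝ) : ℂ) ^ (-s) := by
      refine Continuous.cpow (by fun_prop) continuous_const fun x => ?_
      have : 0 < ‖x + x₀‖ ^ 2 + y ^ 2 := by positivity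
      exact Complex.ofReal_mem_slitPlane.2 this
    exact (((Complex.continuous_conj.comp (continuous_id.add continuous_const)).pow _).mul h1).mul
      (Complex.continuous_conj.comp continuous_addChar)
  have hint (i : ℕ) (R : ℝ) : Integrable (F i) (volume.restrict (Metric.closedBall 0 R)) :=
    (hcont i).continuousOn.integrableOn_compact (isCompact_closedBall _ _)
  have hJ (R : ℝ) : jacquetTrunc (inducedVec k r j) (unip x₀ * torus y * toSL κ) R =
      ∑ i : Fin (k + 1), rho k κ i j * (C i * ∫ x in Metric.closedBall (0 : ℂ) R, F i x) := by
    unfold jacquetTrunc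
    simp only [hpt]
    rw [integral_finsetSum _ fun (i : Fin (k + 1)) _ => ((hint i R).const_mul (C i)).const_mul _]
    simp only [integral_const_mul]
  have hlim : Tendsto (fun R => ∑ i : Fin (k + 1), rho k κ i j *
      (C i * ∫ x in Metric.closedBall (0 : ℂ) R, F i x)) atTop
      (𝓝 (∑ i : Fin (k + 1), rho k κ i j * (C i * (addChar x₀ * besselKernel (k - i) s y 2)))) := by
    refine tendsto_finsetSum _ fun i _ => Tendsto.const_mul _ (Tendsto.const_mul _ ?_)
    refine tendsto_truncated_fourier (k - i) ?_ hy x₀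
    have : ((k - (i : ℕ) : ℕ) : ℝ) ≤ k := by exact_mod_cast Nat.sub_le _ _
    rw [hsre]; linarith
  rw [show jacquetTrunc (inducedVec k r j) (unip x₀ * torus y * toSL κ) = _ from funext hJ]
  convert hlim using 2
  rw [Finset.mul_sum, Finset.mul_sum]
  refine Finset.sum_congr rfl fun i _ => ?_
  have := const_mul_besselKernel_two k r (Nat.lt_succ_iff.1 i.2) hy
  simp only [hC]
  linear_combination (-(addChar x₀ * rho k κ i j)) * this

/-! ### The normalised Whittaker embedding -/

theorem jacquetConst_ne_zero (k : ℕ) (r : ℝ) : jacquetConst k r ≠ 0 := by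
  have h1 : ((√(k + 1 : ℝ) : ℝ) : ℂ) ≠ 0 := by
    have : 0 < √(k + 1 : ℝ) := Real.sqrt_pos.2 (by positivity)
    exact_mod_cast this.ne'
  have h2 : Complex.Gamma (1 + (k : ℂ) / 2 + Complex.I * r) ≠ 0 := by
    apply Complex.Gamma_ne_zero_of_re_pos
    simp; positivity
  have h3 : (2 * (Real.pi : ℂ)) ≠ 0 := by exact_mod_cast Real.two_pi_pos.ne'
  have h4 : ((2 * Real.pi : ℝ) : ℂ) ^ ((k : ℂ) / 2 + Complex.I * r) ≠ 0 := by
    rw [ofReal_cpow_eq_exp Real.two_pi_pos]; exact Complex.exp_ne_zero _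
  have h5 : (-Complex.I) ^ k ≠ 0 := pow_ne_zero _ (neg_ne_zero.2 Complex.I_ne_zero)
  unfold jacquetConst
  exact div_ne_zero (mul_ne_zero (mul_ne_zero (mul_ne_zero h1 h5) h3) h4) h2

/-- The positive constant that makes the Whittaker embedding unitary. -/
noncomputable def whittakerNorm (k : ℕ) (r : ℝ) : ℝ :=
  4 * √2 * Real.pi * ((2 * Real.pi) ^ ((k : ℝ) / 2) * √(k + 1 : ℝ) /
    ‖Complex.Gamma (1 + (k : ℂ) / 2 + Complex.I * r)‖)

theorem norm_Gamma_pos (k : ℕ) (r : ℝ) :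
    0 < ‖Complex.Gamma (1 + (k : ℂ) / 2 + Complex.I * r)‖ :=
  norm_pos_iff.2 (Complex.Gamma_ne_zero_of_re_pos (by simp; positivity))

theorem whittakerNorm_pos (k : ℕ) (r : ℝ) : 0 < whittakerNorm k r := by
  have := norm_Gamma_pos k r
  have := Real.pi_pos
  unfold whittakerNorm; positivity

theorem whittakerNorm_sq (k : ℕ) (r : ℝ) : whittakerNorm k r ^ 2 =
    8 * (2 * Real.pi) ^ (k + 2) * (k + 1) / ‖Complex.Gamma (1 + (k : ℂ) / 2 + Complex.I * r)‖ ^ 2 := by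
  unfold whittakerNorm
  have e : ((2 * Real.pi) ^ ((k : ℝ) / 2)) ^ 2 = (2 * Real.pi) ^ k := by
    rw [← Real.rpow_natCast, ← Real.rpow_mul Real.two_pi_pos.le, ← Real.rpow_natCast]
    congr 1; push_cast; ring
  rw [mul_pow, div_pow, mul_pow, mul_pow, mul_pow, mul_pow, e, Real.sq_sqrt (by positivity),
    Real.sq_sqrt (by positivity)]
  ring

theorem integral_norm_whittakerVec_sq (k : ℕ) (r : ℝ) :
    ∫ y, ‖whittakerVec k r 0 y‖ ^ 2 ∂mulHaar = (whittakerNorm k r ^ 2)⁻¹ := by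
  set μ : ℂ := (k : ℂ) / 2 - Complex.I * r with hμ
  have hμc : conj μ = (k : ℂ) / 2 + Complex.I * r := by
    simp [hμ, Complex.conj_ofNat]
  have hre : |μ.re| + |(conj μ).re| < ((k : ℂ) + 2).re := by
    rw [hμc]; simp [hμ]
    rw [abs_of_nonneg (by positivity)]; linarith
  have hpt : ∀ᵐ y ∂mulHaar, ((‖whittakerVec k r 0 y‖ ^ 2 : ℝ) : ℂ) = (y : ℂ) ^ ((k : ℂ) + 2) *
      (besselK μ (4 * Real.pi * y) * besselK (conj μ) (4 * Real.pi * y)) := by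
    filter_upwards [ae_mulHaar_pos] with y hy
    rw [← Complex.normSq_eq_norm_sq, ← Complex.mul_conj, whittakerVec, map_mul, besselK_conj,
      Complex.conj_ofReal]
    simp only [Nat.choose_zero_right, Nat.cast_one, Real.sqrt_one, mul_one, Nat.cast_zero, sub_zero]
    rw [← hμ]
    have e : ((y ^ ((k : ℝ) / 2 + 1) : ℝ) : ℂ) * ((y ^ ((k : ℝ) / 2 + 1) : ℝ) : ℂ) =
        (y : ℂ) ^ ((k : ℂ) + 2) := by
      rw [Complex.ofReal_cpow hy.le, ofReal_cpow_eq_exp hy, ofReal_cpow_eq_exp hy, ← Complex.exp_add]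
      congr 1; push_cast; ring
    rw [← e]; ring
  have h := (integral_mulHaar_besselK_mul_besselK hre).2
  rw [← integral_congr_ae hpt, integral_complex_ofReal] at h
  have e1 : ((k : ℂ) + 2 + (μ + conj μ)) / 2 = (k : ℂ) + 1 := by rw [hμc, hμ]; ring
  have e2 : ((k : ℂ) + 2 - (μ + conj μ)) / 2 = 1 := by rw [hμc, hμ]; ring
  have e3 : ((k : ℂ) + 2 + (μ - conj μ)) / 2 = conj (1 + (k : ℂ) / 2 + Complex.I * r) := by
    rw [hμc, hμ]; simp [Complex.conj_ofNat]; ring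
  have e4 : ((k : ℂ) + 2 - (μ - conj μ)) / 2 = 1 + (k : ℂ) / 2 + Complex.I * r := by
    rw [hμc, hμ]; ring
  have e5 : Complex.Gamma ((k : ℂ) + 2) = ((k : ℂ) + 1) * Complex.Gamma ((k : ℂ) + 1) := by
    rw [← Complex.Gamma_add_one _ (by exact_mod_cast Nat.succ_ne_zero k)]; congr 1; ring
  have e6 : ((2 * Real.pi : ℝ) : ℂ) ^ (-((k : ℂ) + 2)) = (((2 * Real.pi) ^ (k + 2) : ℝ) : ℂ)⁻¹ := by
    rw [Complex.cpow_neg, show ((k : ℂ) + 2) = ((k + 2 : ℕ) : ℂ) by push_cast; ring,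
      Complex.cpow_natCast]; push_cast; ring
  have hG : Complex.Gamma ((k : ℂ) + 1) ≠ 0 := by
    rw [Complex.Gamma_nat_eq_factorial]; exact_mod_cast Nat.factorial_ne_zero k
  rw [e1, e2, e3, e4, Complex.Gamma_one, Complex.Gamma_conj, mul_comm (conj _), Complex.mul_conj,
    Complex.normSq_eq_norm_sq, e5, e6] at h
  have hk : ((k : ℂ) + 1) ≠ 0 := by exact_mod_cast Nat.succ_ne_zero k
  have hπ : (((2 * Real.pi) ^ (k + 2) : ℝ) : ℂ) ≠ 0 := by
    exact_mod_cast (pow_pos Real.two_pi_pos _).ne'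
  rw [whittakerNorm_sq]
  have hn := norm_Gamma_pos k r
  apply Complex.ofReal_injective
  rw [h]
  push_cast at hπ ⊢
  field_simp

theorem besselK_half_sub_eq_ofReal (k i : ℕ) (x : ℝ) :
    besselK ((k : ℂ) / 2 - i) x = ((besselK ((k : ℂ) / 2 - i) x).re : ℂ) :=
  exists_besselK_eq_ofReal (Or.inl (by simp [Complex.conj_ofNat])) x

theorem boldW_apply (k : ℕ) (y : ℝ) (i : Fin (k + 1)) : boldW k y i = whittakerVec k 0 i y := by
  simp [boldW, whittakerVec]

theorem conj_boldW_apply (k : ℕ) (y : ℝ) (i : Fin (k + 1)) : conj (boldW k y i) = boldW k y i := by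
  rw [boldW_apply, whittakerVec, Complex.ofReal_zero, mul_zero, sub_zero,
    besselK_half_sub_eq_ofReal, map_mul, Complex.conj_ofReal, Complex.conj_ofReal]

/-- The positivity in the definition of a Whittaker embedding makes sense because for `k = 0` or `r = 0`
the order of the Bessel function is imaginary or real. -/
theorem eventually_whittakerVec_pos {k : ℕ} {r : ℝ} (h : k = 0 ∨ r = 0) :
    ∀ᶠ y : ℝ in atTop, ∃ t : ℝ, 0 < t ∧ whittakerVec k r 0 y = t := by
  have hpos : ∀ᶠ y : ℝ in atTop, 0 < (besselK ((k : ℂ) / 2 - Complex.I * r) (4 * Real.pi * y)).re := by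
    rcases h with h | h
    · subst h
      filter_upwards [eventually_gt_atTop (r ^ 2)] with y hy
      have := besselK_re_pos_of_imag (x := 4 * Real.pi * y) (r := r) (by
        have := Real.pi_gt_three
        nlinarith [sq_nonneg r])
      rw [← besselK_neg] at this
      simpa using this
    · subst h
      filter_upwards [eventually_gt_atTop 0] with y hy
      have := besselK_re_pos_of_real (x := 4 * Real.pi * y) (by positivity) ((k : ℝ) / 2)
      simpa using this
  have hreal (y : ℝ) : besselK ((k : ℂ) / 2 - Complex.I * r) (4 * Real.pi * y) =
      ((besselK ((k : ℂ) / 2 - Complex.I * r) (4 * Real.pi * y)).re : ℂ) := by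
    apply exists_besselK_eq_ofReal
    rcases h with h | h
    · right; subst h; simp
    · left; subst h; simp [Complex.conj_ofNat]
  filter_upwards [hpos, eventually_gt_atTop 0] with y hy hy0
  refine ⟨y ^ ((k : ℝ) / 2 + 1) * (besselK ((k : ℂ) / 2 - Complex.I * r) (4 * Real.pi * y)).re,
    by positivity, ?_⟩
  unfold whittakerVec
  rw [Complex.ofReal_mul _ (besselK _ _).re, ← hreal y]
  simp only [Nat.choose_zero_right, Nat.cast_one, Real.sqrt_one, mul_one, Nat.cast_zero, sub_zero]

theorem toSL_one : toSL 1 = 1 := rfl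

theorem torus_eq_unip_mul (y : ℝ) : torus y = unip 0 * torus y * toSL 1 := by
  have : unip 0 = 1 := by
    ext i j; fin_cases i <;> fin_cases j <;> simp [unip]
  rw [this, toSL_one, one_mul, mul_one]

theorem torus_mul_toSL_eq (y : ℝ) (κ : SU2) : torus y * toSL κ = unip 0 * torus y * toSL κ := by
  have : unip 0 = 1 := by
    ext i j; fin_cases i <;> fin_cases j <;> simp [unip]
  rw [this, one_mul]

theorem addChar_zero : addChar 0 = 1 := by simp [addChar]

theorem rho_one_zero (k : ℕ) (i : Fin (k + 1)) : rho k 1 i 0 = if i = 0 then 1 else 0 := by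
  rw [rho_zero_right]
  split_ifs with h
  · subst h; simp
  · have h0 : (i : ℕ) ≠ 0 := fun h' => h (Fin.ext h')
    have : (1 : SU2).1 1 0 = 0 := by simp
    rw [this, zero_pow h0, mul_zero, mul_zero]

/-- The values of a multiple of the Jacquet integral. -/
theorem eq_of_tendsto_jacquetTrunc {k : ℕ} {r : ℝ} {j : Fin (k + 1)} {c w : ℂ} {x₀ : ℂ} {y : ℝ}
    (hy : 0 < y) {κ : SU2}
    (h : Tendsto (fun R : ℝ => c * jacquetTrunc (inducedVec k r j) (unip x₀ * torus y * toSL κ) R)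
      atTop (𝓝 w)) :
    w = c * jacquetConst k r * (addChar x₀ * ∑ i, rho k κ i j * whittakerVec k r i y) := by
  rw [mul_assoc]
  exact tendsto_nhds_unique h ((tendsto_jacquetTrunc k r j x₀ hy κ).const_mul c)

theorem sum_rho_one_mul (k : ℕ) (w : ℕ → ℂ) : ∑ i : Fin (k + 1), rho k 1 i 0 * w i = w 0 := by
  simp only [rho_one_zero]
  rw [Finset.sum_eq_single 0] <;> simp +contextual

/-- The unitarity and the positivity condition determine the constant. -/
theorem norm_condition_iff {k : ℕ} {r : ℝ} (h : k = 0 ∨ r = 0) {b : ℂ} {w : ℝ → ℂ}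
    (hw : ∀ y, 0 < y → w y = b * whittakerVec k r 0 y) :
    (∫ y, ‖w y‖ ^ 2 ∂mulHaar = 1 ∧ ∀ᶠ y : ℝ in atTop, ∃ t : ℝ, 0 < t ∧ w y = t) ↔
      b = whittakerNorm k r := by
  have hN := whittakerNorm_pos k r
  have h1 : ∫ y, ‖w y‖ ^ 2 ∂mulHaar = ‖b‖ ^ 2 * (whittakerNorm k r ^ 2)⁻¹ := by
    rw [← integral_norm_whittakerVec_sq, ← integral_const_mul]
    refine integral_congr_ae ?_
    filter_upwards [ae_mulHaar_pos] with y hy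
    rw [hw y hy, norm_mul, mul_pow]
  have hev := eventually_whittakerVec_pos h
  rw [h1]
  constructor
  · rintro ⟨h2, h3⟩
    obtain ⟨y, ⟨t, ht, hty⟩, ⟨u, hu, huy⟩, hy⟩ :=
      (h3.and (hev.and (eventually_gt_atTop 0))).exists
    rw [hw y hy, huy] at hty
    have hb : b = ((t / u : ℝ) : ℂ) := by
      have : (u : ℂ) ≠ 0 := by exact_mod_cast hu.ne'
      push_cast; rw [eq_div_iff this, hty]
    rw [hb, Complex.norm_real, Real.norm_eq_abs, sq_abs, mul_inv_eq_one₀ (by positivity)] at h2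
    rw [hb, (pow_left_inj₀ (by positivity) hN.le (by norm_num)).1 h2]
  · intro hb
    subst hb
    refine ⟨?_, ?_⟩
    · rw [Complex.norm_real, Real.norm_eq_abs, sq_abs, mul_inv_cancel₀ (by positivity)]
    · filter_upwards [hev, eventually_gt_atTop 0] with y ⟨t, ht, hty⟩ hy
      exact ⟨whittakerNorm k r * t, by positivity, by rw [hw y hy, hty]; push_cast; ring⟩

/-- The values of a Whittaker embedding in Iwasawa coordinates. -/
theorem IsWhittakerEmbedding.apply_eq {k : ℕ} {r : ℝ} (h : k = 0 ∨ r = 0)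
    {W : Fin (k + 1) → SL2 → ℂ} (hW : IsWhittakerEmbedding k r W) (j : Fin (k + 1)) (x₀ : ℂ) {y : ℝ}
    (hy : 0 < y) (κ : SU2) : W j (unip x₀ * torus y * toSL κ) =
      whittakerNorm k r * (addChar x₀ * ∑ i, rho k κ i j * whittakerVec k r i y) := by
  obtain ⟨c, hc, h1, h2⟩ := hW
  rw [← (norm_condition_iff h (b := c * jacquetConst k r) fun y hy => by
    have := hc 0 (torus y)
    rw [torus_eq_unip_mul] at this
    have := eq_of_tendsto_jacquetTrunc hy this
    rwa [← torus_eq_unip_mul, addChar_zero, one_mul,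
      sum_rho_one_mul k fun i => whittakerVec k r i y] at this).1 ⟨h1, h2⟩]
  exact eq_of_tendsto_jacquetTrunc hy (hc j _)

theorem existsUnique_isWhittakerEmbedding {k : ℕ} {r : ℝ} (h : k = 0 ∨ r = 0) :
    ∃! W, IsWhittakerEmbedding k r W := by
  have hJ := jacquetConst_ne_zero k r
  have hex (g : SL2) : ∃ x, g = unip x * torus (height g) * toSL (kPart g) := iwasawa g
  choose x hx using hex
  have hlim (j : Fin (k + 1)) (g : SL2) :
      Tendsto (fun R : ℝ => whittakerNorm k r / jacquetConst k r * jacquetTrunc (inducedVec k r j) g R)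
        atTop (𝓝 (whittakerNorm k r * (addChar (x g) *
          ∑ i, rho k (kPart g) i j * whittakerVec k r i (height g)))) := by
    have h1 := (tendsto_jacquetTrunc k r j (x g) (height_pos g) (kPart g)).const_mul
      (whittakerNorm k r / jacquetConst k r)
    rw [← hx g, ← mul_assoc, div_mul_cancel₀ _ hJ] at h1
    exact h1
  refine ⟨fun j g => whittakerNorm k r * (addChar (x g) *
    ∑ i, rho k (kPart g) i j * whittakerVec k r i (height g)),
    ⟨whittakerNorm k r / jacquetConst k r, hlim, ?_⟩, fun W hW => ?_⟩
  · refine (norm_condition_iff h (b := whittakerNorm k r) fun y hy => ?_).2 rfl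
    have h1 := hlim 0 (torus y)
    rw [torus_eq_unip_mul] at h1
    have h2 := eq_of_tendsto_jacquetTrunc hy h1
    rw [← torus_eq_unip_mul, addChar_zero, one_mul,
      sum_rho_one_mul k fun i => whittakerVec k r i y, div_mul_cancel₀ _ hJ] at h2
    exact h2
  · ext j g
    have h1 := hW.apply_eq h j (x g) (height_pos g) (kPart g)
    rw [← hx g] at h1
    exact h1

/-! ### The Whittaker triple integrals -/

theorem inducedVec_torus_mul_toSL (k : ℕ) (r : ℝ) (j : Fin (k + 1)) {y : ℝ} (hy : 0 < y) (κ : SU2) :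
    inducedVec k r j (torus y * toSL κ) =
      (y : ℂ) ^ (1 + Complex.I * r) * (((√(k + 1 : ℝ) : ℝ) : ℂ) * rho k κ 0 j) := by
  rw [torus_mul_toSL_eq]
  unfold inducedVec inducedExt
  rw [height_unip_torus_toSL 0 hy, kPart_unip_torus_toSL 0 hy]

instance : SigmaFinite mulHaar := by
  unfold mulHaar
  exact SigmaFinite.withDensity_ofReal _

theorem rho_zero (κ : SU2) : rho 0 κ 0 0 = 1 := by
  rw [rho_zero_left]; simp

theorem whittakerNorm_zero_left (r : ℝ) :
    whittakerNorm 0 r = 4 * √2 * Real.pi * ‖Complex.Gamma (1 + Complex.I * r)‖⁻¹ := by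
  simp [whittakerNorm]

theorem whittakerNorm_zero_right (k : ℕ) : whittakerNorm k 0 =
    4 * √2 * Real.pi * ((2 * Real.pi) ^ ((k : ℝ) / 2) * √(k + 1 : ℝ) /
      Real.Gamma (1 + (k : ℝ) / 2)) := by
  have h : ‖Complex.Gamma (1 + (k : ℂ) / 2 + Complex.I * (0 : ℝ))‖ = Real.Gamma (1 + (k : ℝ) / 2) := by
    rw [Complex.ofReal_zero, mul_zero, add_zero,
      show (1 + (k : ℂ) / 2) = ((1 + (k : ℝ) / 2 : ℝ) : ℂ) by push_cast; ring, Complex.Gamma_ofReal,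
      Complex.norm_real, Real.norm_of_nonneg (Real.Gamma_pos_of_pos (by positivity)).le]
  rw [whittakerNorm, h]

theorem IsWhittakerEmbedding.apply_spherical {r : ℝ} {W : Fin (0 + 1) → SL2 → ℂ}
    (hW : IsWhittakerEmbedding 0 r W) {y : ℝ} (hy : 0 < y) (κ : SU2) :
    W 0 (torus y * toSL κ) = ((whittakerNorm 0 r * y : ℝ) : ℂ) *
      besselK (Complex.I * r) (4 * Real.pi * y) := by
  rw [torus_mul_toSL_eq, hW.apply_eq (Or.inl rfl) 0 0 hy κ, addChar_zero, one_mul]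
  simp only [Fin.sum_univ_one, Nat.reduceAdd, Fin.isValue, rho_zero, one_mul, Fin.val_zero,
    whittakerVec]
  rw [← besselK_neg]
  simp
  ring

theorem IsWhittakerEmbedding.apply_minimal {k : ℕ} {W : Fin (k + 1) → SL2 → ℂ}
    (hW : IsWhittakerEmbedding k 0 W) {y : ℝ} (hy : 0 < y) (κ : SU2) (j : Fin (k + 1)) :
    W j (torus y * toSL κ) = (whittakerNorm k 0 : ℂ) * ∑ i, rho k κ i j * conj (boldW k y i) := by
  rw [torus_mul_toSL_eq, hW.apply_eq (Or.inr rfl) j 0 hy κ, addChar_zero, one_mul]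
  simp only [conj_boldW_apply]
  simp only [boldW_apply]

theorem continuous_rho_mul_conj (k : ℕ) (i j : Fin (k + 1)) :
    Continuous fun κ => rho k κ i 0 * conj (rho k κ j 0) :=
  (continuous_rho_zero_right k i).mul
    (Complex.continuous_conj.comp (continuous_rho_zero_right k j))

/-- Integration over `K` of products of two vectors of `ρ_k`, by Schur orthogonality. -/
theorem integral_prod_sum_mul_rho {k : ℕ} (f : Fin (k + 1) → Fin (k + 1) → ℝ → ℂ)
    (hf : ∀ i j, Integrable (f i j) mulHaar) (F : ℝ × SU2 → ℂ)
    (hF : ∀ y, 0 < y → ∀ κ, F (y, κ) = ∑ i, ∑ j, f i j y * (rho k κ i 0 * conj (rho k κ j 0))) :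
    Integrable F (mulHaar.prod haarK) ∧
      ∫ p, F p ∂(mulHaar.prod haarK) = ((k : ℂ) + 1)⁻¹ * ∑ i, ∫ y, f i i y ∂mulHaar := by
  have hae : (fun p : ℝ × SU2 => ∑ i, ∑ j, f i j p.1 * (rho k p.2 i 0 * conj (rho k p.2 j 0)))
      =ᵐ[mulHaar.prod haarK] F := by
    have : ∀ᵐ p ∂(mulHaar.prod haarK), 0 < p.1 :=
      Measure.quasiMeasurePreserving_fst.ae ae_mulHaar_pos
    filter_upwards [this] with p hp
    exact (hF p.1 hp p.2).symm
  have hi (i j : Fin (k + 1)) : Integrable (fun p : ℝ × SU2 =>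
      f i j p.1 * (rho k p.2 i 0 * conj (rho k p.2 j 0))) (mulHaar.prod haarK) :=
    (hf i j).mul_prod (integrable_of_continuous_SU2 (continuous_rho_mul_conj k i j))
  refine ⟨(integrable_finsetSum _ fun i _ => integrable_finsetSum _ fun j _ => hi i j).congr hae, ?_⟩
  rw [← integral_congr_ae hae, integral_finsetSum _ fun i _ => integrable_finsetSum _ fun j _ => hi i j,
    Finset.mul_sum]
  refine Finset.sum_congr rfl fun i _ => ?_
  rw [integral_finsetSum _ fun j _ => hi i j]
  have h1 (j : Fin (k + 1)) : ∫ p : ℝ × SU2, f i j p.1 * (rho k p.2 i 0 * conj (rho k p.2 j 0))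
      ∂(mulHaar.prod haarK) = (∫ y, f i j y ∂mulHaar) * if i = j then ((k : ℂ) + 1)⁻¹ else 0 := by
    rw [integral_prod_mul (f i j) (fun κ => rho k κ i 0 * conj (rho k κ j 0)), integral_rho_mul_conj]
  simp only [h1]
  simp [mul_comm]

theorem abs_re_half_sub_le {k i : ℕ} (hi : i ≤ k) : |((k : ℂ) / 2 - i).re| ≤ k / 2 := by
  have : (i : ℝ) ≤ k := by exact_mod_cast hi
  have h0 : (0 : ℝ) ≤ i := by positivity
  simp
  rw [abs_le]; constructor <;> linarith

theorem boldW_apply_eq (k : ℕ) {y : ℝ} (hy : 0 < y) (i : Fin (k + 1)) :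
    boldW k y i = ((√(k.choose i) : ℝ) : ℂ) * ((y : ℂ) ^ ((k : ℂ) / 2 + 1) *
      besselK ((k : ℂ) / 2 - (i : ℕ)) (4 * Real.pi * y)) := by
  have : ((y ^ ((k : ℝ) / 2 + 1) : ℝ) : ℂ) = (y : ℂ) ^ ((k : ℂ) / 2 + 1) := by
    rw [Complex.ofReal_cpow hy.le]; push_cast; rfl
  simp only [boldW]
  rw [Complex.ofReal_mul, this]; ring

theorem norm_boldW_sq (k : ℕ) (y : ℝ) :
    ((‖boldW k y‖ ^ 2 : ℝ) : ℂ) = ∑ i, boldW k y i * conj (boldW k y i) := by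
  rw [EuclideanSpace.norm_sq_eq]
  push_cast
  refine Finset.sum_congr rfl fun i _ => ?_
  rw [Complex.mul_conj, Complex.normSq_eq_norm_sq]; push_cast; rfl

theorem integrable_boldW_mul_boldW (k : ℕ) (r : ℝ) (i j : Fin (k + 1)) :
    Integrable (fun y : ℝ => (y : ℂ) ^ (1 + Complex.I * r) * (boldW k y i * conj (boldW k y j)) *
      (((y ^ 2)⁻¹ : ℝ) : ℂ)) mulHaar ∧
    ∫ y : ℝ, (y : ℂ) ^ (1 + Complex.I * r) * (boldW k y i * conj (boldW k y i)) *
      (((y ^ 2)⁻¹ : ℝ) : ℂ) ∂mulHaar = ((2 * Real.pi : ℝ) : ℂ) ^ (-(k + 1 + Complex.I * r)) / 8 /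
      Complex.Gamma (k + (1 + Complex.I * r)) * (Complex.Gamma ((1 + k + Complex.I * r) / 2) ^ 2) *
      (k.choose i * (Complex.Gamma ((1 + Complex.I * r) / 2 + i) *
        Complex.Gamma ((1 + Complex.I * r) / 2 + (k - i : ℕ)))) := by
  have hre (i j : Fin (k + 1)) : |((k : ℂ) / 2 - (i : ℕ)).re| + |((k : ℂ) / 2 - (j : ℕ)).re| <
      ((k : ℂ) + 1 + Complex.I * r).re := by
    have h1 := abs_re_half_sub_le (Nat.lt_succ_iff.1 i.2)
    have h2 := abs_re_half_sub_le (Nat.lt_succ_iff.1 j.2)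
    have h3 : ((k : ℂ) + 1 + Complex.I * r).re = k + 1 := by simp
    rw [h3]; linarith
  have hpt (i j : Fin (k + 1)) : (fun y : ℝ => ((√(k.choose i) : ℝ) : ℂ) * ((√(k.choose j) : ℝ) : ℂ) *
      ((y : ℂ) ^ ((k : ℂ) + 1 + Complex.I * r) * (besselK ((k : ℂ) / 2 - (i : ℕ)) (4 * Real.pi * y) *
        besselK ((k : ℂ) / 2 - (j : ℕ)) (4 * Real.pi * y)))) =ᵐ[mulHaar]
      (fun y : ℝ => (y : ℂ) ^ (1 + Complex.I * r) * (boldW k y i * conj (boldW k y j)) *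
        (((y ^ 2)⁻¹ : ℝ) : ℂ)) := by
    filter_upwards [ae_mulHaar_pos] with y hy
    have e : (y : ℂ) ^ ((k : ℂ) + 1 + Complex.I * r) = (y : ℂ) ^ (1 + Complex.I * r) *
        ((y : ℂ) ^ ((k : ℂ) / 2 + 1) * (y : ℂ) ^ ((k : ℂ) / 2 + 1)) * (((y ^ 2)⁻¹ : ℝ) : ℂ) := by
      have e2 : (((y ^ 2)⁻¹ : ℝ) : ℂ) = (y : ℂ) ^ (-2 : ℂ) := by
        rw [Complex.cpow_neg, show (2 : ℂ) = ((2 : ℕ) : ℂ) by norm_num, Complex.cpow_natCast]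
        push_cast; rfl
      rw [e2, ofReal_cpow_eq_exp hy, ofReal_cpow_eq_exp hy, ofReal_cpow_eq_exp hy,
        ofReal_cpow_eq_exp hy, ← Complex.exp_add, ← Complex.exp_add, ← Complex.exp_add]
      congr 1; ring
    rw [conj_boldW_apply, boldW_apply_eq k hy, boldW_apply_eq k hy, e]; ring
  refine ⟨((integral_mulHaar_besselK_mul_besselK (hre i j)).1.const_mul _).congr (hpt i j), ?_⟩
  have hik : (i : ℕ) ≤ k := Nat.lt_succ_iff.1 i.2
  rw [← integral_congr_ae (hpt i i), integral_const_mul,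
    (integral_mulHaar_besselK_mul_besselK (hre i i)).2, sqrt_choose_mul_self]
  have e1 : ((k : ℂ) + 1 + Complex.I * r + ((k : ℂ) / 2 - (i : ℕ) + ((k : ℂ) / 2 - (i : ℕ)))) / 2 =
      (1 + Complex.I * r) / 2 + (k - i : ℕ) := by
    rw [Nat.cast_sub hik]; ring
  have e2 : ((k : ℂ) + 1 + Complex.I * r - ((k : ℂ) / 2 - (i : ℕ) + ((k : ℂ) / 2 - (i : ℕ)))) / 2 =
      (1 + Complex.I * r) / 2 + i := by ring
  have e3 : ((k : ℂ) + 1 + Complex.I * r + ((k : ℂ) / 2 - (i : ℕ) - ((k : ℂ) / 2 - (i : ℕ)))) / 2 =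
      (1 + k + Complex.I * r) / 2 := by ring
  have e4 : ((k : ℂ) + 1 + Complex.I * r - ((k : ℂ) / 2 - (i : ℕ) - ((k : ℂ) / 2 - (i : ℕ)))) / 2 =
      (1 + k + Complex.I * r) / 2 := by ring
  rw [e1, e2, e3, e4, add_assoc (k : ℂ) 1]
  ring

/-- The Vandermonde identity for Gamma functions. -/
theorem sum_choose_mul_Gamma_mul_Gamma (k : ℕ) : ∀ {a b : ℂ}, 0 < a.re → 0 < b.re →
    ∑ i ∈ Finset.range (k + 1), k.choose i * (Complex.Gamma (a + i) * Complex.Gamma (b + (k - i : ℕ))) =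
      Complex.Gamma a * Complex.Gamma b * Complex.Gamma (k + (a + b)) / Complex.Gamma (a + b) := by
  induction k with
  | zero =>
    intro a b ha hb
    have : Complex.Gamma (a + b) ≠ 0 := Complex.Gamma_ne_zero_of_re_pos (by simp; linarith)
    simp
    field_simp
  | succ k ih =>
    intro a b ha hb
    have h := Finset.sum_choose_succ_mul (R := ℂ)
      (fun i l => Complex.Gamma (a + i) * Complex.Gamma (b + l)) k
    rw [h]
    have h1 := ih ha (b := b + 1) (by simp; linarith)
    have h2 := ih (a := a + 1) (by simp; linarith) hb
    have e1 : ∑ i ∈ Finset.range (k + 1), (k.choose i : ℂ) *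
        (Complex.Gamma (a + i) * Complex.Gamma (b + (k + 1 - i : ℕ))) =
        ∑ i ∈ Finset.range (k + 1), k.choose i *
          (Complex.Gamma (a + i) * Complex.Gamma (b + 1 + (k - i : ℕ))) := by
      refine Finset.sum_congr rfl fun i hi => ?_
      have : i ≤ k := Nat.lt_succ_iff.1 (Finset.mem_range.1 hi)
      rw [Nat.succ_sub this]; push_cast; congr 3; ring
    have e2 : ∑ i ∈ Finset.range (k + 1), (k.choose i : ℂ) *
        (Complex.Gamma (a + (i + 1 : ℕ)) * Complex.Gamma (b + (k - i : ℕ))) =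
        ∑ i ∈ Finset.range (k + 1), k.choose i *
          (Complex.Gamma (a + 1 + i) * Complex.Gamma (b + (k - i : ℕ))) := by
      refine Finset.sum_congr rfl fun i _ => ?_
      push_cast; congr 3; ring
    rw [e1, e2, h1, h2]
    have ha0 : a ≠ 0 := fun h => by rw [h] at ha; simp at ha
    have hb0 : b ≠ 0 := fun h => by rw [h] at hb; simp at hb
    have hab : 0 < (a + b).re := by simp; linarith
    have hab0 : a + b ≠ 0 := fun h => by rw [h] at hab; simp at hab
    have hG := Complex.Gamma_ne_zero_of_re_pos hab
    rw [show a + (b + 1) = a + b + 1 by ring, show a + 1 + b = a + b + 1 by ring,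
      Complex.Gamma_add_one _ ha0, Complex.Gamma_add_one _ hb0, Complex.Gamma_add_one _ hab0]
    push_cast
    rw [show (k : ℂ) + (a + b + 1) = k + 1 + (a + b) by ring]
    field_simp
    ring

theorem integrable_integrandT2 (k : ℕ) (r : ℝ) : Integrable (integrandT2 k r) mulHaar := by
  have h : integrandT2 k r = fun y : ℝ => ∑ i, (y : ℂ) ^ (1 + Complex.I * r) *
      (boldW k y i * conj (boldW k y i)) * (((y ^ 2)⁻¹ : ℝ) : ℂ) := by
    ext y
    rw [integrandT2, norm_boldW_sq, Finset.mul_sum, Finset.sum_mul]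
  rw [h]
  exact integrable_finsetSum _ fun i _ => (integrable_boldW_mul_boldW k r i i).1

theorem integral_integrandT2_eq_sum (k : ℕ) (r : ℝ) : ∫ y, integrandT2 k r y ∂mulHaar =
    ∑ i, ∫ y : ℝ, (y : ℂ) ^ (1 + Complex.I * r) *
      (boldW k y i * conj (boldW k y i)) * (((y ^ 2)⁻¹ : ℝ) : ℂ) ∂mulHaar := by
  rw [← integral_finsetSum _ fun i _ => (integrable_boldW_mul_boldW k r i i).1]
  congr 1
  ext y
  rw [integrandT2, norm_boldW_sq, Finset.mul_sum, Finset.sum_mul]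

theorem integral_integrandT2 (k : ℕ) (r : ℝ) : ∫ y, integrandT2 k r y ∂mulHaar =
    ((2 * Real.pi : ℝ) : ℂ) ^ (-(k + 1 + Complex.I * r)) / 8 *
      (Complex.Gamma ((1 + k + Complex.I * r) / 2) ^ 2 * Complex.Gamma ((1 + Complex.I * r) / 2) ^ 2) /
        Complex.Gamma (1 + Complex.I * r) := by
  rw [integral_integrandT2_eq_sum]
  simp only [fun i => (integrable_boldW_mul_boldW k r i i).2]
  rw [← Finset.mul_sum, ← Finset.sum_range (fun i => (k.choose i : ℂ) *
    (Complex.Gamma ((1 + Complex.I * r) / 2 + i) * Complex.Gamma ((1 + Complex.I * r) / 2 + (k - i : ℕ)))),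
    sum_choose_mul_Gamma_mul_Gamma k (by simp) (by simp), add_halves]
  have : Complex.Gamma (k + (1 + Complex.I * r)) ≠ 0 :=
    Complex.Gamma_ne_zero_of_re_pos (by simp; positivity)
  field_simp

theorem whittakerNorm_zero_right_sq (k : ℕ) : whittakerNorm k 0 ^ 2 * ((k : ℝ) + 1)⁻¹ =
    32 * Real.pi ^ 2 * ((2 * Real.pi) ^ k / Real.Gamma ((k : ℝ) / 2 + 1) ^ 2) := by
  have e : ((2 * Real.pi) ^ ((k : ℝ) / 2)) ^ 2 = (2 * Real.pi) ^ k := by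
    rw [← Real.rpow_natCast, ← Real.rpow_mul Real.two_pi_pos.le, ← Real.rpow_natCast]
    congr 1; push_cast; ring
  rw [whittakerNorm_zero_right, mul_pow, div_pow, mul_pow, mul_pow, mul_pow, e,
    Real.sq_sqrt (by positivity), Real.sq_sqrt (by positivity), add_comm (1 : ℝ)]
  have := Real.Gamma_pos_of_pos (show 0 < (k : ℝ) / 2 + 1 by positivity)
  field_simp
  ring

theorem norm_Gamma_sq_eq (k : ℕ) (r : ℝ) :
    Complex.Gamma ((1 + k + Complex.I * r) / 2) * Complex.Gamma ((1 + k - Complex.I * r) / 2) =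
      ((‖Complex.Gamma ((1 + k + Complex.I * r) / 2)‖ ^ 2 : ℝ) : ℂ) := by
  have : (1 + k - Complex.I * r) / 2 = conj ((1 + k + Complex.I * r) / 2) := by
    simp [Complex.conj_ofNat, sub_eq_add_neg]
  rw [this, Complex.Gamma_conj, Complex.mul_conj, Complex.normSq_eq_norm_sq]

theorem gammaRatio_eq_ofReal (k : ℕ) (r : ℝ) : gammaRatio k r =
    ((‖Complex.Gamma ((1 + k + Complex.I * r) / 2)‖ ^ 2 * ‖Complex.Gamma ((1 + Complex.I * r) / 2)‖ ^ 2 /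
      (Real.Gamma (1 + (k : ℝ) / 2) ^ 2 * ‖Complex.Gamma (1 + Complex.I * r)‖) : ℝ) : ℂ) := by
  have h0 := norm_Gamma_sq_eq 0 r
  simp only [Nat.cast_zero, add_zero] at h0
  rw [gammaRatio, norm_Gamma_sq_eq, h0]
  push_cast; rfl

/-- On the left the Gamma factors of the numerator are squared, on the right each of them is multiplied
by its complex conjugate. -/
theorem norm_tripleT2 (k : ℕ) (r : ℝ) :
    ‖tripleT2 k r‖ = ‖((2 * Real.pi : ℝ) : ℂ) * gammaRatio k r‖ := by
  have hπ := Real.two_pi_pos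
  have hG := Real.Gamma_pos_of_pos (show 0 < 1 + (k : ℝ) / 2 by positivity)
  have hG2 : Complex.Gamma (1 + Complex.I * r) ≠ 0 := Complex.Gamma_ne_zero_of_re_pos (by simp)
  have hre : (-((k : ℂ) + 1 + Complex.I * r)).re = -((k + 1 : ℕ) : ℝ) := by simp
  rw [gammaRatio_eq_ofReal, ← Complex.ofReal_mul, Complex.norm_real, Real.norm_of_nonneg (by positivity),
    tripleT2, integral_integrandT2, norm_mul, Complex.norm_real, Real.norm_of_nonneg (by
      have := Real.Gamma_pos_of_pos (show 0 < (k : ℝ) / 2 + 1 by positivity)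
      positivity), norm_div, norm_mul, norm_div,
    Complex.norm_cpow_eq_rpow_re_of_pos hπ, hre, norm_mul, norm_pow, norm_pow, Complex.norm_ofNat,
    Real.rpow_neg hπ.le, Real.rpow_natCast, pow_succ, add_comm ((k : ℝ) / 2)]
  have := norm_pos_iff.2 hG2
  field_simp
  ring

theorem whittakerTriple_minimal {k : ℕ} (r : ℝ) {W : Fin (k + 1) → SL2 → ℂ}
    (hW : IsWhittakerEmbedding k 0 W) :
    Integrable (whittakerIntegrand (W 0) (W 0) (inducedVec 0 r 0)) (mulHaar.prod haarK) ∧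
      whittakerTriple (W 0) (W 0) (inducedVec 0 r 0) = tripleT2 k r := by
  have h := integral_prod_sum_mul_rho (k := k) (fun i j y => ((whittakerNorm k 0 ^ 2 : ℝ) : ℂ) *
    ((y : ℂ) ^ (1 + Complex.I * r) * (boldW k y i * conj (boldW k y j)) * (((y ^ 2)⁻¹ : ℝ) : ℂ)))
    (fun i j => (integrable_boldW_mul_boldW k r i j).1.const_mul _)
    (whittakerIntegrand (W 0) (W 0) (inducedVec 0 r 0)) (fun y hy κ => by
      unfold whittakerIntegrand
      simp only
      rw [hW.apply_minimal hy, inducedVec_torus_mul_toSL 0 r 0 hy, rho_zero, map_mul,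
        Complex.conj_ofReal, map_sum]
      simp only [map_mul, conj_boldW_apply, Nat.cast_zero, zero_add, Real.sqrt_one, Complex.ofReal_one,
        mul_one]
      rw [mul_mul_mul_comm, Finset.sum_mul_sum, Finset.mul_sum, Finset.sum_mul, Finset.sum_mul]
      refine Finset.sum_congr rfl fun i _ => ?_
      rw [Finset.mul_sum, Finset.sum_mul, Finset.sum_mul]
      refine Finset.sum_congr rfl fun j _ => ?_
      push_cast; ring)
  refine ⟨h.1, ?_⟩
  unfold whittakerTriple
  rw [h.2]
  simp only [integral_const_mul]
  rw [← Finset.mul_sum, ← integral_integrandT2_eq_sum, tripleT2, ← whittakerNorm_zero_right_sq]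
  push_cast; ring

theorem whittakerTriple_mixed {k : ℕ} {r : ℝ} {W₁ : Fin (0 + 1) → SL2 → ℂ}
    {W₂ : Fin (k + 1) → SL2 → ℂ} (h₁ : IsWhittakerEmbedding 0 r W₁)
    (h₂ : IsWhittakerEmbedding k 0 W₂) :
    Integrable (whittakerIntegrand (W₁ 0) (W₂ 0) (inducedVec k 0 0)) (mulHaar.prod haarK) ∧
      tripleT1 k W₁ W₂ = ((2 * Real.pi : ℝ) : ℂ) * gammaRatio k r := by
  set c : ℂ := ((whittakerNorm 0 r * whittakerNorm k 0 * √(k + 1 : ℝ) : ℝ) : ℂ) with hc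
  have hre (j : Fin (k + 1)) : |(Complex.I * (r : ℂ)).re| + |((k : ℂ) / 2 - (j : ℕ)).re| <
      ((k : ℂ) / 2 + 1).re := by
    have h2 := abs_re_half_sub_le (Nat.lt_succ_iff.1 j.2)
    have h3 : ((k : ℂ) / 2 + 1).re = k / 2 + 1 := by simp
    have h4 : (Complex.I * (r : ℂ)).re = 0 := by simp
    rw [h3, h4, abs_zero]; linarith
  have hM (j : Fin (k + 1)) := integral_mulHaar_besselK_mul_besselK (hre j)
  set f : Fin (k + 1) → ℝ → ℂ := fun j y => c * ((√(k.choose j) : ℝ) : ℂ) *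
    ((y : ℂ) ^ ((k : ℂ) / 2 + 1) * (besselK (Complex.I * r) (4 * Real.pi * y) *
      besselK ((k : ℂ) / 2 - (j : ℕ)) (4 * Real.pi * y))) with hf
  have h := integral_prod_sum_mul_rho (k := k) (fun i j y => if i = 0 then f j y else 0)
    (fun i j => by
      split_ifs
      · exact (hM j).1.const_mul _
      · exact integrable_zero _ _ _)
    (whittakerIntegrand (W₁ 0) (W₂ 0) (inducedVec k 0 0)) (fun y hy κ => by
      rw [Finset.sum_eq_single 0]
      · unfold whittakerIntegrand
        simp only [if_true]
        rw [h₁.apply_spherical hy, h₂.apply_minimal hy, inducedVec_torus_mul_toSL k 0 0 hy, map_mul,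
          Complex.conj_ofReal, map_sum, Finset.mul_sum, Finset.mul_sum, Finset.sum_mul, Finset.sum_mul]
        refine Finset.sum_congr rfl fun j _ => ?_
        have hy0 : (y : ℂ) ≠ 0 := by exact_mod_cast hy.ne'
        rw [map_mul, Complex.conj_conj, boldW_apply_eq k hy, Complex.ofReal_zero, mul_zero, add_zero,
          Complex.cpow_one]
        simp only [hf, hc]
        push_cast
        field_simp
      · intro i _ hi
        simp [hi]
      · simp)
  refine ⟨h.1, ?_⟩
  unfold tripleT1 whittakerTriple
  rw [h.2, Finset.sum_eq_single 0]
  · simp only [if_true, hf]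
    rw [integral_const_mul, (hM 0).2]
    simp only [Fin.val_zero, Nat.cast_zero, sub_zero, Nat.choose_zero_right, Nat.cast_one,
      Real.sqrt_one, Complex.ofReal_one, mul_one]
    have e1 : ((k : ℂ) / 2 + 1 + (Complex.I * r + (k : ℂ) / 2)) / 2 = (1 + k + Complex.I * r) / 2 := by
      ring
    have e2 : ((k : ℂ) / 2 + 1 - (Complex.I * r + (k : ℂ) / 2)) / 2 = (1 - Complex.I * r) / 2 := by ring
    have e3 : ((k : ℂ) / 2 + 1 + (Complex.I * r - (k : ℂ) / 2)) / 2 = (1 + Complex.I * r) / 2 := by ring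
    have e4 : ((k : ℂ) / 2 + 1 - (Complex.I * r - (k : ℂ) / 2)) / 2 = (1 + k - Complex.I * r) / 2 := by
      ring
    have e5 : ((2 * Real.pi : ℝ) : ℂ) ^ (-((k : ℂ) / 2 + 1)) =
        ((((2 * Real.pi) ^ ((k : ℝ) / 2) * (2 * Real.pi))⁻¹ : ℝ) : ℂ) := by
      rw [← Real.rpow_add_one Real.two_pi_pos.ne', ← Real.rpow_neg Real.two_pi_pos.le,
        Complex.ofReal_cpow Real.two_pi_pos.le]
      push_cast; rfl
    have e6 : Complex.Gamma ((k : ℂ) / 2 + 1) = (Real.Gamma (1 + (k : ℝ) / 2) : ℂ) := by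
      rw [← Complex.Gamma_ofReal]; push_cast; congr 1; ring
    have e7 : ((√2 : ℝ) : ℂ) ^ 2 = 2 := by
      rw [sq, ← Complex.ofReal_mul, Real.mul_self_sqrt (by norm_num)]; norm_num
    have e8 : ((√(k + 1 : ℝ) : ℝ) : ℂ) ^ 2 = (k : ℂ) + 1 := by
      rw [sq, ← Complex.ofReal_mul, Real.mul_self_sqrt (by positivity)]; push_cast; rfl
    have hk : ((k : ℂ) + 1) ≠ 0 := by exact_mod_cast Nat.succ_ne_zero k
    have hG : ((Real.Gamma (1 + (k : ℝ) / 2) : ℝ) : ℂ) ≠ 0 := by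
      exact_mod_cast (Real.Gamma_pos_of_pos (show 0 < 1 + (k : ℝ) / 2 by positivity)).ne'
    have hG2 : ((‖Complex.Gamma (1 + Complex.I * r)‖ : ℝ) : ℂ) ≠ 0 := by
      exact_mod_cast (norm_pos_iff.2 (Complex.Gamma_ne_zero_of_re_pos (by simp))).ne'
    have hp : (((2 * Real.pi) ^ ((k : ℝ) / 2) : ℝ) : ℂ) ≠ 0 := by
      exact_mod_cast (Real.rpow_pos_of_pos Real.two_pi_pos _).ne'
    have hπ : (Real.pi : ℂ) ≠ 0 := by exact_mod_cast Real.pi_ne_zero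
    rw [e1, e2, e3, e4, e5, e6, hc, whittakerNorm_zero_left, whittakerNorm_zero_right, gammaRatio]
    simp only [Complex.ofReal_mul, Complex.ofReal_div, Complex.ofReal_inv, Complex.ofReal_pow,
      Complex.ofReal_ofNat]
    field_simp
    rw [e7, e8]
    ring
  · intro i _ hi
    simp [hi]
  · simp

/-! ### Integration over `K` on the big Bruhat cell -/

theorem SU2.exists_row_one_eq {c d : ℂ} (h : ‖c‖ ^ 2 + ‖d‖ ^ 2 = 1) :
    ∃ κ : SU2, κ.1 1 0 = c ∧ κ.1 1 1 = d :=
  ⟨SU2.ofRow (conj d) (-conj c) (by simpa [add_comm] using h), by simp [SU2.ofRow]⟩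

/-- Right multiplication of row vectors by `κ`. -/
noncomputable def rowMul (κ : SU2) : ℂ × ℂ →ₗ[ℝ] ℂ × ℂ where
  toFun v := (v.1 * κ.1 0 0 + v.2 * κ.1 1 0, v.1 * κ.1 0 1 + v.2 * κ.1 1 1)
  map_add' v w := by ext <;> simp <;> ring
  map_smul' t v := by ext <;> simp <;> ring

theorem rowMul_apply (κ : SU2) (v : ℂ × ℂ) :
    rowMul κ v = (v.1 * κ.1 0 0 + v.2 * κ.1 1 0, v.1 * κ.1 0 1 + v.2 * κ.1 1 1) := rfl

theorem rowMul_rowMul (κ κ' : SU2) (v : ℂ × ℂ) : rowMul κ' (rowMul κ v) = rowMul (κ * κ') v := by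
  simp only [rowMul_apply, Submonoid.coe_mul, Matrix.mul_apply, Fin.sum_univ_two]
  ext <;> simp <;> ring

theorem norm_rowMul_sq (κ : SU2) (v : ℂ × ℂ) :
    ‖(rowMul κ v).1‖ ^ 2 + ‖(rowMul κ v).2‖ ^ 2 = ‖v.1‖ ^ 2 + ‖v.2‖ ^ 2 :=
  SU2.norm_row_mul κ v.1 v.2

theorem rowMul_one (v : ℂ × ℂ) : rowMul 1 v = v := by simp [rowMul_apply]

theorem continuous_rowMul : Continuous fun p : SU2 × (ℂ × ℂ) => rowMul p.1 p.2 := by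
  simp only [rowMul_apply]
  have h (i j : Fin 2) : Continuous fun p : SU2 × (ℂ × ℂ) => p.1.1 i j :=
    (continuous_entry i j).comp continuous_fst
  have h1 : Continuous fun p : SU2 × (ℂ × ℂ) => p.2.1 := by fun_prop
  have h2 : Continuous fun p : SU2 × (ℂ × ℂ) => p.2.2 := by fun_prop
  exact ((h1.mul (h 0 0)).add (h2.mul (h 1 0))).prodMk ((h1.mul (h 0 1)).add (h2.mul (h 1 1)))

/-- Unitary maps preserve Lebesgue measure, because they preserve the unit ball. -/
theorem measurePreserving_rowMul (κ : SU2) : MeasurePreserving (rowMul κ) := by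
  have hcont : Continuous (rowMul κ) := LinearMap.continuous_of_finiteDimensional _
  refine ⟨hcont.measurable, ?_⟩
  have hdet : LinearMap.det (rowMul κ) ≠ 0 := by
    have h : (rowMul κ) ∘ₗ (rowMul κ⁻¹) = LinearMap.id := by
      ext1 <;> ext1 <;> simp [rowMul_rowMul, rowMul_one]
    have := congrArg LinearMap.det h
    rw [LinearMap.det_comp, LinearMap.det_id] at this
    exact left_ne_zero_of_mul_eq_one this
  have : (volume : Measure (ℂ × ℂ)).IsAddHaarMeasure :=
    inferInstanceAs ((volume : Measure ℂ).prod (volume : Measure ℂ)).IsAddHaarMeasure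
  have hmap := Measure.map_linearMap_addHaar_eq_smul_addHaar (volume : Measure (ℂ × ℂ)) hdet
  set B : Set (ℂ × ℂ) := {v | ‖v.1‖ ^ 2 + ‖v.2‖ ^ 2 < 1} with hB
  have hBo : IsOpen B := isOpen_lt (by fun_prop) continuous_const
  have hpre : rowMul κ ⁻¹' B = B := by
    ext v; simp only [hB, Set.mem_preimage, Set.mem_ofPred_eq, norm_rowMul_sq]
  have hB0 : volume B ≠ 0 := (hBo.measure_pos volume ⟨0, by simp [hB]⟩).ne'
  have hBt : volume B ≠ ⊤ := by
    have hsub : B ⊆ Metric.closedBall 0 1 := by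
      intro v hv
      have hv' : ‖v.1‖ ^ 2 + ‖v.2‖ ^ 2 < 1 := hv
      rw [mem_closedBall_zero_iff, Prod.norm_def]
      refine max_le ?_ ?_ <;> nlinarith [norm_nonneg v.1, norm_nonneg v.2]
    exact ((measure_mono hsub).trans_lt measure_closedBall_lt_top).ne
  have h1 : Measure.map (rowMul κ) volume B = volume B := by
    rw [Measure.map_apply hcont.measurable hBo.measurableSet, hpre]
  rw [hmap, Measure.smul_apply, smul_eq_mul] at h1
  have h2 : ENNReal.ofReal |(LinearMap.det (rowMul κ))⁻¹| = 1 := by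
    have h3 : ENNReal.ofReal |(LinearMap.det (rowMul κ))⁻¹| * volume B = 1 * volume B := by
      rw [h1, one_mul]
    exact (ENNReal.mul_left_inj hB0 hBt).1 h3
  rw [hmap, h2, one_smul]

/-- The Gaussian on `ℂ²`. -/
noncomputable def gaussTwo (v : ℂ × ℂ) : ENNReal :=
  ENNReal.ofReal (Real.exp (-(‖v.1‖ ^ 2 + ‖v.2‖ ^ 2)))

theorem measurable_gaussTwo : Measurable gaussTwo := by unfold gaussTwo; fun_prop

theorem lintegral_norm_pow_mul_exp (n : ℕ) {b : ℝ} (hb : 0 < b) :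
    ∫⁻ z : ℂ, ENNReal.ofReal (‖z‖ ^ (2 * n) * Real.exp (-(b * ‖z‖ ^ 2))) =
      ENNReal.ofReal (Real.pi * n.factorial / b ^ (n + 1)) := by
  have h1 := Complex.integral_rpow_mul_exp_neg_mul_rpow (p := 2) (q := 2 * n) (b := b)
    (by norm_num) (by have : (0 : ℝ) ≤ n := by positivity
                      linarith) hb
  have h2 : (fun x : ℂ => ‖x‖ ^ (2 * n : ℝ) * Real.exp (-b * ‖x‖ ^ (2 : ℝ))) =
      fun z : ℂ => ‖z‖ ^ (2 * n) * Real.exp (-(b * ‖z‖ ^ 2)) := by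
    ext z
    rw [Real.rpow_two, neg_mul]
    congr 1
    rw [← Real.rpow_natCast]; push_cast; rfl
  have h3 : (2 * Real.pi / 2) * b ^ (-((2 * n : ℝ) + 2) / 2) * Real.Gamma (((2 * n : ℝ) + 2) / 2) =
      Real.pi * n.factorial / b ^ (n + 1) := by
    rw [show ((2 * n : ℝ) + 2) / 2 = n + 1 by ring, Real.Gamma_nat_eq_factorial,
      show (-((2 * n : ℝ) + 2) / 2) = -((n + 1 : ℕ) : ℝ) by push_cast; ring, Real.rpow_neg hb.le,
      Real.rpow_natCast]
    ring
  rw [h2, h3] at h1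
  have hpos : 0 < Real.pi * n.factorial / b ^ (n + 1) := by positivity
  rw [← h1, ofReal_integral_eq_lintegral_ofReal]
  · by_contra hni
    rw [integral_undef hni] at h1
    exact hpos.ne h1
  · exact ae_of_all _ fun z => by positivity

theorem lintegral_gaussTwo : ∫⁻ v, gaussTwo v = ENNReal.ofReal (Real.pi ^ 2) := by
  have h := lintegral_norm_pow_mul_exp 0 one_pos
  simp only [mul_zero, pow_zero, one_mul, Nat.factorial_zero, Nat.cast_one, mul_one, one_pow,
    div_one] at h
  have h2 (v : ℂ × ℂ) : gaussTwo v = ENNReal.ofReal (Real.exp (-‖v.1‖ ^ 2)) *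
      ENNReal.ofReal (Real.exp (-‖v.2‖ ^ 2)) := by
    rw [gaussTwo, neg_add, Real.exp_add, ENNReal.ofReal_mul (by positivity)]
  simp only [h2]
  rw [Measure.volume_eq_prod, lintegral_prod_mul (f := fun z : ℂ => ENNReal.ofReal (Real.exp (-‖z‖ ^ 2)))
    (g := fun z : ℂ => ENNReal.ofReal (Real.exp (-‖z‖ ^ 2))) (by fun_prop) (by fun_prop), h,
    ← ENNReal.ofReal_mul Real.pi_pos.le, sq]

/-- The distribution of the bottom row of `κ` is the angular distribution of a Gaussian vector. -/
theorem lintegral_haarK_row {φ : ℂ × ℂ → ENNReal} (hφ : Measurable φ)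
    (hhom : ∀ t : ℝ, 0 < t → ∀ v : ℂ × ℂ, φ (t * v.1, t * v.2) = φ v) :
    ENNReal.ofReal (Real.pi ^ 2) * ∫⁻ κ, φ (κ.1 1 0, κ.1 1 1) ∂haarK =
      ∫⁻ v, φ v * gaussTwo v := by
  have hinv (κ : SU2) : ∫⁻ v, φ v * gaussTwo v = ∫⁻ v, φ (rowMul κ v) * gaussTwo v := by
    have := (measurePreserving_rowMul κ).lintegral_comp (hφ.mul measurable_gaussTwo)
    simp only [Pi.mul_apply] at this
    rw [← this]
    refine lintegral_congr fun v => ?_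
    congr 1
    rw [gaussTwo, gaussTwo, norm_rowMul_sq]
  have hinner (v : ℂ × ℂ) (hv : v ≠ 0) : ∫⁻ κ, φ (rowMul κ v) ∂haarK =
      ∫⁻ κ, φ (κ.1 1 0, κ.1 1 1) ∂haarK := by
    set t : ℝ := √(‖v.1‖ ^ 2 + ‖v.2‖ ^ 2) with ht
    have hpos : 0 < ‖v.1‖ ^ 2 + ‖v.2‖ ^ 2 := by
      by_contra hneg
      apply hv
      have h1 : ‖v.1‖ ^ 2 = 0 := by nlinarith [sq_nonneg ‖v.1‖, sq_nonneg ‖v.2‖]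
      have h2 : ‖v.2‖ ^ 2 = 0 := by nlinarith [sq_nonneg ‖v.1‖, sq_nonneg ‖v.2‖]
      have h3 : v.1 = 0 := by simpa using h1
      have h4 : v.2 = 0 := by simpa using h2
      exact Prod.ext h3 h4
    have ht0 : 0 < t := Real.sqrt_pos.2 hpos
    have ht2 : t ^ 2 = ‖v.1‖ ^ 2 + ‖v.2‖ ^ 2 := Real.sq_sqrt hpos.le
    have htc : (t : ℂ) ≠ 0 := by exact_mod_cast ht0.ne'
    obtain ⟨κ₀, h0, h1⟩ := SU2.exists_row_one_eq (c := v.1 / t) (d := v.2 / t) (by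
      rw [norm_div, norm_div, Complex.norm_real, Real.norm_eq_abs, abs_of_pos ht0, div_pow, div_pow,
        ← add_div, ← ht2, div_self (by positivity)])
    have h2 (κ : SU2) : φ (rowMul κ v) = φ ((κ₀ * κ).1 1 0, (κ₀ * κ).1 1 1) := by
      rw [← hhom t ht0 ((κ₀ * κ).1 1 0, (κ₀ * κ).1 1 1)]
      congr 1
      simp only [rowMul_apply, Submonoid.coe_mul, Matrix.mul_apply, Fin.sum_univ_two, h0, h1]
      ext <;> simp only <;> field_simp
    simp only [h2]
    exact lintegral_mul_left_eq_self (fun κ : SU2 => φ (κ.1 1 0, κ.1 1 1)) κ₀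
  have hmeas : Measurable fun p : SU2 × (ℂ × ℂ) => φ (rowMul p.1 p.2) * gaussTwo p.2 :=
    (hφ.comp continuous_rowMul.measurable).mul (measurable_gaussTwo.comp measurable_snd)
  calc _ = ∫⁻ v, (∫⁻ κ, φ (κ.1 1 0, κ.1 1 1) ∂haarK) * gaussTwo v := by
        rw [lintegral_const_mul _ measurable_gaussTwo, lintegral_gaussTwo, mul_comm]
    _ = ∫⁻ v, ∫⁻ κ, φ (rowMul κ v) * gaussTwo v ∂haarK := by
        have h0 : ∀ᵐ v : ℂ × ℂ, v ≠ 0 := by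
          rw [Measure.volume_eq_prod, ae_iff]
          have : {v : ℂ × ℂ | ¬v ≠ 0} = {0} ×ˢ {0} := by ext v; simp [Prod.ext_iff]
          rw [this, Measure.prod_prod]; simp
        refine lintegral_congr_ae ?_
        filter_upwards [h0] with v hv
        have hmv : Measurable fun κ : SU2 => φ (rowMul κ v) :=
          hφ.comp (continuous_rowMul.comp (continuous_id.prodMk continuous_const)).measurable
        rw [lintegral_mul_const _ hmv, hinner v hv]
    _ = ∫⁻ κ, (∫⁻ v, φ (rowMul κ v) * gaussTwo v) ∂haarK :=
        lintegral_lintegral_swap (hmeas.comp measurable_swap).aemeasurable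
    _ = _ := by
        simp only [← hinv]
        simp

theorem lintegral_comp_const_mul {a : ℂ} (ha : a ≠ 0) {F : ℂ → ENNReal} (hF : Measurable F) :
    ENNReal.ofReal (‖a‖ ^ 2) * ∫⁻ x, F (a * x) = ∫⁻ x, F x := by
  have hdet : LinearMap.det (LinearMap.mulLeft ℝ a) = ‖a‖ ^ 2 := by
    rw [← Complex.normSq_eq_norm_sq, ← Algebra.norm_complex_apply, Algebra.norm_apply]; rfl
  have hpos : 0 < ‖a‖ ^ 2 := by have := norm_pos_iff.2 ha; positivity
  have hmap := Measure.map_linearMap_addHaar_eq_smul_addHaar (volume : Measure ℂ)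
    (f := LinearMap.mulLeft ℝ a) (by rw [hdet]; exact hpos.ne')
  have h1 : ∫⁻ x, F (a * x) = ∫⁻ x, F x ∂(Measure.map (LinearMap.mulLeft ℝ a) volume) := by
    rw [lintegral_map hF (LinearMap.continuous_of_finiteDimensional _).measurable]
    rfl
  rw [h1, hmap, hdet, lintegral_smul_measure, smul_eq_mul, ← mul_assoc, abs_of_pos (inv_pos.2 hpos),
    ← ENNReal.ofReal_mul hpos.le, mul_inv_cancel₀ hpos.ne', ENNReal.ofReal_one, one_mul]

theorem ae_haarK_entry_ne_zero : ∀ᵐ κ ∂haarK, κ.1 1 0 ≠ 0 := by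
  have h := lintegral_haarK_row (φ := ({v : ℂ × ℂ | v.1 = 0}).indicator 1)
    (measurable_one.indicator (measurableSet_eq_fun measurable_fst measurable_const))
    (fun t ht v => by
      have htc : (t : ℂ) ≠ 0 := by exact_mod_cast ht.ne'
      by_cases h : v.1 = 0 <;> simp [Set.indicator, h, htc])
  have h0 : ∀ᵐ v : ℂ × ℂ, v.1 ≠ 0 := by
    rw [Measure.volume_eq_prod]
    refine Measure.quasiMeasurePreserving_fst.ae (p := fun z : ℂ => z ≠ 0) ?_
    rw [ae_iff]; simp
  have h1 : ∫⁻ v, ({v : ℂ × ℂ | v.1 = 0}).indicator 1 v * gaussTwo v = 0 := by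
    rw [lintegral_eq_zero_iff' (by
      refine AEMeasurable.mul ?_ measurable_gaussTwo.aemeasurable
      exact (measurable_one.indicator
        (measurableSet_eq_fun measurable_fst measurable_const)).aemeasurable)]
    filter_upwards [h0] with v hv
    simp [hv]
  rw [h1, mul_eq_zero] at h
  have h2 := h.resolve_left (by simp [Real.pi_ne_zero])
  rw [lintegral_eq_zero_iff] at h2
  · filter_upwards [h2] with κ hκ h3
    simp [h3] at hκ
  · refine (measurable_one.indicator
      (measurableSet_eq_fun measurable_fst measurable_const)).comp ?_
    exact ((continuous_entry 1 0).prodMk (continuous_entry 1 1)).measurable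

/-- The density of the coordinate `d / c` of `K`. -/
noncomputable def cauchyDensity (x : ℂ) : ENNReal :=
  ENNReal.ofReal (Real.pi⁻¹ * ((1 + ‖x‖ ^ 2) ^ 2)⁻¹)

theorem measurable_cauchyDensity : Measurable cauchyDensity := by unfold cauchyDensity; fun_prop

theorem lintegral_haarK_div {φ : ℂ → ENNReal} (hφ : Measurable φ) :
    ∫⁻ κ, φ (κ.1 1 1 / κ.1 1 0) ∂haarK = ∫⁻ x, cauchyDensity x * φ x := by
  have hπ : ENNReal.ofReal (Real.pi ^ 2) ≠ 0 := by simp [Real.pi_ne_zero]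
  rw [← ENNReal.mul_right_inj hπ ENNReal.ofReal_ne_top,
    lintegral_haarK_row (φ := fun v => φ (v.2 / v.1)) (by fun_prop) (fun t ht v => by
      have htc : (t : ℂ) ≠ 0 := by exact_mod_cast ht.ne'
      simp only
      rw [mul_div_mul_left _ _ htc])]
  have hm : Measurable fun v : ℂ × ℂ => φ (v.2 / v.1) * gaussTwo v :=
    (hφ.comp (by fun_prop)).mul measurable_gaussTwo
  rw [Measure.volume_eq_prod, lintegral_prod _ hm.aemeasurable]
  have h1 : ∀ᵐ c : ℂ, ∫⁻ d, φ (d / c) * gaussTwo (c, d) =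
      ∫⁻ x, φ x * ENNReal.ofReal (‖c‖ ^ 2 * Real.exp (-((1 + ‖x‖ ^ 2) * ‖c‖ ^ 2))) := by
    have h0 : ∀ᵐ c : ℂ, c ≠ 0 := by rw [ae_iff]; simp
    filter_upwards [h0] with c hc
    rw [← lintegral_comp_const_mul hc (F := fun d => φ (d / c) * gaussTwo (c, d))
      (hm.comp (by fun_prop : Measurable fun d : ℂ => (c, d))), ← lintegral_const_mul']
    · refine lintegral_congr fun x => ?_
      rw [mul_div_cancel_left₀ _ hc, gaussTwo, ENNReal.ofReal_mul (by positivity), mul_left_comm]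
      congr 4
      simp only [norm_mul]; ring
    · exact ENNReal.ofReal_ne_top
  rw [lintegral_congr_ae h1, lintegral_lintegral_swap, ← lintegral_const_mul' _ _
    ENNReal.ofReal_ne_top]
  · refine lintegral_congr fun x => ?_
    have h2 := lintegral_norm_pow_mul_exp 1 (b := 1 + ‖x‖ ^ 2) (by positivity)
    simp only [mul_one, Nat.factorial_one, Nat.cast_one, Nat.reduceAdd] at h2
    rw [lintegral_const_mul _ (by fun_prop), h2, cauchyDensity, ← mul_assoc,
      ← ENNReal.ofReal_mul (by positivity), mul_comm]
    congr 2
    have := Real.pi_pos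
    field_simp
  · refine Measurable.aemeasurable ?_
    refine (hφ.comp measurable_snd).mul ?_
    fun_prop

theorem map_haarK_div : haarK.map (fun κ => κ.1 1 1 / κ.1 1 0) = volume.withDensity cauchyDensity := by
  have hm : Measurable fun κ : SU2 => κ.1 1 1 / κ.1 1 0 :=
    (continuous_entry 1 1).measurable.div (continuous_entry 1 0).measurable
  ext S hS
  rw [← lintegral_indicator_one hS, ← lintegral_indicator_one hS,
    lintegral_map (measurable_one.indicator hS) hm, lintegral_haarK_div (measurable_one.indicator hS),
    lintegral_withDensity_eq_lintegral_mul _ measurable_cauchyDensity (measurable_one.indicator hS)]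
  rfl

/-- Integration over `K` of a function on row vectors that is homogeneous of degree `-4`, in the
noncompact picture. -/
theorem integral_haarK_row {φ : ℂ → ℂ → ℂ} (hφ : Continuous fun x => φ 1 x)
    (hhom : ∀ c d : ℂ, c ≠ 0 → φ c d = ((‖c‖ ^ 4)⁻¹ : ℝ) * φ 1 (d / c)) :
    ∫ κ, φ (κ.1 1 0) (κ.1 1 1) ∂haarK = (Real.pi : ℂ)⁻¹ * ∫ x, φ 1 x := by
  have hm : Measurable fun κ : SU2 => κ.1 1 1 / κ.1 1 0 :=
    (continuous_entry 1 1).measurable.div (continuous_entry 1 0).measurable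
  have h1 : ∫ κ, φ (κ.1 1 0) (κ.1 1 1) ∂haarK =
      ∫ κ, (((1 + ‖κ.1 1 1 / κ.1 1 0‖ ^ 2) ^ 2 : ℝ) : ℂ) * φ 1 (κ.1 1 1 / κ.1 1 0) ∂haarK := by
    refine integral_congr_ae ?_
    filter_upwards [ae_haarK_entry_ne_zero] with κ hκ
    rw [hhom _ _ hκ]
    congr 2
    have h2 := SU2.norm_row_one κ
    have h3 := norm_pos_iff.2 hκ
    rw [norm_div]
    have h4 : 1 + (‖κ.1 1 1‖ / ‖κ.1 1 0‖) ^ 2 = (‖κ.1 1 0‖ ^ 2)⁻¹ := by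
      field_simp; exact h2
    rw [h4]; field_simp
  rw [h1, ← integral_map (f := fun x : ℂ => (((1 + ‖x‖ ^ 2) ^ 2 : ℝ) : ℂ) * φ 1 x) hm.aemeasurable
    (by fun_prop), map_haarK_div, integral_withDensity_eq_integral_toReal_smul measurable_cauchyDensity
    (ae_of_all _ fun _ => ENNReal.ofReal_lt_top), ← integral_const_mul]
  congr 1
  ext x
  have : 0 < Real.pi := Real.pi_pos
  have h5 : ((1 + ‖x‖ ^ 2 : ℝ) : ℂ) ≠ 0 := by
    have : 0 < 1 + ‖x‖ ^ 2 := by positivity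
    exact_mod_cast this.ne'
  rw [cauchyDensity, ENNReal.toReal_ofReal (by positivity), Complex.real_smul]
  push_cast at h5 ⊢
  field_simp

/-! ### Left invariance of the hyperbolic measure -/

noncomputable instance : MeasurableSpace SL2 := borel SL2

instance : BorelSpace SL2 := ⟨rfl⟩

theorem isInducing_SL2_entries : Topology.IsInducing (fun g : SL2 => fun i j => g.1 i j) :=
  Topology.IsInducing.subtypeVal

instance : SecondCountableTopology SL2 := isInducing_SL2_entries.secondCountableTopology

theorem continuous_SL2_entry (i j : Fin 2) : Continuous fun g : SL2 => g.1 i j :=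
  (continuous_apply_apply i j).comp continuous_subtype_val

theorem measurable_SL2_iff {X : Type*} [MeasurableSpace X] {f : X → SL2}
    (hf : ∀ i j, Measurable fun x => (f x).1 i j) : Measurable f := by
  have h2 : borel SL2 = MeasurableSpace.comap (fun g : SL2 => fun i j => g.1 i j)
      (borel (Fin 2 → Fin 2 → ℂ)) :=
    (congrArg (@borel SL2) isInducing_SL2_entries.eq_induced).trans borel_comap
  refine measurable_iff_comap_le.2 ?_
  change MeasurableSpace.comap f (borel SL2) ≤ _
  rw [h2, MeasurableSpace.comap_comp, ← measurable_iff_comap_le, ← BorelSpace.measurable_eq]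
  exact measurable_pi_iff.2 fun i => measurable_pi_iff.2 fun j => hf i j

theorem continuous_toSL : Continuous toSL :=
  Continuous.subtype_mk continuous_subtype_val _

theorem measurable_torus_entry (i j : Fin 2) : Measurable fun y : ℝ => (torus y).1 i j := by
  have h : (fun y : ℝ => (torus y).1 i j) = fun y : ℝ => if 0 < y then
      (!![((√y : ℝ) : ℂ), 0; 0, ((√y : ℝ) : ℂ)⁻¹] : Matrix (Fin 2) (Fin 2) ℂ) i j
      else (1 : Matrix (Fin 2) (Fin 2) ℂ) i j := by
    ext y; by_cases h : 0 < y <;> simp [torus, h]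
  rw [h]
  refine Measurable.ite measurableSet_Ioi ?_ measurable_const
  have : Measurable fun y : ℝ => ((√y : ℝ) : ℂ) := by fun_prop
  fin_cases i <;> fin_cases j <;> simp
  · exact this
  · exact this

/-- The element `n(x) a(y)`. -/
noncomputable def borelElt (p : ℂ × ℝ) : SL2 := unip p.1 * torus p.2

theorem measurable_borelElt : Measurable borelElt := by
  refine measurable_SL2_iff fun i j => ?_
  have h (i j : Fin 2) : Measurable fun p : ℂ × ℝ => (torus p.2).1 i j :=
    (measurable_torus_entry i j).comp measurable_snd
  have hu (i j : Fin 2) : Measurable fun p : ℂ × ℝ => (unip p.1).1 i j := by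
    fin_cases i <;> fin_cases j <;> simp [unip]
    fun_prop
  simp only [borelElt, Matrix.SpecialLinearGroup.coe_mul, Matrix.mul_apply, Fin.sum_univ_two]
  exact ((hu i 0).mul (h 0 j)).add ((hu i 1).mul (h 1 j))

theorem ofCoords_eq (p : ℂ × ℝ × SU2) : ofCoords p = borelElt (p.1, p.2.1) * toSL p.2.2 := rfl

theorem measurable_ofCoords : Measurable ofCoords := by
  have h1 : Measurable fun p : ℂ × ℝ × SU2 => borelElt (p.1, p.2.1) :=
    measurable_borelElt.comp (by fun_prop)
  have h2 : Measurable fun p : ℂ × ℝ × SU2 => toSL p.2.2 :=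
    continuous_toSL.measurable.comp (by fun_prop)
  exact h1.mul h2

/-- The coordinate `x` in the Iwasawa decomposition. -/
noncomputable def xPart (g : SL2) : ℂ :=
  (g.1 0 0 * conj (g.1 1 0) + g.1 0 1 * conj (g.1 1 1)) / (rowNorm g : ℂ) ^ 2

theorem eq_unip_xPart_mul (g : SL2) :
    g = unip (xPart g) * torus (height g) * toSL (kPart g) := by
  obtain ⟨x, hx⟩ := iwasawa g
  have hy := height_pos g
  have hs : ((√(height g) : ℝ) : ℂ) ≠ 0 := by exact_mod_cast (Real.sqrt_pos.2 hy).ne'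
  have hh : ((height g : ℝ) : ℂ) = ((√(height g) : ℝ) : ℂ) ^ 2 := by
    exact_mod_cast (Real.sq_sqrt hy.le).symm
  have hN : (rowNorm g : ℂ) ^ 2 = ((height g : ℝ) : ℂ)⁻¹ := by
    rw [height]; push_cast; rw [inv_inv]
  have hrow := SU2.norm_row_zero (kPart g)
  have hrow' : (kPart g).1 0 0 * conj ((kPart g).1 0 0) + (kPart g).1 0 1 * conj ((kPart g).1 0 1) = 1 := by
    rw [Complex.mul_conj, Complex.mul_conj, Complex.normSq_eq_norm_sq, Complex.normSq_eq_norm_sq]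
    exact_mod_cast hrow
  have e1 (i : Fin 2) : g.1 1 i = ((√(height g) : ℝ) : ℂ)⁻¹ * (kPart g).1 1 i := by
    have := unip_torus_toSL_row x hy (kPart g)
    rw [← hx] at this
    fin_cases i
    · exact this.1
    · exact this.2
  have e0 (i : Fin 2) : g.1 0 i = ((√(height g) : ℝ) : ℂ) * (kPart g).1 0 i +
      x * ((√(height g) : ℝ) : ℂ)⁻¹ * (kPart g).1 1 i := by
    have : g.1 0 i = (unip x * torus (height g) * toSL (kPart g)).1 0 i := by rw [← hx]
    rw [this, Matrix.SpecialLinearGroup.coe_mul, Matrix.SpecialLinearGroup.coe_mul]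
    simp [unip, torus, hy, toSL, Matrix.mul_apply, Fin.sum_univ_two]
  have hxp : xPart g = x := by
    rw [xPart, hN, e0, e0, e1, e1, SU2.one_one_eq, SU2.one_zero_eq, hh]
    simp only [map_mul, map_inv₀, Complex.conj_ofReal, map_neg, Complex.conj_conj]
    field_simp
    linear_combination x * hrow'
  rw [hxp]; exact hx

theorem apply_eq_apply_borelElt {α : Type*} {F : SL2 → α} (hF : ∀ g κ, F (g * toSL κ) = F g) (g : SL2) :
    F g = F (borelElt (xPart g, height g)) := by
  conv_lhs => rw [eq_unip_xPart_mul g]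
  exact hF _ _

theorem lintegral_mulHaar_eq_exp {f : ℝ → ENNReal} (hf : Measurable f) :
    ∫⁻ y, f y ∂mulHaar = ∫⁻ t : ℝ, f (Real.exp t) := by
  have h := lintegral_image_eq_lintegral_abs_deriv_mul MeasurableSet.univ
    (fun t _ => (Real.hasDerivAt_exp t).hasDerivWithinAt) Real.exp_injective.injOn
    (fun y => ENNReal.ofReal y⁻¹ * f y)
  rw [Set.image_univ, Real.range_exp, setLIntegral_univ] at h
  rw [lintegral_mulHaar hf, h]
  refine lintegral_congr fun t => ?_
  have := Real.exp_pos t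
  rw [← mul_assoc, abs_of_pos this, ← ENNReal.ofReal_mul this.le, mul_inv_cancel₀ this.ne',
    ENNReal.ofReal_one, one_mul]

theorem lintegral_mulHaar_mul_left {f : ℝ → ENNReal} (hf : Measurable f) {c : ℝ} (hc : 0 < c) :
    ∫⁻ y, f (c * y) ∂mulHaar = ∫⁻ y, f y ∂mulHaar := by
  rw [lintegral_mulHaar_eq_exp hf, lintegral_mulHaar_eq_exp (by fun_prop),
    ← lintegral_add_left_eq_self (fun t => f (Real.exp t)) (Real.log c)]
  simp only [Real.exp_add, Real.exp_log hc]

theorem lintegral_mulHaar_div {f : ℝ → ENNReal} (hf : Measurable f) {c : ℝ} (hc : 0 < c) :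
    ∫⁻ y, f (c / y) ∂mulHaar = ∫⁻ y, f y ∂mulHaar := by
  rw [lintegral_mulHaar_eq_exp hf, lintegral_mulHaar_eq_exp (by fun_prop),
    ← lintegral_sub_left_eq_self (fun t => f (Real.exp t)) (Real.log c)]
  simp only [Real.exp_sub, Real.exp_log hc]

/-- The hyperbolic measure `y⁻² dx dy^×` in the coordinates `n(x) a(y)`. -/
noncomputable def hypMeasure : Measure (ℂ × ℝ) :=
  (volume : Measure ℂ).prod (mulHaar.withDensity fun y => ENNReal.ofReal (y ^ 2)⁻¹)

instance : SigmaFinite (mulHaar.withDensity fun y => ENNReal.ofReal (y ^ 2)⁻¹) :=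
  SigmaFinite.withDensity_ofReal _

/-- In the coordinates `ξ = x / y` and `y` the hyperbolic measure is a product of invariant
measures. -/
theorem lintegral_hypMeasure {G : ℂ × ℝ → ENNReal} (hG : Measurable G) :
    ∫⁻ p, G p ∂hypMeasure = ∫⁻ ξ : ℂ, ∫⁻ y, G (y * ξ, y) ∂mulHaar := by
  have hm : Measurable fun y : ℝ => ENNReal.ofReal (y ^ 2)⁻¹ := by fun_prop
  rw [hypMeasure, lintegral_prod_symm _ hG.aemeasurable,
    lintegral_withDensity_eq_lintegral_mul _ hm (hG.lintegral_prod_left'), lintegral_lintegral_swap]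
  · refine lintegral_congr_ae ?_
    filter_upwards [ae_mulHaar_pos] with y hy
    have hy0 : (y : ℂ) ≠ 0 := by exact_mod_cast hy.ne'
    rw [Pi.mul_apply, ← lintegral_comp_const_mul hy0 (F := fun x => G (x, y)) (by fun_prop),
      ← mul_assoc, Complex.norm_real, Real.norm_eq_abs, sq_abs, ← ENNReal.ofReal_mul (by positivity),
      inv_mul_cancel₀ (by positivity), ENNReal.ofReal_one, one_mul]
  · refine Measurable.aemeasurable ?_
    unfold Function.uncurry
    fun_prop

/-- Left translation by `g` preserves the hyperbolic measure.  Functions on `SL(2, ℂ) / K` are encoded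
as right `K`-invariant functions on `SL(2, ℂ)`. -/
def HypInvariant (g : SL2) : Prop := ∀ F : SL2 → ENNReal, Measurable F →
  (∀ h κ, F (h * toSL κ) = F h) →
    ∫⁻ p, F (g * borelElt p) ∂hypMeasure = ∫⁻ p, F (borelElt p) ∂hypMeasure

theorem HypInvariant.mul {g h : SL2} (hg : HypInvariant g) (hh : HypInvariant h) :
    HypInvariant (g * h) := by
  intro F hF hK
  rw [← hg F hF hK, ← hh (fun x => F (g * x)) (hF.comp (measurable_const_mul g))
    (fun h κ => by rw [← mul_assoc, hK])]
  simp only [mul_assoc]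

theorem hypInvariant_unip (b : ℂ) : HypInvariant (unip b) := by
  intro F hF _
  have h1 (p : ℂ × ℝ) : unip b * borelElt p = borelElt (b + p.1, p.2) := by
    have : unip b * unip p.1 = unip (b + p.1) := by
      ext i j
      rw [Matrix.SpecialLinearGroup.coe_mul]
      fin_cases i <;> fin_cases j <;> simp [unip, Matrix.mul_apply, Fin.sum_univ_two, add_comm]
    rw [borelElt, ← mul_assoc, this, borelElt]
  have hm : Measurable fun p => F (borelElt p) := hF.comp measurable_borelElt
  have hm' : Measurable fun p : ℂ × ℝ => F (borelElt (b + p.1, p.2)) :=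
    hm.comp (by fun_prop : Measurable fun p : ℂ × ℝ => (b + p.1, p.2))
  simp only [h1]
  rw [hypMeasure, lintegral_prod_symm _ hm.aemeasurable, lintegral_prod_symm _ hm'.aemeasurable]
  refine lintegral_congr fun y => ?_
  exact lintegral_add_left_eq_self (fun x => F (borelElt (x, y))) b

/-- The element `diag(a, a⁻¹)`. -/
noncomputable def diagElt (a : ℂ) (ha : a ≠ 0) : SL2 :=
  ⟨!![a, 0; 0, a⁻¹], by simp [Matrix.det_fin_two, ha]⟩

theorem hypInvariant_diagElt (a : ℂ) (ha : a ≠ 0) : HypInvariant (diagElt a ha) := by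
  intro F hF hK
  have hm : Measurable fun p => F (borelElt p) := hF.comp measurable_borelElt
  have hm' : Measurable fun p => F (diagElt a ha * borelElt p) :=
    hF.comp (measurable_borelElt.const_mul _)
  have hna : 0 < ‖a‖ := norm_pos_iff.2 ha
  set u : ℂ := a ^ 2 / (‖a‖ ^ 2 : ℝ) with hu
  have hun : ‖u‖ = 1 := by
    rw [hu, norm_div, norm_pow, Complex.norm_real, Real.norm_of_nonneg (by positivity)]; field_simp
  have hpt (ξ : ℂ) (y : ℝ) (hy : 0 < y) : F (diagElt a ha * borelElt (y * ξ, y)) =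
      F (borelElt (((‖a‖ ^ 2 * y : ℝ) : ℂ) * (u * ξ), ‖a‖ ^ 2 * y)) := by
    have hs : ((√y : ℝ) : ℂ) ≠ 0 := by exact_mod_cast (Real.sqrt_pos.2 hy).ne'
    have hh : ((y : ℝ) : ℂ) = ((√y : ℝ) : ℂ) ^ 2 := by exact_mod_cast (Real.sq_sqrt hy.le).symm
    have hent : (diagElt a ha * borelElt (y * ξ, y)).1 =
        !![a * (√y : ℝ), a * (y * ξ * ((√y : ℝ) : ℂ)⁻¹); 0, a⁻¹ * ((√y : ℝ) : ℂ)⁻¹] := by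
      rw [borelElt, Matrix.SpecialLinearGroup.coe_mul, Matrix.SpecialLinearGroup.coe_mul]
      simp [diagElt, unip, torus, hy]
    have hN : rowNorm (diagElt a ha * borelElt (y * ξ, y)) ^ 2 = (‖a‖ ^ 2 * y)⁻¹ := by
      rw [rowNorm_sq_eq, hent]
      simp [mul_pow, Real.sq_sqrt hy.le]
      rw [mul_comm]
    have hnc : ((‖a‖ : ℝ) : ℂ) ≠ 0 := by exact_mod_cast hna.ne'
    have hmc : ((‖a‖ : ℝ) : ℂ) ^ 2 = a * conj a := by
      rw [Complex.mul_conj, Complex.normSq_eq_norm_sq]; push_cast; rfl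
    have hca : conj a ≠ 0 := by simpa using ha
    rw [apply_eq_apply_borelElt hK]
    congr 3
    · rw [xPart, ← Complex.ofReal_pow, hN, hent, hu]
      simp
      rw [hh, hmc]
      field_simp
    · rw [height, hN, inv_inv]
  rw [lintegral_hypMeasure hm, lintegral_hypMeasure hm',
    ← lintegral_comp_const_mul (a := u) (by rw [← norm_pos_iff, hun]; exact one_pos)
      (F := fun ξ => ∫⁻ y, F (borelElt (y * ξ, y)) ∂mulHaar) (by
        refine Measurable.lintegral_prod_right' (f := fun q : ℂ × ℝ => F (borelElt (q.2 * q.1, q.2))) ?_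
        exact hm.comp (by fun_prop)), hun]
  simp only [one_pow, ENNReal.ofReal_one, one_mul]
  refine lintegral_congr fun ξ => ?_
  rw [← lintegral_mulHaar_mul_left (f := fun y => F (borelElt (y * (u * ξ), y)))
    (hm.comp (by fun_prop)) (c := ‖a‖ ^ 2) (by positivity)]
  refine lintegral_congr_ae ?_
  filter_upwards [ae_mulHaar_pos] with y hy
  exact hpt ξ y hy

theorem hypInvariant_weyl : HypInvariant weyl := by
  intro F hF hK
  have hm : Measurable fun p => F (borelElt p) := hF.comp measurable_borelElt
  have hm' : Measurable fun p => F (weyl * borelElt p) := hF.comp (measurable_borelElt.const_mul _)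
  have hpt (ξ : ℂ) (y : ℝ) (hy : 0 < y) : F (weyl * borelElt (y * ξ, y)) =
      F (borelElt ((((1 + ‖ξ‖ ^ 2)⁻¹ / y : ℝ) : ℂ) * -conj ξ, (1 + ‖ξ‖ ^ 2)⁻¹ / y)) := by
    have hs : ((√y : ℝ) : ℂ) ≠ 0 := by exact_mod_cast (Real.sqrt_pos.2 hy).ne'
    have hh : ((y : ℝ) : ℂ) = ((√y : ℝ) : ℂ) ^ 2 := by exact_mod_cast (Real.sq_sqrt hy.le).symm
    have hent : (weyl * borelElt (y * ξ, y)).1 =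
        !![0, -((√y : ℝ) : ℂ)⁻¹; ((√y : ℝ) : ℂ), (y * ξ * ((√y : ℝ) : ℂ)⁻¹)] := by
      rw [borelElt, Matrix.SpecialLinearGroup.coe_mul, Matrix.SpecialLinearGroup.coe_mul]
      simp [weyl, unip, torus, hy]
    have hN : rowNorm (weyl * borelElt (y * ξ, y)) ^ 2 = y * (1 + ‖ξ‖ ^ 2) := by
      rw [rowNorm_sq_eq, hent]
      simp [mul_pow, Real.sq_sqrt hy.le]
      field_simp
    have h1 : ((1 + ‖ξ‖ ^ 2 : ℝ) : ℂ) ≠ 0 := by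
      have : 0 < 1 + ‖ξ‖ ^ 2 := by positivity
      exact_mod_cast this.ne'
    rw [apply_eq_apply_borelElt hK]
    congr 3
    · rw [xPart, ← Complex.ofReal_pow, hN, hent]
      simp
      push_cast at h1
      rw [hh]
      field_simp
    · rw [height, hN, mul_inv, mul_comm, div_eq_mul_inv]
  set H : ℂ → ENNReal := fun ξ => ∫⁻ y, F (borelElt (y * ξ, y)) ∂mulHaar with hH
  have h2 : ∫⁻ ξ, H (-conj ξ) = ∫⁻ ξ, H ξ := by
    have hHm : Measurable H := by
      refine Measurable.lintegral_prod_right' (f := fun q : ℂ × ℝ => F (borelElt (q.2 * q.1, q.2))) ?_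
      exact hm.comp (by fun_prop)
    rw [← lintegral_neg_eq_self H]
    exact Complex.conjLIE.measurePreserving.lintegral_comp (hHm.comp measurable_neg)
  rw [lintegral_hypMeasure hm, lintegral_hypMeasure hm', ← h2]
  refine lintegral_congr fun ξ => ?_
  simp only [hH]
  rw [← lintegral_mulHaar_div (f := fun y => F (borelElt (y * (-conj ξ), y)))
    (hm.comp (by fun_prop)) (c := (1 + ‖ξ‖ ^ 2)⁻¹) (by positivity)]
  refine lintegral_congr_ae ?_
  filter_upwards [ae_mulHaar_pos] with y hy
  exact hpt ξ y hy

/-- Every element of `SL(2, ℂ)` preserves the hyperbolic measure, by the Bruhat decomposition. -/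
theorem hypInvariant (g : SL2) : HypInvariant g := by
  have hd := g.2
  rw [Matrix.det_fin_two] at hd
  by_cases hc : g.1 1 0 = 0
  · rw [hc, mul_zero, sub_zero] at hd
    have ha : g.1 0 0 ≠ 0 := left_ne_zero_of_mul_eq_one hd
    have : g = unip (g.1 0 1 * g.1 0 0) * diagElt (g.1 0 0) ha := by
      ext i j
      rw [Matrix.SpecialLinearGroup.coe_mul]
      fin_cases i <;> fin_cases j <;> simp [unip, diagElt, hc]
      · field_simp
      · exact eq_inv_of_mul_eq_one_right hd
    rw [this]
    exact (hypInvariant_unip _).mul (hypInvariant_diagElt _ _)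
  · have : g = unip (g.1 0 0 / g.1 1 0) * diagElt (g.1 1 0)⁻¹ (inv_ne_zero hc) * weyl *
        unip (g.1 1 1 / g.1 1 0) := by
      ext i j
      rw [Matrix.SpecialLinearGroup.coe_mul, Matrix.SpecialLinearGroup.coe_mul,
        Matrix.SpecialLinearGroup.coe_mul]
      fin_cases i <;> fin_cases j <;> simp [unip, diagElt, weyl, hc]
      · field_simp
        linear_combination -hd
      · field_simp
    rw [this]
    exact (((hypInvariant_unip _).mul (hypInvariant_diagElt _ _)).mul hypInvariant_weyl).mul
      (hypInvariant_unip _)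

theorem lintegral_haarG {H : ℂ × ℝ × SU2 → ENNReal} (hH : Measurable H) :
    ∫⁻ p, H p ∂haarG = ∫⁻ q, ∫⁻ κ, H (q.1, q.2, κ) ∂haarK ∂hypMeasure := by
  have hm : Measurable fun q : ℂ × ℝ => ∫⁻ κ, H (q.1, q.2, κ) ∂haarK :=
    Measurable.lintegral_prod_right' (f := fun q : (ℂ × ℝ) × SU2 => H (q.1.1, q.1.2, q.2))
      (hH.comp (by fun_prop))
  rw [haarG, hypMeasure, lintegral_prod _ hH.aemeasurable, lintegral_prod _ hm.aemeasurable]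
  refine lintegral_congr fun x => ?_
  have hx : Measurable fun q : ℝ × SU2 => H (x, q) := hH.comp (by fun_prop)
  rw [lintegral_prod _ hx.aemeasurable]

/-- The measure on `Ḡ` is left invariant. -/
theorem lintegral_haarG_mul_left (g : SL2) {F : SL2 → ENNReal} (hF : Measurable F) :
    ∫⁻ p, F (g * ofCoords p) ∂haarG = ∫⁻ p, F (ofCoords p) ∂haarG := by
  have h1 : Measurable fun p => F (ofCoords p) := hF.comp measurable_ofCoords
  have h2 : Measurable fun p => F (g * ofCoords p) := hF.comp (measurable_ofCoords.const_mul g)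
  rw [lintegral_haarG h1, lintegral_haarG h2]
  have hm : Measurable fun h : SL2 => ∫⁻ κ, F (h * toSL κ) ∂haarK := by
    refine Measurable.lintegral_prod_right' (f := fun q : SL2 × SU2 => F (q.1 * toSL q.2)) ?_
    exact hF.comp (measurable_fst.mul (continuous_toSL.measurable.comp measurable_snd))
  have h := hypInvariant g (fun h => ∫⁻ κ, F (h * toSL κ) ∂haarK) hm (fun h κ₀ => by
    simp only [mul_assoc, ← toSL_mul]
    exact lintegral_mul_left_eq_self (fun κ => F (h * toSL κ)) κ₀)
  simp only [mul_assoc] at h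
  exact h

/-! ### Matrix coefficients of the minimal `K`-type -/

theorem rowVec_smul (k : ℕ) (r : ℝ) {j : ℕ} (hj : j ≤ k) (z c d : ℂ) :
    rowVec k r j (z * c) (z * d) = conj z ^ k *
      ((‖z‖ ^ 2 : ℝ) : ℂ) ^ (-(1 + (k : ℂ) / 2 + Complex.I * r)) * rowVec k r j c d := by
  have hp : conj z ^ k = conj z ^ (k - j) * conj z ^ j := by rw [← pow_add]; congr 1; omega
  have hn : ‖z * c‖ ^ 2 + ‖z * d‖ ^ 2 = ‖z‖ ^ 2 * (‖c‖ ^ 2 + ‖d‖ ^ 2) := by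
    rw [norm_mul, norm_mul]; ring
  unfold rowVec
  rw [hn, Complex.ofReal_mul, Complex.mul_cpow_ofReal_nonneg (by positivity) (by positivity), hp]
  simp only [map_mul, mul_pow]
  ring

theorem continuous_rowVec_comp {X : Type*} [TopologicalSpace X] (k : ℕ) (r : ℝ) (j : ℕ) {c d : X → ℂ}
    (hc : Continuous c) (hd : Continuous d) (h0 : ∀ x, 0 < ‖c x‖ ^ 2 + ‖d x‖ ^ 2) :
    Continuous fun x => rowVec k r j (c x) (d x) := by
  unfold rowVec
  have h1 : Continuous fun x => ((‖c x‖ ^ 2 + ‖d x‖ ^ 2 : ℝ) : ℂ) ^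
      (-(1 + (k : ℂ) / 2 + Complex.I * r)) :=
    Continuous.cpow (by fun_prop) continuous_const fun x => Complex.ofReal_mem_slitPlane.2 (h0 x)
  have h2 : Continuous fun x => conj (c x) := Complex.continuous_conj.comp hc
  have h3 : Continuous fun x => conj (d x) := Complex.continuous_conj.comp hd
  exact (continuous_const.mul ((h3.pow _).mul (h2.pow _))).mul h1

theorem continuous_inducedVec (k : ℕ) (r : ℝ) (j : Fin (k + 1)) : Continuous (inducedVec k r j) := by
  rw [show inducedVec k r j = _ from funext fun g => inducedVec_eq_rowVec k r j g]
  refine continuous_rowVec_comp k r j (continuous_SL2_entry 1 0) (continuous_SL2_entry 1 1) fun g => ?_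
  rw [← rowNorm_sq_eq]
  have := rowNorm_pos g
  positivity

/-- The matrix coefficient `⟨g v_{k-2j}, v_{k-2i}⟩` of the representation of weight `k` and spectral
parameter `0`. -/
noncomputable def crossCoeff (k : ℕ) (i j : Fin (k + 1)) (g : SL2) : ℂ :=
  ∫ κ, inducedVec k 0 j (toSL κ * g) * conj (inducedVec k 0 i (toSL κ)) ∂haarK

theorem matCoeff_inducedVec (k : ℕ) (j : Fin (k + 1)) :
    matCoeff (inducedVec k 0 j) = crossCoeff k j j := rfl

theorem continuous_crossCoeff_integrand (k : ℕ) (i j : Fin (k + 1)) :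
    Continuous fun p : SL2 × SU2 =>
      inducedVec k 0 j (toSL p.2 * p.1) * conj (inducedVec k 0 i (toSL p.2)) := by
  have h := continuous_toSL.comp (continuous_snd : Continuous fun p : SL2 × SU2 => p.2)
  exact ((continuous_inducedVec k 0 j).comp (h.mul continuous_fst)).mul
    (Complex.continuous_conj.comp ((continuous_inducedVec k 0 i).comp h))

theorem measurable_crossCoeff (k : ℕ) (i j : Fin (k + 1)) : Measurable (crossCoeff k i j) :=
  (StronglyMeasurable.integral_prod_right' (ν := haarK)
    (continuous_crossCoeff_integrand k i j).stronglyMeasurable).measurable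

theorem integrable_crossCoeff_integrand (k : ℕ) (i j : Fin (k + 1)) (g : SL2) :
    Integrable (fun κ => inducedVec k 0 j (toSL κ * g) * conj (inducedVec k 0 i (toSL κ))) haarK :=
  have h : Continuous fun κ =>
      inducedVec k 0 j (toSL κ * g) * conj (inducedVec k 0 i (toSL κ)) :=
    ((continuous_inducedVec k 0 j).comp (continuous_toSL.mul continuous_const)).mul
      (Complex.continuous_conj.comp ((continuous_inducedVec k 0 i).comp continuous_toSL))
  integrable_of_continuous_SU2 h

theorem crossCoeff_mul_toSL (k : ℕ) (i j : Fin (k + 1)) (g : SL2) (κ : SU2) :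
    crossCoeff k i j (g * toSL κ) = ∑ l, rho k κ l j * crossCoeff k i l g := by
  unfold crossCoeff
  simp only [← mul_assoc, inducedVec_mul_toSL k 0 j, Finset.sum_mul]
  rw [integral_finsetSum]
  · simp only [mul_assoc, integral_const_mul]
  · intro l _
    simp only [mul_assoc]
    exact (integrable_crossCoeff_integrand k i l g).const_mul _

theorem crossCoeff_toSL_inv_mul (k : ℕ) (i j : Fin (k + 1)) (g : SL2) (κ : SU2) :
    crossCoeff k i j (toSL κ⁻¹ * g) = ∑ l, conj (rho k κ l i) * crossCoeff k l j g := by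
  unfold crossCoeff
  rw [← integral_mul_right_eq_self _ κ]
  have h (κ' : SU2) : inducedVec k 0 j (toSL (κ' * κ) * (toSL κ⁻¹ * g)) *
      conj (inducedVec k 0 i (toSL (κ' * κ))) = ∑ l, conj (rho k κ l i) *
        (inducedVec k 0 j (toSL κ' * g) * conj (inducedVec k 0 l (toSL κ'))) := by
    rw [← mul_assoc, ← toSL_mul, mul_inv_cancel_right, toSL_mul κ' κ, inducedVec_mul_toSL, map_sum,
      Finset.mul_sum]
    refine Finset.sum_congr rfl fun l _ => ?_
    rw [map_mul]; ring
  simp only [h]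
  rw [integral_finsetSum _ fun l _ => (integrable_crossCoeff_integrand k l j g).const_mul _]
  simp only [integral_const_mul]

/-- The Fourier transform of the function `x ↦ f_j(w n(x) a(y))` on `ℂ`. -/
noncomputable def vecKernel (k j : ℕ) (y : ℝ) (ζ : ℂ) : ℂ :=
  ((√(k + 1 : ℝ) : ℝ) : ℂ) * ((-Complex.I) ^ j * ((√(k.choose j) : ℝ) : ℂ)) *
    (y : ℂ) ^ (1 + j : ℂ) * besselKernel (k - j) (1 + (k : ℂ) / 2) y ζ

theorem fourierInv_const_mul (c : ℂ) (f : ℂ → ℂ) (x : ℂ) :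
    𝓕⁻ (fun ζ => c * f ζ) x = c * 𝓕⁻ f x := by
  rw [Real.fourierInv_eq', Real.fourierInv_eq', ← integral_const_mul]
  congr 1; ext ζ; simp only [smul_eq_mul]; ring

theorem re_one_add_half (k : ℕ) : (1 + (k : ℂ) / 2).re = 1 + k / 2 := by simp

theorem integrable_vecKernel (k j : ℕ) {y : ℝ} (hy : 0 < y) : Integrable (vecKernel k j y) := by
  refine (integrable_besselKernel (k - j) ?_ hy).const_mul _
  have : ((k - j : ℕ) : ℝ) ≤ k := by exact_mod_cast Nat.sub_le _ _
  rw [re_one_add_half]; linarith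

theorem memLp_vecKernel (k j : ℕ) {y : ℝ} (hy : 0 < y) : MemLp (vecKernel k j y) 2 := by
  refine (memLp_two_besselKernel (k - j) ?_ hy).const_mul _
  have : ((k - j : ℕ) : ℝ) ≤ k := by exact_mod_cast Nat.sub_le _ _
  rw [re_one_add_half]; linarith

theorem fourierInv_vecKernel (k : ℕ) {j : ℕ} (hj : j ≤ k) {y : ℝ} (hy : 0 < y) (x : ℂ) :
    𝓕⁻ (vecKernel k j y) x = rowVec k 0 j ((√y : ℝ) : ℂ) (x / ((√y : ℝ) : ℂ)) := by
  have : ((k - j : ℕ) : ℝ) ≤ k := by exact_mod_cast Nat.sub_le _ _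
  unfold vecKernel
  rw [fourierInv_const_mul, fourierInv_besselKernel (k - j) (by rw [re_one_add_half]; linarith) hy,
    rowVec_torus k 0 hj hy]
  simp

theorem fourierInv_modulate (f : ℂ → ℂ) (x x₀ : ℂ) :
    𝓕⁻ (fun ζ => Complex.exp (((2 * Real.pi * ⟪ζ, x₀⟫ : ℝ) : ℂ) * Complex.I) * f ζ) x =
      𝓕⁻ f (x + x₀) := by
  rw [Real.fourierInv_eq', Real.fourierInv_eq']
  congr 1; ext ζ
  rw [inner_add_right, smul_eq_mul, smul_eq_mul, ← mul_assoc, ← Complex.exp_add]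
  congr 2; push_cast; ring

/-- The matrix coefficients on the Borel subgroup as Fourier transforms. -/
theorem crossCoeff_borelElt (k : ℕ) (i j : Fin (k + 1)) (x₀ : ℂ) {y : ℝ} (hy : 0 < y) :
    crossCoeff k i j (borelElt (x₀, y)) =
      (Real.pi : ℂ)⁻¹ * 𝓕⁻ (fun ζ => vecKernel k j y ζ * conj (vecKernel k i 1 ζ)) x₀ := by
  have hs := Real.sqrt_pos.2 hy
  have hi : (i : ℕ) ≤ k := Nat.lt_succ_iff.1 i.2
  have hj : (j : ℕ) ≤ k := Nat.lt_succ_iff.1 j.2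
  have hs0 : ((√y : ℝ) : ℂ) ≠ 0 := by exact_mod_cast hs.ne'
  set φ : ℂ → ℂ → ℂ := fun c d => rowVec k 0 j (c * (√y : ℝ)) ((c * x₀ + d) / (√y : ℝ)) *
    conj (rowVec k 0 i c d) with hφ
  have h1 (κ : SU2) : inducedVec k 0 j (toSL κ * borelElt (x₀, y)) * conj (inducedVec k 0 i (toSL κ)) =
      φ (κ.1 1 0) (κ.1 1 1) := by
    rw [inducedVec_eq_rowVec, inducedVec_eq_rowVec]
    have : (toSL κ * borelElt (x₀, y)).1 1 0 = κ.1 1 0 * (√y : ℝ) ∧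
        (toSL κ * borelElt (x₀, y)).1 1 1 = (κ.1 1 0 * x₀ + κ.1 1 1) / (√y : ℝ) := by
      rw [borelElt, Matrix.SpecialLinearGroup.coe_mul, Matrix.SpecialLinearGroup.coe_mul]
      simp [toSL, unip, torus, hy, Matrix.mul_apply, Fin.sum_univ_two, div_eq_mul_inv, add_mul, mul_assoc]
    rw [this.1, this.2]; rfl
  have hhom : ∀ c d : ℂ, c ≠ 0 → φ c d = ((‖c‖ ^ 4)⁻¹ : ℝ) * φ 1 (d / c) := by
    intro c d hc
    have hnc : 0 < ‖c‖ := norm_pos_iff.2 hc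
    have e1 : rowVec k 0 j (c * (√y : ℝ)) ((c * x₀ + d) / (√y : ℝ)) = conj c ^ k *
        ((‖c‖ ^ 2 : ℝ) : ℂ) ^ (-(1 + (k : ℂ) / 2 + Complex.I * (0 : ℝ))) *
        rowVec k 0 j (1 * (√y : ℝ)) ((1 * x₀ + d / c) / (√y : ℝ)) := by
      rw [← rowVec_smul k 0 hj]; congr 1
      · ring
      · field_simp
    have e2 : rowVec k 0 i c d = conj c ^ k *
        ((‖c‖ ^ 2 : ℝ) : ℂ) ^ (-(1 + (k : ℂ) / 2 + Complex.I * (0 : ℝ))) * rowVec k 0 i 1 (d / c) := by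
      rw [← rowVec_smul k 0 hi]; congr 1
      · ring
      · field_simp
    have e3 : conj c ^ k * ((‖c‖ ^ 2 : ℝ) : ℂ) ^ (-(1 + (k : ℂ) / 2 + Complex.I * (0 : ℝ))) *
        conj (conj c ^ k * ((‖c‖ ^ 2 : ℝ) : ℂ) ^ (-(1 + (k : ℂ) / 2 + Complex.I * (0 : ℝ)))) =
        (((‖c‖ ^ 4)⁻¹ : ℝ) : ℂ) := by
      rw [Complex.mul_conj, Complex.normSq_eq_norm_sq, norm_mul, norm_pow, RCLike.norm_conj,
        Complex.norm_cpow_eq_rpow_re_of_pos (by positivity)]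
      congr 1
      have : (-(1 + (k : ℂ) / 2 + Complex.I * (0 : ℝ))).re = -(1 + k / 2) := by simp
      have h2 : (‖c‖ ^ 2) ^ (-(1 + (k : ℝ) / 2)) = (‖c‖ ^ (k + 2))⁻¹ := by
        rw [← Real.rpow_natCast, ← Real.rpow_mul hnc.le, ← Real.rpow_natCast, ← Real.rpow_neg hnc.le]
        congr 1; push_cast; ring
      rw [this, h2, pow_add]
      field_simp
    simp only [hφ]
    rw [e1, e2, map_mul, ← e3]; ring
  have hcont : Continuous fun x => φ 1 x := by
    refine Continuous.mul ?_ (Complex.continuous_conj.comp ?_)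
    · refine continuous_rowVec_comp k 0 j continuous_const (by fun_prop) fun x => ?_
      have : 0 < ‖(1 : ℂ) * (√y : ℝ)‖ := norm_pos_iff.2 (mul_ne_zero one_ne_zero hs0)
      positivity
    · refine continuous_rowVec_comp k 0 i continuous_const continuous_id fun x => ?_
      rw [norm_one]; positivity
  unfold crossCoeff
  simp only [h1]
  rw [integral_haarK_row hcont hhom]
  congr 1
  have h2 (x : ℂ) : φ 1 x = 𝓕⁻ (fun ζ => Complex.exp (((2 * Real.pi * ⟪ζ, x₀⟫ : ℝ) : ℂ) * Complex.I) *
      vecKernel k j y ζ) x * conj (𝓕⁻ (vecKernel k i 1) x) := by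
    rw [fourierInv_modulate, fourierInv_vecKernel k hj hy, fourierInv_vecKernel k hi one_pos]
    simp only [hφ]
    simp [add_comm]
  simp only [h2]
  have hL1 : Integrable (fun ζ => Complex.exp (((2 * Real.pi * ⟪ζ, x₀⟫ : ℝ) : ℂ) * Complex.I) *
      vecKernel k j y ζ) :=
    integrable_cexp_mul_I_mul (integrable_vecKernel k j hy) (c := fun ζ => 2 * Real.pi * ⟪ζ, x₀⟫)
      (by fun_prop)
  rw [integral_fourierInv_mul_conj hL1 ((memLp_vecKernel k j hy).congr_norm hL1.1
    (ae_of_all _ fun ζ => by rw [norm_mul, Complex.norm_exp_ofReal_mul_I, one_mul]))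
    (integrable_vecKernel k i one_pos) (memLp_vecKernel k i one_pos), Real.fourierInv_eq']
  congr 1; ext ζ
  rw [smul_eq_mul, mul_assoc]

/-- The constant in the values of `vecKernel`. -/
noncomputable def kernelConst (k : ℕ) : ℂ :=
  ((√(k + 1 : ℝ) : ℝ) : ℂ) * (2 * Real.pi) * (-Complex.I) ^ k *
    ((Real.pi ^ ((k : ℝ) / 2) : ℝ) : ℂ) / Complex.Gamma (1 + (k : ℂ) / 2)

theorem vecKernel_eq (k : ℕ) {j : ℕ} (hj : j ≤ k) {y : ℝ} (hy : 0 < y) {ζ : ℂ} (hζ : ζ ≠ 0) :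
    vecKernel k j y ζ = kernelConst k *
      ((√(k.choose j) * y ^ (1 + (k : ℝ) / 2) * ‖ζ‖ ^ ((j : ℝ) - k / 2) : ℝ) : ℂ) *
      conj ζ ^ (k - j) * besselK ((k : ℂ) / 2 - j) (2 * Real.pi * ‖ζ‖ * y) := by
  have hζ' : 0 < ‖ζ‖ := norm_pos_iff.2 hζ
  have hπ := Real.pi_pos
  have e0 : (1 + (k : ℂ) / 2 - 1 - ((k - j : ℕ) : ℂ)) = -((k : ℂ) / 2 - j) := by
    rw [Nat.cast_sub hj]; ring
  have e1 : 2 * (Real.pi * ‖ζ‖ * y) = 2 * Real.pi * ‖ζ‖ * y := by ring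
  have e2 : -(Real.pi * Complex.I * conj ζ) = (Real.pi : ℂ) * (-Complex.I * conj ζ) := by ring
  have e3 : (-Complex.I) ^ k = (-Complex.I) ^ j * (-Complex.I) ^ (k - j) := by
    rw [← pow_add]; congr 1; omega
  have e4 : (y : ℂ) ^ (1 + j : ℂ) * (Real.pi : ℂ) ^ (k - j) *
      ((Real.pi * ‖ζ‖ / y : ℝ) : ℂ) ^ (-((k : ℂ) / 2 - j)) =
      ((Real.pi ^ ((k : ℝ) / 2) : ℝ) : ℂ) * ((y ^ (1 + (k : ℝ) / 2) * ‖ζ‖ ^ ((j : ℝ) - k / 2) : ℝ) : ℂ) := by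
    rw [← Complex.cpow_natCast, Complex.ofReal_mul, Complex.ofReal_cpow hπ.le, Complex.ofReal_cpow hy.le,
      Complex.ofReal_cpow hζ'.le, ofReal_cpow_eq_exp hy, ofReal_cpow_eq_exp hy, ofReal_cpow_eq_exp hπ,
      ofReal_cpow_eq_exp hπ, ofReal_cpow_eq_exp hζ', ofReal_cpow_eq_exp (by positivity),
      Real.log_div (by positivity) hy.ne', Real.log_mul hπ.ne' hζ'.ne', ← Complex.exp_add,
      ← Complex.exp_add, ← Complex.exp_add, ← Complex.exp_add]
    congr 1; push_cast [Nat.cast_sub hj]; ring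
  unfold vecKernel kernelConst besselKernel
  rw [e0, besselK_neg, e1, e2, mul_pow, mul_pow, e3]
  push_cast at e4 ⊢
  linear_combination (((√(k + 1 : ℝ) : ℝ) : ℂ) * ((-Complex.I) ^ j * ((√(k.choose j) : ℝ) : ℂ)) *
    (2 * Real.pi) * ((-Complex.I) ^ (k - j) * conj ζ ^ (k - j)) / Complex.Gamma (1 + (k : ℂ) / 2) *
    besselK ((k : ℂ) / 2 - j) (2 * Real.pi * ‖ζ‖ * y)) * e4

/-- The symmetry between the two extreme weights comes from `K_{-ν} = K_ν`. -/
theorem conj_kernelProduct (k : ℕ) (l : Fin (k + 1)) {y : ℝ} (hy : 0 < y) {ζ : ℂ} (hζ : ζ ≠ 0) :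
    conj (vecKernel k (l.rev : ℕ) y ζ * conj (vecKernel k 0 1 ζ)) =
      vecKernel k l y ζ * conj (vecKernel k k 1 ζ) := by
  have hl : (l : ℕ) ≤ k := Nat.lt_succ_iff.1 l.2
  have hr : (l.rev : ℕ) = k - l := by rw [Fin.val_rev]; omega
  have hζ' : 0 < ‖ζ‖ := norm_pos_iff.2 hζ
  have hK (ν : ℝ) (x : ℝ) : conj (besselK (ν : ℂ) x) = besselK (ν : ℂ) x := by
    rw [besselK_conj, Complex.conj_ofReal]
  have c1 : ((k : ℂ) / 2 - ((k - l : ℕ) : ℂ)) = (-((k : ℝ) / 2 - (l : ℕ) : ℝ) : ℂ) := by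
    push_cast [Nat.cast_sub hl]; ring
  have c2 : ((k : ℂ) / 2 - ((0 : ℕ) : ℂ)) = (((k : ℝ) / 2 : ℝ) : ℂ) := by push_cast; ring
  have c3 : ((k : ℂ) / 2 - ((l : ℕ) : ℂ)) = (((k : ℝ) / 2 - (l : ℕ) : ℝ) : ℂ) := by push_cast; ring
  have c4 : ((k : ℂ) / 2 - (k : ℂ)) = (-((k : ℝ) / 2 : ℝ) : ℂ) := by push_cast; ring
  rw [hr, vecKernel_eq k (Nat.sub_le k l) hy hζ, vecKernel_eq k (Nat.zero_le k) one_pos hζ,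
    vecKernel_eq k hl hy hζ, vecKernel_eq k le_rfl one_pos hζ, c1, c2, c3, c4, besselK_neg, besselK_neg]
  simp only [map_mul, map_pow, Complex.conj_conj, Complex.conj_ofReal, hK, Nat.choose_symm hl,
    Nat.choose_zero_right, Nat.choose_self, Nat.sub_sub_self hl, Nat.sub_self, Nat.sub_zero, pow_zero,
    Real.one_rpow]
  have e1 : ((‖ζ‖ ^ (((k - l : ℕ) : ℝ) - k / 2) : ℝ) : ℂ) * ((‖ζ‖ ^ (((0 : ℕ) : ℝ) - k / 2) : ℝ) : ℂ) *
      (ζ ^ (l : ℕ) * conj ζ ^ (l : ℕ)) =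
      ((‖ζ‖ ^ (((l : ℕ) : ℝ) - k / 2) : ℝ) : ℂ) * ((‖ζ‖ ^ ((k : ℝ) - k / 2) : ℝ) : ℂ) := by
    rw [← mul_pow, Complex.mul_conj, Complex.normSq_eq_norm_sq]
    norm_cast
    rw [← pow_mul, ← Real.rpow_natCast ‖ζ‖ (2 * l), ← Real.rpow_add hζ', ← Real.rpow_add hζ',
      ← Real.rpow_add hζ']
    congr 1; push_cast [Nat.cast_sub hl]; ring
  have e2 : conj ζ ^ k = conj ζ ^ (l : ℕ) * conj ζ ^ (k - l) := by
    rw [← pow_add]; congr 1; omega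
  rw [e2]
  push_cast at e1 ⊢
  rw [map_one]
  linear_combination (conj (kernelConst k) * kernelConst k * ((√((k.choose l : ℕ) : ℝ) : ℝ) : ℂ) *
    ((y ^ (1 + (k : ℝ) / 2) : ℝ) : ℂ) * ((√1 : ℝ) : ℂ) * conj ζ ^ (k - l : ℕ) *
    besselK ((k : ℂ) / 2 - (l : ℕ)) (2 * Real.pi * ‖ζ‖ * y) *
    besselK ((k : ℂ) / 2) (2 * Real.pi * ‖ζ‖ * 1)) * e1

theorem ae_ne_zero_complex : ∀ᵐ ζ : ℂ, ζ ≠ 0 := by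
  rw [ae_iff]; simp

/-- The reversal of the weights conjugates the matrix coefficients on the Borel subgroup. -/
theorem crossCoeff_borelElt_last (k : ℕ) (l : Fin (k + 1)) (x : ℂ) {y : ℝ} (hy : 0 < y) :
    crossCoeff k (Fin.last k) l (borelElt (x, y)) =
      (-1) ^ (k - (l : ℕ)) * conj (crossCoeff k 0 l.rev (borelElt (x, y))) := by
  have hl : (l : ℕ) ≤ k := Nat.lt_succ_iff.1 l.2
  have hneg (ζ : ℂ) (hζ : ζ ≠ 0) :
      vecKernel k l y (-ζ) * conj (vecKernel k k 1 (-ζ)) =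
        (-1) ^ (k - (l : ℕ)) * (vecKernel k l y ζ * conj (vecKernel k k 1 ζ)) := by
    rw [vecKernel_eq k hl hy (neg_ne_zero.2 hζ), vecKernel_eq k le_rfl one_pos (neg_ne_zero.2 hζ),
      vecKernel_eq k hl hy hζ, vecKernel_eq k le_rfl one_pos hζ, norm_neg, map_neg,
      neg_pow (conj ζ) (k - l), Nat.sub_self, pow_zero, pow_zero]
    ring
  rw [crossCoeff_borelElt k _ _ x hy, crossCoeff_borelElt k _ _ x hy, map_mul, Real.fourierInv_eq',
    Real.fourierInv_eq', ← integral_conj, map_inv₀, Complex.conj_ofReal, mul_left_comm]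
  congr 1
  rw [← integral_neg_eq_self, ← integral_const_mul]
  refine integral_congr_ae ?_
  filter_upwards [ae_ne_zero_complex] with ζ hζ
  have := conj_kernelProduct k l hy hζ
  simp only [smul_eq_mul, Fin.val_last, Fin.val_zero]
  rw [hneg ζ hζ, map_mul, this, inner_neg_left, ← Complex.exp_conj]
  simp only [map_mul, Complex.conj_I, Complex.conj_ofReal]
  rw [show ((2 * Real.pi * -⟪ζ, x⟫ : ℝ) : ℂ) * Complex.I = ((2 * Real.pi * ⟪ζ, x⟫ : ℝ) : ℂ) * -Complex.I by
    push_cast; ring]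
  ring

/-- The matrix coefficients of the extreme weight vectors are complex conjugate. -/
theorem crossCoeff_last_last (k : ℕ) (g : SL2) :
    crossCoeff k (Fin.last k) (Fin.last k) g = conj (crossCoeff k 0 0 g) := by
  have hg := eq_unip_xPart_mul g
  rw [hg]
  change crossCoeff k _ _ (borelElt (xPart g, height g) * _) = conj (crossCoeff k _ _
    (borelElt (xPart g, height g) * _))
  rw [crossCoeff_mul_toSL, crossCoeff_mul_toSL, map_sum, ← Equiv.sum_comp Fin.revPerm]
  refine Finset.sum_congr rfl fun l _ => ?_
  rw [Fin.revPerm_apply, crossCoeff_borelElt_last k _ _ (height_pos g), rho_last_right, Fin.rev_rev, map_mul,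
    mul_mul_mul_comm, ← mul_pow]
  simp

theorem continuous_height : Continuous height := by
  unfold height
  refine Continuous.inv₀ ?_ fun g => (pow_pos (rowNorm_pos g) 2).ne'
  simp only [rowNorm_sq_eq]
  exact ((continuous_SL2_entry 1 0).norm.pow 2).add ((continuous_SL2_entry 1 1).norm.pow 2)

theorem height_mul_toSL (g : SL2) (κ : SU2) : height (g * toSL κ) = height g := by
  unfold height
  rw [rowNorm_sq_eq, rowNorm_sq_eq, Matrix.SpecialLinearGroup.coe_mul]
  simp only [Matrix.mul_apply, Fin.sum_univ_two, toSL]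
  rw [SU2.norm_row_mul]

theorem height_borelElt (x : ℂ) {y : ℝ} (hy : 0 < y) : height (borelElt (x, y)) = y := by
  have := height_unip_torus_toSL x hy 1
  rwa [height_mul_toSL] at this

theorem height_toSL (κ : SU2) : height (toSL κ) = 1 := by
  unfold height
  rw [rowNorm_sq_eq]
  simp only [toSL]
  rw [SU2.norm_row_one, inv_one]

theorem inducedVec_zero_left (r : ℝ) (g : SL2) :
    inducedVec 0 r 0 g = (height g : ℂ) ^ (1 + Complex.I * r) := by
  simp [inducedVec, inducedExt, rho_zero]

/-- The spherical function as an integral over `K`. -/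
theorem matCoeff_spherical (r : ℝ) (g : SL2) :
    matCoeff (inducedVec 0 r 0) g = ∫ κ, (height (toSL κ * g) : ℂ) ^ (1 + Complex.I * r) ∂haarK := by
  simp [matCoeff, inducedVec_zero_left, height_toSL]

/-- Orthogonality relations for the first column of `ρ_k`. -/
theorem lintegral_enorm_sum_conj_rho (k : ℕ) (a : Fin (k + 1) → ℂ) :
    ∫⁻ κ, ‖∑ l, conj (rho k κ l 0) * a l‖ₑ ^ 2 ∂haarK =
      ENNReal.ofReal ((k : ℝ) + 1)⁻¹ * ∑ l, ‖a l‖ₑ ^ 2 := by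
  have hc : Continuous fun κ => ∑ l, conj (rho k κ l 0) * a l :=
    continuous_finsetSum _ fun l _ =>
      (Complex.continuous_conj.comp (continuous_rho_zero_right k l)).mul continuous_const
  have h1 : ∫ κ, ((‖∑ l, conj (rho k κ l 0) * a l‖ ^ 2 : ℝ) : ℂ) ∂haarK =
      (((k : ℝ) + 1)⁻¹ * ∑ l, ‖a l‖ ^ 2 : ℝ) := by
    have h2 (κ : SU2) : ((‖∑ l, conj (rho k κ l 0) * a l‖ ^ 2 : ℝ) : ℂ) =
        ∑ l, ∑ m, (conj (a l) * a m) * (rho k κ l 0 * conj (rho k κ m 0)) := by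
      rw [← Complex.normSq_eq_norm_sq, ← Complex.mul_conj, mul_comm, map_sum, Finset.sum_mul_sum]
      refine Finset.sum_congr rfl fun l _ => Finset.sum_congr rfl fun m _ => ?_
      rw [map_mul, Complex.conj_conj]; ring
    have h3 (l m : Fin (k + 1)) : Integrable (fun κ => (conj (a l) * a m) *
        (rho k κ l 0 * conj (rho k κ m 0))) haarK :=
      (integrable_of_continuous_SU2 ((continuous_rho_zero_right k l).mul
        (Complex.continuous_conj.comp (continuous_rho_zero_right k m)))).const_mul _
    simp only [h2]
    rw [integral_finsetSum _ fun l _ => integrable_finsetSum _ fun m _ => h3 l m]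
    push_cast
    rw [Finset.mul_sum]
    refine Finset.sum_congr rfl fun l _ => ?_
    rw [integral_finsetSum _ fun m _ => h3 l m]
    simp only [integral_const_mul, integral_rho_mul_conj]
    simp only [mul_ite, mul_zero, Finset.sum_ite_eq, Finset.mem_univ, if_true]
    rw [mul_comm (conj (a l)), Complex.mul_conj, Complex.normSq_eq_norm_sq]
    push_cast; ring
  have h4 : ∫ κ, ‖∑ l, conj (rho k κ l 0) * a l‖ ^ 2 ∂haarK = ((k : ℝ) + 1)⁻¹ * ∑ l, ‖a l‖ ^ 2 := by
    rw [integral_complex_ofReal] at h1; exact_mod_cast h1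
  have h5 : Integrable (fun κ => ‖∑ l, conj (rho k κ l 0) * a l‖ ^ 2) haarK :=
    (hc.norm.pow 2).integrable_of_hasCompactSupport (HasCompactSupport.of_compactSpace _)
  have hen (z : ℂ) : ‖z‖ₑ ^ 2 = ENNReal.ofReal (‖z‖ ^ 2) := by
    rw [← ofReal_norm, ENNReal.ofReal_pow (norm_nonneg z)]
  simp only [hen]
  rw [← ofReal_integral_eq_lintegral_ofReal h5 (ae_of_all _ fun κ => by positivity), h4,
    ENNReal.ofReal_mul (by positivity), ENNReal.ofReal_sum_of_nonneg fun l _ => by positivity]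

theorem lintegral_enorm_sum_rho (k : ℕ) (a : Fin (k + 1) → ℂ) :
    ∫⁻ κ, ‖∑ l, rho k κ l 0 * a l‖ₑ ^ 2 ∂haarK =
      ENNReal.ofReal ((k : ℝ) + 1)⁻¹ * ∑ l, ‖a l‖ₑ ^ 2 := by
  have h := lintegral_enorm_sum_conj_rho k fun l => conj (a l)
  have h1 (κ : SU2) : ∑ l, conj (rho k κ l 0) * conj (a l) = conj (∑ l, rho k κ l 0 * a l) := by
    simp only [map_sum, map_mul]
  have h2 (z : ℂ) : ‖conj z‖ₑ = ‖z‖ₑ := by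
    rw [← ofReal_norm, RCLike.norm_conj, ofReal_norm]
  simpa only [h1, h2] using h

/-! ### Fourier coefficients along horospheres -/

theorem enorm_sq_eq_ofReal {E : Type*} [SeminormedAddCommGroup E] (z : E) :
    ‖z‖ₑ ^ 2 = ENNReal.ofReal (‖z‖ ^ 2) := by
  rw [← ofReal_norm, ENNReal.ofReal_pow (norm_nonneg z)]

theorem measurable_besselK (ν : ℂ) : Measurable (besselK ν) := by
  have h : Continuous fun p : ℝ × ℝ =>
      (Real.exp (-p.1 * Real.cosh p.2) : ℂ) * Complex.cosh (ν * p.2) := by fun_prop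
  exact (StronglyMeasurable.integral_prod_right'
    (ν := volume.restrict (Set.Ioi (0 : ℝ))) h.stronglyMeasurable).measurable

theorem measurable_boldW_apply (k : ℕ) (j : Fin (k + 1)) : Measurable fun y => boldW k y j := by
  simp only [boldW]
  have h1 : Measurable fun y : ℝ => ((y ^ ((k : ℝ) / 2 + 1) * √(k.choose j) : ℝ) : ℂ) := by fun_prop
  have h2 : Measurable fun y : ℝ => besselK ((k : ℂ) / 2 - (j : ℕ)) (4 * Real.pi * y) :=
    (measurable_besselK _).comp (by fun_prop)
  exact h1.mul h2

theorem enorm_boldW_sq (k : ℕ) (y : ℝ) : ‖boldW k y‖ₑ ^ 2 = ∑ j, ‖boldW k y j‖ₑ ^ 2 := by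
  rw [enorm_sq_eq_ofReal, EuclideanSpace.norm_sq_eq,
    ENNReal.ofReal_sum_of_nonneg fun l _ => by positivity]
  simp only [enorm_sq_eq_ofReal]

theorem measurable_enorm_boldW_sq (k : ℕ) : Measurable fun y => ‖boldW k y‖ₑ ^ 2 := by
  simp only [enorm_boldW_sq]
  exact Finset.measurable_fun_sum _ fun j _ => (measurable_boldW_apply k j).enorm.pow_const 2

/-- The constant that relates `vecKernel` to the Whittaker function `boldW`. -/
noncomputable def planchConst (k : ℕ) : ℝ :=
  16 * Real.pi ^ 2 * ((k : ℝ) + 1) * (2 * Real.pi) ^ k / Real.Gamma (1 + (k : ℝ) / 2) ^ 2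

theorem planchConst_pos (k : ℕ) : 0 < planchConst k := by
  have := Real.Gamma_pos_of_pos (show 0 < 1 + (k : ℝ) / 2 by positivity)
  unfold planchConst
  positivity

theorem norm_kernelConst_sq (k : ℕ) : ‖kernelConst k‖ ^ 2 * 2 ^ (k + 2) = planchConst k := by
  have hG := Real.Gamma_pos_of_pos (show 0 < 1 + (k : ℝ) / 2 by positivity)
  have h : Complex.Gamma (1 + (k : ℂ) / 2) = ((Real.Gamma (1 + (k : ℝ) / 2) : ℝ) : ℂ) := by
    rw [← Complex.Gamma_ofReal]; push_cast; rfl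
  have e : (Real.pi ^ ((k : ℝ) / 2)) ^ 2 = Real.pi ^ k := by
    rw [← Real.rpow_natCast, ← Real.rpow_mul Real.pi_pos.le, ← Real.rpow_natCast]
    congr 1; push_cast; ring
  unfold kernelConst planchConst
  rw [h]
  simp only [norm_mul, norm_div, norm_pow, norm_neg, Complex.norm_I, one_pow, mul_one,
    Complex.norm_real, Real.norm_eq_abs, mul_pow, div_pow, sq_abs, e, Complex.norm_ofNat]
  rw [Real.sq_sqrt (by positivity), pow_add]
  ring

theorem enorm_vecKernel_sq (k : ℕ) (j : Fin (k + 1)) {y : ℝ} (hy : 0 < y) {ζ : ℂ} (hζ : ζ ≠ 0) :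
    ‖vecKernel k j y ζ‖ₑ ^ 2 =
      ENNReal.ofReal (planchConst k / ‖ζ‖ ^ 2) * ‖boldW k (y * (‖ζ‖ / 2)) j‖ₑ ^ 2 := by
  have hj : (j : ℕ) ≤ k := Nat.lt_succ_iff.1 j.2
  have hζ' : 0 < ‖ζ‖ := norm_pos_iff.2 hζ
  rw [enorm_sq_eq_ofReal, enorm_sq_eq_ofReal, ← ENNReal.ofReal_mul (by have := planchConst_pos k; positivity)]
  congr 1
  have e1 : 4 * Real.pi * (y * (‖ζ‖ / 2)) = 2 * Real.pi * ‖ζ‖ * y := by ring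
  rw [vecKernel_eq k hj hy hζ, boldW_apply_eq k (by positivity), e1, ← norm_kernelConst_sq]
  have e2 : ‖((y * (‖ζ‖ / 2) : ℝ) : ℂ) ^ ((k : ℂ) / 2 + 1)‖ ^ 2 = y ^ (k + 2) * ‖ζ‖ ^ (k + 2) / 2 ^ (k + 2) := by
    rw [Complex.norm_cpow_eq_rpow_re_of_pos (by positivity), ← Real.rpow_natCast,
      ← Real.rpow_mul (by positivity), ← mul_pow, ← div_pow, ← Real.rpow_natCast]
    congr 1
    · ring
    · simp; ring
  have e3 : (y ^ (1 + (k : ℝ) / 2)) ^ 2 = y ^ (k + 2) := by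
    rw [← Real.rpow_natCast, ← Real.rpow_mul hy.le, ← Real.rpow_natCast]
    congr 1; push_cast; ring
  have e4 : (‖ζ‖ ^ ((j : ℝ) - k / 2)) ^ 2 * (‖ζ‖ ^ (k - j : ℕ)) ^ 2 = ‖ζ‖ ^ k := by
    rw [← Real.rpow_natCast _ 2, ← Real.rpow_natCast _ 2, ← Real.rpow_natCast ‖ζ‖ (k - j),
      ← Real.rpow_mul hζ'.le, ← Real.rpow_mul hζ'.le, ← Real.rpow_add hζ', ← Real.rpow_natCast]
    congr 1; push_cast [Nat.cast_sub hj]; ring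
  simp only [norm_mul, mul_pow, e2, norm_pow, RCLike.norm_conj, Complex.norm_real, Real.norm_eq_abs, sq_abs,
    e3]
  have e5 := pow_add ‖ζ‖ k 2
  rw [e5, ← e4]
  generalize ‖ζ‖ ^ ((j : ℝ) - k / 2) = a
  generalize ‖besselK ((k : ℂ) / 2 - (j : ℕ)) (2 * Real.pi * ‖ζ‖ * y)‖ = b
  field_simp

/-- Polar coordinates for radial functions. -/
theorem lintegral_complex_norm {F : ℝ → ENNReal} (hF : Measurable F) :
    ∫⁻ ζ : ℂ, F ‖ζ‖ = ENNReal.ofReal (2 * Real.pi) * ∫⁻ ρ, ENNReal.ofReal (ρ ^ 2) * F ρ ∂mulHaar := by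
  have hm : Measurable fun ρ => ENNReal.ofReal (ρ ^ 2) * F ρ := by fun_prop
  rw [← Complex.lintegral_comp_polarCoord_symm, lintegral_mulHaar hm]
  have h1 : ∀ p ∈ polarCoord.target, ENNReal.ofReal p.1 • F ‖Complex.polarCoord.symm p‖ =
      ENNReal.ofReal p.1 * F p.1 := by
    intro p hp
    have : 0 < p.1 := hp.1
    rw [Complex.norm_polarCoord_symm, abs_of_pos this, smul_eq_mul]
  rw [setLIntegral_congr_fun polarCoord.open_target.measurableSet h1, polarCoord_target,
    Measure.volume_eq_prod, ← Measure.prod_restrict,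
    lintegral_prod _ (by fun_prop)]
  simp only [lintegral_const, Measure.restrict_apply_univ, Real.volume_Ioo]
  rw [lintegral_mul_const _ (by fun_prop), mul_comm, sub_neg_eq_add, ← two_mul]
  congr 1
  refine setLIntegral_congr_fun measurableSet_Ioi fun ρ hρ => ?_
  have hρ' : 0 < ρ := hρ
  rw [← mul_assoc, ← ENNReal.ofReal_mul (by positivity)]
  congr 2; field_simp

/-- The measure `y⁻¹ |𝐖₂(y)|² dy^×`. -/
noncomputable def whittakerMeasure (k : ℕ) : Measure ℝ :=
  mulHaar.withDensity fun y => ENNReal.ofReal y⁻¹ * ‖boldW k y‖ₑ ^ 2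

theorem measurable_whittakerDensity (k : ℕ) :
    Measurable fun y : ℝ => ENNReal.ofReal y⁻¹ * ‖boldW k y‖ₑ ^ 2 :=
  Measurable.mul (by fun_prop) (measurable_enorm_boldW_sq k)

instance (k : ℕ) : IsFiniteMeasure (whittakerMeasure k) := by
  refine isFiniteMeasure_withDensity (ne_of_lt ?_)
  refine lt_of_eq_of_lt (lintegral_congr_ae ?_) (integrable_integrandT2 k 0).2
  filter_upwards [ae_mulHaar_pos] with y hy
  have : ‖integrandT2 k 0 y‖ = y⁻¹ * ‖boldW k y‖ ^ 2 := by
    unfold integrandT2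
    rw [norm_mul, norm_mul, Complex.norm_cpow_eq_rpow_re_of_pos hy, Complex.norm_real, Complex.norm_real,
      Real.norm_of_nonneg (by positivity), Real.norm_of_nonneg (by positivity)]
    simp
    field_simp
  rw [← ofReal_norm (integrandT2 k 0 y), this, enorm_sq_eq_ofReal, ENNReal.ofReal_mul (by positivity)]

/-- The sum of the squared `L²` norms of the Fourier transforms of all matrix coefficients of the
minimal `K`-type along the horosphere of height `y`, up to the factor `π⁻²` of
`sum_lintegral_crossCoeff`; see `sum_lintegral_vecKernel`. -/
noncomputable def kernelEnergy (k : ℕ) (y : ℝ) : ENNReal :=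
  ENNReal.ofReal (planchConst k ^ 2 * (Real.pi / 2)) *
    ∫⁻ t, ENNReal.ofReal (t ^ 2)⁻¹ * (‖boldW k (y * t)‖ₑ ^ 2 * ‖boldW k t‖ₑ ^ 2) ∂mulHaar

theorem measurable_kernelEnergy_integrand (k : ℕ) : Measurable fun p : ℝ × ℝ =>
    ENNReal.ofReal (p.2 ^ 2)⁻¹ * (‖boldW k (p.1 * p.2)‖ₑ ^ 2 * ‖boldW k p.2‖ₑ ^ 2) := by
  have h := measurable_enorm_boldW_sq k
  have h1 : Measurable fun p : ℝ × ℝ => ‖boldW k (p.1 * p.2)‖ₑ ^ 2 := h.comp (by fun_prop)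
  have h2 : Measurable fun p : ℝ × ℝ => ‖boldW k p.2‖ₑ ^ 2 := h.comp (by fun_prop)
  exact Measurable.mul (by fun_prop) (h1.mul h2)

theorem measurable_kernelEnergy (k : ℕ) : Measurable (kernelEnergy k) :=
  (measurable_kernelEnergy_integrand k).lintegral_prod_right'.const_mul _

/-- Summed over the weights, the squares of `vecKernel` combine to the norms of `boldW`. -/
theorem sum_lintegral_vecKernel (k : ℕ) {y : ℝ} (hy : 0 < y) :
    ∑ i : Fin (k + 1), ∑ j : Fin (k + 1), ∫⁻ ζ, ‖vecKernel k j y ζ * conj (vecKernel k i 1 ζ)‖ₑ ^ 2 =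
      kernelEnergy k y := by
  have hW := measurable_enorm_boldW_sq k
  have hWj (j : Fin (k + 1)) : Measurable fun y => ‖boldW k y j‖ₑ ^ 2 :=
    (measurable_boldW_apply k j).enorm.pow_const 2
  have hc (z : ℂ) : ‖conj z‖ₑ = ‖z‖ₑ := by rw [← ofReal_norm, RCLike.norm_conj, ofReal_norm]
  have hP := planchConst_pos k
  set G : Fin (k + 1) → Fin (k + 1) → ℝ → ENNReal := fun i j ρ =>
    ENNReal.ofReal (planchConst k ^ 2 / ρ ^ 4) *
      (‖boldW k (y * (ρ / 2)) j‖ₑ ^ 2 * ‖boldW k (ρ / 2) i‖ₑ ^ 2) with hG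
  have hGm (i j : Fin (k + 1)) : Measurable (G i j) := by
    have h1 : Measurable fun ρ : ℝ => ‖boldW k (y * (ρ / 2)) j‖ₑ ^ 2 := (hWj j).comp (by fun_prop)
    have h2 : Measurable fun ρ : ℝ => ‖boldW k (ρ / 2) i‖ₑ ^ 2 := (hWj i).comp (by fun_prop)
    exact Measurable.mul (by fun_prop) (h1.mul h2)
  have h1 (i j : Fin (k + 1)) : ∫⁻ ζ, ‖vecKernel k j y ζ * conj (vecKernel k i 1 ζ)‖ₑ ^ 2 =
      ENNReal.ofReal (2 * Real.pi) * ∫⁻ ρ, ENNReal.ofReal (ρ ^ 2) * G i j ρ ∂mulHaar := by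
    rw [← lintegral_complex_norm (hGm i j)]
    refine lintegral_congr_ae ?_
    filter_upwards [ae_ne_zero_complex] with ζ hζ
    have hζ' : 0 < ‖ζ‖ := norm_pos_iff.2 hζ
    simp only [hG]
    rw [enorm_mul, mul_pow, hc, enorm_vecKernel_sq k j hy hζ, enorm_vecKernel_sq k i one_pos hζ, one_mul,
      mul_mul_mul_comm, ← ENNReal.ofReal_mul (by positivity)]
    congr 2
    ring
  have hGm' (i j : Fin (k + 1)) : Measurable fun ρ : ℝ => ENNReal.ofReal (ρ ^ 2) * G i j ρ :=
    Measurable.mul (by fun_prop) (hGm i j)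
  simp only [h1, ← Finset.mul_sum]
  simp only [← lintegral_finsetSum' _ fun j _ => (hGm' _ j).aemeasurable]
  rw [← lintegral_finsetSum' _ fun i _ =>
    (Finset.measurable_fun_sum Finset.univ fun j _ => hGm' i j).aemeasurable]
  have hm : Measurable fun ρ : ℝ => ∑ i, ∑ j, ENNReal.ofReal (ρ ^ 2) * G i j ρ :=
    Finset.measurable_fun_sum _ fun i _ => Finset.measurable_fun_sum Finset.univ fun j _ => hGm' i j
  rw [← lintegral_mulHaar_mul_left hm two_pos, kernelEnergy]
  have h2 : ENNReal.ofReal (planchConst k ^ 2 * (Real.pi / 2)) =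
      ENNReal.ofReal (2 * Real.pi) * ENNReal.ofReal (planchConst k ^ 2 / 4) := by
    rw [← ENNReal.ofReal_mul (by positivity)]; congr 1; ring
  have hm2 : Measurable fun t : ℝ => ENNReal.ofReal (t ^ 2)⁻¹ *
      (‖boldW k (y * t)‖ₑ ^ 2 * ‖boldW k t‖ₑ ^ 2) :=
    (measurable_kernelEnergy_integrand k).comp (by fun_prop : Measurable fun t : ℝ => (y, t))
  rw [h2, mul_assoc, ← lintegral_const_mul _ hm2]
  congr 1
  refine lintegral_congr_ae ?_
  filter_upwards [ae_mulHaar_pos] with t ht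
  simp only [hG, ← Finset.mul_sum, mul_div_cancel_left₀ t (two_ne_zero' ℝ)]
  rw [← mul_assoc, ← ENNReal.ofReal_mul (by positivity), ← mul_assoc, ← ENNReal.ofReal_mul (by positivity),
    enorm_boldW_sq k (y * t), enorm_boldW_sq k t, Finset.sum_mul_sum, Finset.sum_comm]
  congr 2
  field_simp
  ring

/-! ### The integral of matrix coefficients -/

theorem lintegral_whittakerMeasure (k : ℕ) {h : ℝ → ENNReal} (hh : Measurable h) :
    ∫⁻ y, h y ∂whittakerMeasure k =
      ∫⁻ y, ENNReal.ofReal y⁻¹ * ‖boldW k y‖ₑ ^ 2 * h y ∂mulHaar := by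
  rw [whittakerMeasure, lintegral_withDensity_eq_lintegral_mul _ (measurable_whittakerDensity k) hh]
  rfl

/-- The substitution of `y / t` for `y` turns the convolution in `kernelEnergy` into a double integral
against `whittakerMeasure`. -/
theorem lintegral_mul_kernelEnergy (k : ℕ) {h : ℝ → ENNReal} (hh : Measurable h) :
    ∫⁻ y, h y * (ENNReal.ofReal y⁻¹ * kernelEnergy k y) ∂mulHaar =
      ENNReal.ofReal (planchConst k ^ 2 * (Real.pi / 2)) *
        ∫⁻ t, ∫⁻ y, h (y / t) ∂whittakerMeasure k ∂whittakerMeasure k := by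
  have hW := measurable_enorm_boldW_sq k
  have hmI : Measurable fun p : ℝ × ℝ => h (p.1 / p.2) := hh.comp (by fun_prop)
  have hm1 : Measurable fun t : ℝ => ∫⁻ y, h (y / t) ∂whittakerMeasure k :=
    Measurable.lintegral_prod_left' (f := fun p : ℝ × ℝ => h (p.1 / p.2)) hmI
  have hm2 : Measurable fun p : ℝ × ℝ => h p.1 * (ENNReal.ofReal p.1⁻¹ *
      (ENNReal.ofReal (p.2 ^ 2)⁻¹ * (‖boldW k (p.1 * p.2)‖ₑ ^ 2 * ‖boldW k p.2‖ₑ ^ 2))) :=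
    (hh.comp measurable_fst).mul (Measurable.mul (by fun_prop) (measurable_kernelEnergy_integrand k))
  have hm3 (y : ℝ) : Measurable fun t : ℝ => ENNReal.ofReal (t ^ 2)⁻¹ *
      (‖boldW k (y * t)‖ₑ ^ 2 * ‖boldW k t‖ₑ ^ 2) :=
    (measurable_kernelEnergy_integrand k).comp (by fun_prop : Measurable fun t : ℝ => (y, t))
  have e1 (y : ℝ) : h y * (ENNReal.ofReal y⁻¹ * kernelEnergy k y) =
      ENNReal.ofReal (planchConst k ^ 2 * (Real.pi / 2)) * ∫⁻ t, h y * (ENNReal.ofReal y⁻¹ *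
        (ENNReal.ofReal (t ^ 2)⁻¹ * (‖boldW k (y * t)‖ₑ ^ 2 * ‖boldW k t‖ₑ ^ 2))) ∂mulHaar := by
    rw [lintegral_const_mul _ ((hm3 y).const_mul _), lintegral_const_mul _ (hm3 y), kernelEnergy]
    ring
  simp only [e1]
  rw [lintegral_const_mul _ (Measurable.lintegral_prod_right' hm2),
    lintegral_lintegral_swap hm2.aemeasurable, lintegral_whittakerMeasure k hm1]
  congr 1
  refine lintegral_congr_ae ?_
  filter_upwards [ae_mulHaar_pos] with t ht
  have hmt : Measurable fun y : ℝ => h (y / t) := hh.comp (by fun_prop)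
  have hmy : Measurable fun y : ℝ => h (y / t) * (ENNReal.ofReal (y / t)⁻¹ *
      (ENNReal.ofReal (t ^ 2)⁻¹ * (‖boldW k y‖ₑ ^ 2 * ‖boldW k t‖ₑ ^ 2))) :=
    hmt.mul (Measurable.mul (by fun_prop) ((hW.mul_const _).const_mul _))
  have hmw : Measurable fun y : ℝ => ENNReal.ofReal y⁻¹ * ‖boldW k y‖ₑ ^ 2 * h (y / t) :=
    (measurable_whittakerDensity k).mul hmt
  rw [lintegral_whittakerMeasure k hmt, ← lintegral_const_mul _ hmw]
  have h4 := lintegral_mulHaar_mul_left hmy ht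
  simp only [mul_div_cancel_left₀ _ ht.ne'] at h4
  simp only [mul_comm _ t]
  rw [h4]
  refine lintegral_congr_ae ?_
  filter_upwards [ae_mulHaar_pos] with y hy
  have h5 : ENNReal.ofReal (y / t)⁻¹ * ENNReal.ofReal (t ^ 2)⁻¹ =
      ENNReal.ofReal t⁻¹ * ENNReal.ofReal y⁻¹ := by
    rw [← ENNReal.ofReal_mul (by positivity), ← ENNReal.ofReal_mul (by positivity)]
    congr 1; field_simp
  rw [← mul_assoc (ENNReal.ofReal (y / t)⁻¹), h5]
  ring

theorem ae_kernelEnergy_lt_top (k : ℕ) : ∀ᵐ y ∂mulHaar, kernelEnergy k y < ⊤ := by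
  have h := lintegral_mul_kernelEnergy k (h := fun _ => 1) measurable_const
  have hf : ∫⁻ y, (1 : ENNReal) * (ENNReal.ofReal y⁻¹ * kernelEnergy k y) ∂mulHaar ≠ ⊤ := by
    rw [h]
    simp only [lintegral_const, one_mul]
    exact ENNReal.mul_ne_top ENNReal.ofReal_ne_top
      (ENNReal.mul_ne_top (measure_ne_top _ _) (measure_ne_top _ _))
  have hm : Measurable fun y : ℝ => (1 : ENNReal) * (ENNReal.ofReal y⁻¹ * kernelEnergy k y) :=
    Measurable.const_mul (Measurable.mul (by fun_prop) (measurable_kernelEnergy k)) _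
  filter_upwards [ae_lt_top hm hf, ae_mulHaar_pos] with y h1 hy
  rw [one_mul] at h1
  have h0 : ENNReal.ofReal y⁻¹ ≠ 0 := by
    rw [ne_eq, ENNReal.ofReal_eq_zero, not_le]; positivity
  by_contra htop
  rw [not_lt, top_le_iff] at htop
  rw [htop, ENNReal.mul_top h0] at h1
  exact lt_irrefl _ h1

/-- Plancherel's theorem along horospheres. -/
theorem sum_lintegral_crossCoeff (k : ℕ) {y : ℝ} (hy : 0 < y) (hfin : kernelEnergy k y < ⊤) :
    ∑ i, ∑ j, ∫⁻ x, ‖crossCoeff k i j (borelElt (x, y))‖ₑ ^ 2 =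
      ENNReal.ofReal (Real.pi⁻¹ ^ 2) * kernelEnergy k y := by
  rw [← sum_lintegral_vecKernel k hy, Finset.mul_sum]
  refine Finset.sum_congr rfl fun i _ => ?_
  rw [Finset.mul_sum]
  refine Finset.sum_congr rfl fun j _ => ?_
  have hpi : ‖(Real.pi : ℂ)⁻¹‖ₑ ^ 2 = ENNReal.ofReal (Real.pi⁻¹ ^ 2) := by
    rw [enorm_sq_eq_ofReal, norm_inv, Complex.norm_real, Real.norm_of_nonneg Real.pi_pos.le]
  have hstar : MemLp (fun ζ => conj (vecKernel k i 1 ζ)) 2 :=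
    (memLp_vecKernel k i one_pos).star
  have h1 : Integrable fun ζ => vecKernel k j y ζ * conj (vecKernel k i 1 ζ) :=
    (memLp_vecKernel k j hy).integrable_mul hstar
  have h2 : MemLp (fun ζ => vecKernel k j y ζ * conj (vecKernel k i 1 ζ)) 2 := by
    refine ⟨h1.1, ?_⟩
    rw [eLpNorm_lt_top_iff_lintegral_rpow_enorm_lt_top (by norm_num) (by norm_num)]
    simp only [ENNReal.toReal_ofNat, ENNReal.rpow_ofNat]
    refine lt_of_le_of_lt ?_ hfin
    rw [← sum_lintegral_vecKernel k hy]
    refine le_trans ?_ (Finset.single_le_sum (f := fun i : Fin (k + 1) => ∑ j : Fin (k + 1),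
      ∫⁻ ζ, ‖vecKernel k j y ζ * conj (vecKernel k i 1 ζ)‖ₑ ^ 2)
      (fun i _ => zero_le) (Finset.mem_univ i))
    exact Finset.single_le_sum (f := fun j : Fin (k + 1) =>
      ∫⁻ ζ, ‖vecKernel k j y ζ * conj (vecKernel k i 1 ζ)‖ₑ ^ 2)
      (fun i _ => zero_le) (Finset.mem_univ j)
  simp only [crossCoeff_borelElt k _ _ _ hy, enorm_mul ((Real.pi : ℂ)⁻¹), mul_pow, hpi]
  rw [lintegral_const_mul' _ _ ENNReal.ofReal_ne_top, lintegral_enorm_fourierInv_sq h1 h2]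

instance : SFinite haarG := by unfold haarG; infer_instance

/-- The square of a matrix coefficient, integrated over `Ḡ` against a function of the height averaged
over `K`.  The invariance of the measure under `K` from both sides and the orthogonality relations
replace the square by the mean of the squares of all matrix coefficients of the minimal `K`-type. -/
theorem lintegral_crossCoeff_mul_height (k : ℕ) {H : ℝ → ENNReal} (hH : Measurable H) :
    ∫⁻ p, ∫⁻ κ, ‖crossCoeff k 0 0 (ofCoords p)‖ₑ ^ 2 * H (height (toSL κ * ofCoords p))
        ∂haarK ∂haarG =
      ENNReal.ofReal ((((k : ℝ) + 1)⁻¹ * Real.pi⁻¹) ^ 2) *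
        ∫⁻ y, ENNReal.ofReal (y ^ 2)⁻¹ * (H y * kernelEnergy k y) ∂mulHaar := by
  have hΦ (i j : Fin (k + 1)) : Measurable fun g => ‖crossCoeff k i j g‖ₑ ^ 2 :=
    (measurable_crossCoeff k i j).enorm.pow_const 2
  have hHh : Measurable fun g : SL2 => H (height g) := hH.comp continuous_height.measurable
  have hmul : Measurable fun q : (ℂ × ℝ × SU2) × SU2 => toSL q.2 * ofCoords q.1 :=
    (continuous_toSL.measurable.comp measurable_snd).mul (measurable_ofCoords.comp measurable_fst)
  have hmul' : Measurable fun q : (ℂ × ℝ × SU2) × SU2 => toSL q.2⁻¹ * ofCoords q.1 :=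
    (continuous_toSL.measurable.comp measurable_snd.inv).mul (measurable_ofCoords.comp measurable_fst)
  have hfst : Measurable fun q : (ℂ × ℝ × SU2) × SU2 => ofCoords q.1 :=
    measurable_ofCoords.comp measurable_fst
  have hm1 : Measurable fun q : (ℂ × ℝ × SU2) × SU2 =>
      ‖crossCoeff k 0 0 (ofCoords q.1)‖ₑ ^ 2 * H (height (toSL q.2 * ofCoords q.1)) :=
    ((hΦ 0 0).comp hfst).mul (hHh.comp hmul)
  have hm2 : Measurable fun q : (ℂ × ℝ × SU2) × SU2 =>
      ‖crossCoeff k 0 0 (toSL q.2⁻¹ * ofCoords q.1)‖ₑ ^ 2 * H (height (ofCoords q.1)) :=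
    ((hΦ 0 0).comp hmul').mul (hHh.comp hfst)
  rw [lintegral_lintegral_swap hm1.aemeasurable]
  -- The translation by `κ` moves from the height to the matrix coefficient.
  have s1 (κ : SU2) : ∫⁻ p, ‖crossCoeff k 0 0 (ofCoords p)‖ₑ ^ 2 * H (height (toSL κ * ofCoords p)) ∂haarG =
      ∫⁻ p, ‖crossCoeff k 0 0 (toSL κ⁻¹ * ofCoords p)‖ₑ ^ 2 * H (height (ofCoords p)) ∂haarG := by
    have hF : Measurable fun g => ‖crossCoeff k 0 0 (toSL κ⁻¹ * g)‖ₑ ^ 2 * H (height g) :=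
      ((hΦ 0 0).comp (measurable_const_mul _)).mul hHh
    rw [← lintegral_haarG_mul_left (toSL κ) hF]
    have hinv : toSL κ⁻¹ * toSL κ = 1 := by
      rw [← toSL_mul, inv_mul_cancel]; rfl
    simp only [← mul_assoc, hinv, one_mul]
  simp only [s1]
  rw [← lintegral_lintegral_swap hm2.aemeasurable]
  -- Averaging over left translations sums over the row index of the matrix coefficients.
  have s2 (p : ℂ × ℝ × SU2) : ∫⁻ κ, ‖crossCoeff k 0 0 (toSL κ⁻¹ * ofCoords p)‖ₑ ^ 2 *
      H (height (ofCoords p)) ∂haarK = ENNReal.ofReal ((k : ℝ) + 1)⁻¹ *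
        (H (height (ofCoords p)) * ∑ i, ‖crossCoeff k i 0 (ofCoords p)‖ₑ ^ 2) := by
    have hm : Measurable fun κ : SU2 => ‖crossCoeff k 0 0 (toSL κ⁻¹ * ofCoords p)‖ₑ ^ 2 :=
      (hΦ 0 0).comp ((continuous_toSL.measurable.comp measurable_inv).mul_const _)
    rw [lintegral_mul_const _ hm]
    simp only [crossCoeff_toSL_inv_mul]
    rw [lintegral_enorm_sum_conj_rho]
    ring
  simp only [s2]
  have hm3 : Measurable fun g : SL2 => H (height g) * ∑ i, ‖crossCoeff k i 0 g‖ₑ ^ 2 :=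
    hHh.mul (Finset.measurable_fun_sum _ fun i _ => hΦ i 0)
  have hm4 : Measurable fun q : ℂ × ℝ => H (height (borelElt q)) *
      ∑ i, ∑ j, ‖crossCoeff k i j (borelElt q)‖ₑ ^ 2 :=
    (hHh.mul (Finset.measurable_fun_sum _ fun i _ => Finset.measurable_fun_sum Finset.univ fun j _ =>
      hΦ i j)).comp measurable_borelElt
  have hm3' : Measurable fun p => H (height (ofCoords p)) * ∑ i, ‖crossCoeff k i 0 (ofCoords p)‖ₑ ^ 2 :=
    hm3.comp measurable_ofCoords
  rw [lintegral_const_mul _ hm3', lintegral_haarG hm3']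
  -- The component `κ` of the coordinates sums over the column index.
  have s3 (q : ℂ × ℝ) : ∫⁻ κ, H (height (ofCoords (q.1, q.2, κ))) *
      ∑ i, ‖crossCoeff k i 0 (ofCoords (q.1, q.2, κ))‖ₑ ^ 2 ∂haarK = ENNReal.ofReal ((k : ℝ) + 1)⁻¹ *
        (H (height (borelElt q)) * ∑ i, ∑ j, ‖crossCoeff k i j (borelElt q)‖ₑ ^ 2) := by
    have hm (i : Fin (k + 1)) : Measurable fun κ : SU2 => ‖crossCoeff k i 0 (borelElt q * toSL κ)‖ₑ ^ 2 :=
      (hΦ i 0).comp (continuous_toSL.measurable.const_mul _)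
    simp only [ofCoords_eq, height_mul_toSL]
    rw [lintegral_const_mul _ (Finset.measurable_fun_sum _ fun i _ => hm i),
      lintegral_finsetSum _ fun i _ => hm i]
    simp only [crossCoeff_mul_toSL, lintegral_enorm_sum_rho]
    rw [← Finset.mul_sum]
    ring
  simp only [s3]
  rw [lintegral_const_mul _ hm4, hypMeasure, lintegral_prod_symm _ hm4.aemeasurable,
    lintegral_withDensity_eq_lintegral_mul _ (by fun_prop) hm4.lintegral_prod_left']
  have hc : ENNReal.ofReal ((((k : ℝ) + 1)⁻¹ * Real.pi⁻¹) ^ 2) = ENNReal.ofReal ((k : ℝ) + 1)⁻¹ *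
      (ENNReal.ofReal ((k : ℝ) + 1)⁻¹ * ENNReal.ofReal (Real.pi⁻¹ ^ 2)) := by
    rw [← ENNReal.ofReal_mul (by positivity), ← ENNReal.ofReal_mul (by positivity)]
    congr 1; ring
  have hm5 : Measurable fun y : ℝ => ENNReal.ofReal (y ^ 2)⁻¹ * (H y * kernelEnergy k y) :=
    Measurable.mul (by fun_prop) (hH.mul (measurable_kernelEnergy k))
  rw [hc, mul_assoc, mul_assoc, ← lintegral_const_mul _ hm5]
  congr 2
  refine lintegral_congr_ae ?_
  filter_upwards [ae_mulHaar_pos, ae_kernelEnergy_lt_top k] with y hy hfin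
  have hm6 (i j : Fin (k + 1)) : Measurable fun x : ℂ => ‖crossCoeff k i j (borelElt (x, y))‖ₑ ^ 2 :=
    (hΦ i j).comp (measurable_borelElt.comp (by fun_prop))
  simp only [Pi.mul_apply, height_borelElt _ hy]
  rw [lintegral_const_mul _ (Finset.measurable_fun_sum _ fun i _ => Finset.measurable_fun_sum Finset.univ
    fun j _ => hm6 i j), lintegral_finsetSum _ fun i _ => Finset.measurable_fun_sum Finset.univ fun j _ => hm6 i j]
  simp only [lintegral_finsetSum _ fun j _ => hm6 _ j]
  rw [sum_lintegral_crossCoeff k hy hfin]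
  ring

/-! ### The distribution of the height -/

/-- The constant of `tripleT2`. -/
noncomputable def tripleConst (k : ℕ) : ℝ :=
  32 * Real.pi ^ 2 * ((2 * Real.pi) ^ k / Real.Gamma ((k : ℝ) / 2 + 1) ^ 2)

theorem planchConst_eq (k : ℕ) : planchConst k = tripleConst k * ((k : ℝ) + 1) / 2 := by
  unfold planchConst tripleConst
  rw [add_comm (1 : ℝ)]
  ring

/-- The density of the integral of matrix coefficients over `Ḡ × K`. -/
noncomputable def coeffDensity (k : ℕ) (q : (ℂ × ℝ × SU2) × SU2) : ENNReal :=
  ‖crossCoeff k 0 0 (ofCoords q.1)‖ₑ ^ 2 * ENNReal.ofReal (height (toSL q.2 * ofCoords q.1))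

theorem measurable_height_mul :
    Measurable fun q : (ℂ × ℝ × SU2) × SU2 => height (toSL q.2 * ofCoords q.1) :=
  continuous_height.measurable.comp
    ((continuous_toSL.measurable.comp measurable_snd).mul (measurable_ofCoords.comp measurable_fst))

theorem measurable_crossCoeff_ofCoords (k : ℕ) :
    Measurable fun q : (ℂ × ℝ × SU2) × SU2 => crossCoeff k 0 0 (ofCoords q.1) :=
  (measurable_crossCoeff k 0 0).comp (measurable_ofCoords.comp measurable_fst)

theorem measurable_coeffDensity (k : ℕ) : Measurable (coeffDensity k) :=
  ((measurable_crossCoeff_ofCoords k).enorm.pow_const 2).mul measurable_height_mul.ennreal_ofReal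

/-- The law of the height, tested on nonnegative functions. -/
theorem lintegral_coeffDensity_mul (k : ℕ) {h : ℝ → ENNReal} (hh : Measurable h) :
    ∫⁻ q, coeffDensity k q * h (height (toSL q.2 * ofCoords q.1)) ∂(haarG.prod haarK) =
      ENNReal.ofReal (tripleConst k ^ 2 / (8 * Real.pi)) *
        ∫⁻ t, ∫⁻ y, h (y / t) ∂whittakerMeasure k ∂whittakerMeasure k := by
  have hm : Measurable fun q : (ℂ × ℝ × SU2) × SU2 =>
      coeffDensity k q * h (height (toSL q.2 * ofCoords q.1)) :=
    (measurable_coeffDensity k).mul (hh.comp measurable_height_mul)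
  have hH : Measurable fun y : ℝ => ENNReal.ofReal y * h y := by fun_prop
  rw [lintegral_prod _ hm.aemeasurable]
  simp only [coeffDensity, mul_assoc]
  rw [lintegral_crossCoeff_mul_height k hH]
  have h1 : ∫⁻ y, ENNReal.ofReal (y ^ 2)⁻¹ * (ENNReal.ofReal y * h y * kernelEnergy k y) ∂mulHaar =
      ∫⁻ y, h y * (ENNReal.ofReal y⁻¹ * kernelEnergy k y) ∂mulHaar := by
    refine lintegral_congr_ae ?_
    filter_upwards [ae_mulHaar_pos] with y hy
    have : ENNReal.ofReal y⁻¹ = ENNReal.ofReal (y ^ 2)⁻¹ * ENNReal.ofReal y := by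
      rw [← ENNReal.ofReal_mul (by positivity)]; congr 1; field_simp
    rw [this]; ring
  rw [h1, lintegral_mul_kernelEnergy k hh, ← mul_assoc, ← ENNReal.ofReal_mul (by positivity)]
  congr 2
  rw [planchConst_eq]
  field_simp
  norm_num

theorem ae_whittakerMeasure_pos (k : ℕ) : ∀ᵐ y ∂whittakerMeasure k, 0 < y :=
  (withDensity_absolutelyContinuous _ _).ae_le ae_mulHaar_pos

/-- The law of the height under `coeffDensity` is the law of the quotient of two independent variables
distributed like `whittakerMeasure`. -/
theorem map_height_eq (k : ℕ) :
    ((haarG.prod haarK).withDensity (coeffDensity k)).map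
        (fun q => height (toSL q.2 * ofCoords q.1)) =
      ENNReal.ofReal (tripleConst k ^ 2 / (8 * Real.pi)) •
        ((whittakerMeasure k).prod (whittakerMeasure k)).map fun q => q.2 / q.1 := by
  have hdiv : Measurable fun q : ℝ × ℝ => q.2 / q.1 := by fun_prop
  refine Measure.ext_of_lintegral _ fun h hh => ?_
  have h1 : Measurable fun q : ℝ × ℝ => h (q.2 / q.1) := hh.comp hdiv
  have h2 : Measurable fun q : (ℂ × ℝ × SU2) × SU2 => h (height (toSL q.2 * ofCoords q.1)) :=
    hh.comp measurable_height_mul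
  rw [lintegral_map hh measurable_height_mul, lintegral_smul_measure, lintegral_map hh hdiv,
    lintegral_prod _ h1.aemeasurable,
    lintegral_withDensity_eq_lintegral_mul _ (measurable_coeffDensity k) h2]
  exact lintegral_coeffDensity_mul k hh

theorem toReal_coeffDensity (k : ℕ) (q : (ℂ × ℝ × SU2) × SU2) : (coeffDensity k q).toReal =
    ‖crossCoeff k 0 0 (ofCoords q.1)‖ ^ 2 * height (toSL q.2 * ofCoords q.1) := by
  rw [coeffDensity, enorm_sq_eq_ofReal, ← ENNReal.ofReal_mul (by positivity), ENNReal.toReal_ofReal]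
  have := height_pos (toSL q.2 * ofCoords q.1)
  positivity

theorem measurable_cpow_I_mul (r : ℝ) : Measurable fun y : ℝ => (y : ℂ) ^ (Complex.I * r) := by
  fun_prop

theorem cpow_one_add {y : ℝ} (hy : 0 < y) (s : ℂ) : (y : ℂ) ^ (1 + s) = y * (y : ℂ) ^ s := by
  rw [Complex.cpow_add _ _ (by exact_mod_cast hy.ne'), Complex.cpow_one]

theorem integral_whittakerMeasure_cpow (k : ℕ) (r : ℝ) :
    ∫ y : ℝ, (y : ℂ) ^ (Complex.I * r) ∂whittakerMeasure k = ∫ y, integrandT2 k r y ∂mulHaar := by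
  have hd (y : ℝ) : ENNReal.ofReal y⁻¹ * ‖boldW k y‖ₑ ^ 2 < ⊤ :=
    ENNReal.mul_lt_top ENNReal.ofReal_lt_top (by rw [enorm_sq_eq_ofReal]; exact ENNReal.ofReal_lt_top)
  rw [whittakerMeasure, integral_withDensity_eq_integral_toReal_smul (measurable_whittakerDensity k)
    (ae_of_all _ hd)]
  refine integral_congr_ae ?_
  filter_upwards [ae_mulHaar_pos] with y hy
  have hy0 : (y : ℂ) ≠ 0 := by exact_mod_cast hy.ne'
  rw [enorm_sq_eq_ofReal, ← ENNReal.ofReal_mul (by positivity), ENNReal.toReal_ofReal (by positivity),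
    integrandT2, cpow_one_add hy, Complex.real_smul]
  push_cast
  field_simp

/-- The integrand of `tripleS` before the integration over `K` that produces the spherical
function. -/
noncomputable def coeffIntegrand (k : ℕ) (r : ℝ) (q : (ℂ × ℝ × SU2) × SU2) : ℂ :=
  ((‖crossCoeff k 0 0 (ofCoords q.1)‖ ^ 2 : ℝ) : ℂ) *
    (height (toSL q.2 * ofCoords q.1) : ℂ) ^ (1 + Complex.I * r)

theorem coeffIntegrand_eq_smul (k : ℕ) (r : ℝ) (q : (ℂ × ℝ × SU2) × SU2) :
    coeffIntegrand k r q =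
      (coeffDensity k q).toReal • (height (toSL q.2 * ofCoords q.1) : ℂ) ^ (Complex.I * r) := by
  rw [coeffIntegrand, cpow_one_add (height_pos _), toReal_coeffDensity, Complex.real_smul]
  push_cast; ring

theorem coeffDensity_lt_top (k : ℕ) (q : (ℂ × ℝ × SU2) × SU2) : coeffDensity k q < ⊤ :=
  ENNReal.mul_lt_top (by rw [enorm_sq_eq_ofReal]; exact ENNReal.ofReal_lt_top) ENNReal.ofReal_lt_top

theorem integrable_coeffIntegrand (k : ℕ) (r : ℝ) :
    Integrable (coeffIntegrand k r) (haarG.prod haarK) := by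
  have hm : Measurable (coeffIntegrand k r) := by
    rw [funext (coeffIntegrand_eq_smul k r)]
    exact (measurable_coeffDensity k).ennreal_toReal.smul
      ((measurable_cpow_I_mul r).comp measurable_height_mul)
  refine ⟨hm.aestronglyMeasurable, ?_⟩
  have h := lintegral_coeffDensity_mul k (h := fun _ => 1) measurable_const
  simp only [mul_one, lintegral_const, one_mul] at h
  refine lt_of_eq_of_lt (lintegral_congr fun q => ?_) (lt_of_eq_of_lt h ?_)
  · have hh := height_pos (toSL q.2 * ofCoords q.1)
    rw [coeffIntegrand_eq_smul, enorm_smul, ← ofReal_norm ((height _ : ℂ) ^ _),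
      Complex.norm_cpow_eq_rpow_re_of_pos hh, Real.enorm_of_nonneg ENNReal.toReal_nonneg,
      ENNReal.ofReal_toReal (coeffDensity_lt_top k q).ne]
    simp
  · exact ENNReal.mul_lt_top ENNReal.ofReal_lt_top
      (ENNReal.mul_lt_top (measure_lt_top _ _) (measure_lt_top _ _))

theorem integral_coeffIntegrand (k : ℕ) (r : ℝ) : ∫ q, coeffIntegrand k r q ∂(haarG.prod haarK) =
    ((tripleConst k ^ 2 / (8 * Real.pi) * ‖∫ y, integrandT2 k r y ∂mulHaar‖ ^ 2 : ℝ) : ℂ) := by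
  have hdiv : Measurable fun q : ℝ × ℝ => q.2 / q.1 := by fun_prop
  have hφ := measurable_cpow_I_mul r
  have hC : 0 ≤ tripleConst k ^ 2 / (8 * Real.pi) := by positivity
  simp only [coeffIntegrand_eq_smul]
  rw [← integral_withDensity_eq_integral_toReal_smul (measurable_coeffDensity k)
      (ae_of_all _ (coeffDensity_lt_top k)),
    ← integral_map (φ := fun q : (ℂ × ℝ × SU2) × SU2 => height (toSL q.2 * ofCoords q.1))
      (f := fun y : ℝ => (y : ℂ) ^ (Complex.I * r)) measurable_height_mul.aemeasurable
      hφ.aestronglyMeasurable, map_height_eq, integral_smul_measure,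
    integral_map hdiv.aemeasurable hφ.aestronglyMeasurable, ENNReal.toReal_ofReal hC]
  have h1 : (fun q : ℝ × ℝ => ((q.2 / q.1 : ℝ) : ℂ) ^ (Complex.I * r))
      =ᵐ[(whittakerMeasure k).prod (whittakerMeasure k)]
      fun q => conj ((q.1 : ℂ) ^ (Complex.I * r)) * (q.2 : ℂ) ^ (Complex.I * r) := by
    have hp1 := Measure.quasiMeasurePreserving_fst (μ := whittakerMeasure k) (ν := whittakerMeasure k)
      |>.ae (ae_whittakerMeasure_pos k)
    have hp2 := Measure.quasiMeasurePreserving_snd (μ := whittakerMeasure k) (ν := whittakerMeasure k)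
      |>.ae (ae_whittakerMeasure_pos k)
    filter_upwards [hp1, hp2] with q h1 h2
    rw [ofReal_cpow_eq_exp (div_pos h2 h1), ofReal_cpow_eq_exp h1, ofReal_cpow_eq_exp h2,
      ← Complex.exp_conj, ← Complex.exp_add, Real.log_div h2.ne' h1.ne']
    congr 1
    simp only [map_mul, Complex.conj_I, Complex.conj_ofReal]
    push_cast; ring
  rw [integral_congr_ae h1, integral_prod_mul (fun y : ℝ => conj ((y : ℂ) ^ (Complex.I * r)))
    (fun y : ℝ => (y : ℂ) ^ (Complex.I * r)), integral_conj, integral_whittakerMeasure_cpow,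
    mul_comm (conj _), Complex.mul_conj, Complex.normSq_eq_norm_sq, Complex.real_smul]
  push_cast; rfl

theorem integrandS_eq_integral (k : ℕ) (r : ℝ) (p : ℂ × ℝ × SU2) :
    integrandS k r p = ∫ κ, coeffIntegrand k r (p, κ) ∂haarK := by
  unfold coeffIntegrand
  dsimp only
  rw [integral_const_mul, integrandS, matCoeff_inducedVec, matCoeff_inducedVec, crossCoeff_last_last,
    matCoeff_spherical, Complex.mul_conj, Complex.normSq_eq_norm_sq]

theorem integrable_integrandS (k : ℕ) (r : ℝ) : Integrable (integrandS k r) haarG := by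
  rw [funext (integrandS_eq_integral k r)]
  exact (integrable_coeffIntegrand k r).integral_prod_left

/-- The integral of matrix coefficients is the square of a Whittaker integral. -/
theorem tripleS_eq (k : ℕ) (r : ℝ) :
    tripleS k r = ((‖tripleT2 k r‖ ^ 2 / (8 * Real.pi) : ℝ) : ℂ) := by
  unfold tripleS
  simp only [integrandS_eq_integral]
  rw [← integral_prod _ (integrable_coeffIntegrand k r), integral_coeffIntegrand, tripleT2, norm_mul,
    Complex.norm_real, mul_pow, Real.norm_eq_abs, sq_abs, tripleConst]
  congr 1; ring

end TripleWeight

theorem mainTheorem3 (k : ℕ) (r' : ℝ) :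
    -- the normalised Whittaker embeddings of `u ∈ I'` and of `ρ_k ⊂ I` exist and are unique
    (∃! W₁, IsWhittakerEmbedding 0 r' W₁) ∧
    (∃! W₂, IsWhittakerEmbedding k 0 W₂) ∧
    ∀ (W₁ : Fin (0 + 1) → SL2 → ℂ) (W₂ : Fin (k + 1) → SL2 → ℂ),
      IsWhittakerEmbedding 0 r' W₁ → IsWhittakerEmbedding k 0 W₂ →
      -- the formulas for the Whittaker functions
      (∀ y : ℝ, 0 < y → ∀ κ : SU2,
        W₁ 0 (torus y * toSL κ) =
          ((4 * √2 * Real.pi * ‖Complex.Gamma (1 + Complex.I * r')‖⁻¹ * y : ℝ) : ℂ) *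
            besselK (Complex.I * r') (4 * Real.pi * y)) ∧
      (∀ y : ℝ, 0 < y → ∀ κ : SU2, ∀ j : Fin (k + 1),
        W₂ j (torus y * toSL κ) =
          ((4 * √2 * Real.pi * ((2 * Real.pi) ^ ((k : ℝ) / 2) * √(k + 1 : ℝ) /
            Real.Gamma (1 + (k : ℝ) / 2)) : ℝ) : ℂ) *
            ∑ i, rho k κ i j * conj (boldW k y i)) ∧
      -- the first integral
      Integrable (whittakerIntegrand (W₁ 0) (W₂ 0) (inducedVec k 0 0)) (mulHaar.prod haarK) ∧
      tripleT1 k W₁ W₂ = ((2 * Real.pi : ℝ) : ℂ) * gammaRatio k r' ∧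
      -- it determines the integral of matrix coefficients
      Integrable (integrandS k r') haarG ∧
      tripleS k r' = ((‖tripleT1 k W₁ W₂‖ ^ 2 / (8 * Real.pi) : ℝ) : ℂ) ∧
      -- the second integral
      Integrable (integrandT2 k r') mulHaar ∧
      Integrable (whittakerIntegrand (W₂ 0) (W₂ 0) (inducedVec 0 r' 0)) (mulHaar.prod haarK) ∧
      tripleT2 k r' = whittakerTriple (W₂ 0) (W₂ 0) (inducedVec 0 r' 0) ∧
      ‖tripleT2 k r'‖ = ‖tripleT1 k W₁ W₂‖ := by
  refine ⟨existsUnique_isWhittakerEmbedding (Or.inl rfl), existsUnique_isWhittakerEmbedding (Or.inr rfl),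
    fun W₁ W₂ h₁ h₂ => ?_⟩
  obtain ⟨hi₁, ht₁⟩ := whittakerTriple_mixed h₁ h₂
  obtain ⟨hi₂, ht₂⟩ := whittakerTriple_minimal r' h₂
  have hn : ‖tripleT2 k r'‖ = ‖tripleT1 k W₁ W₂‖ := by rw [norm_tripleT2, ht₁]
  refine ⟨fun y hy κ => ?_, fun y hy κ j => ?_, hi₁, ht₁, integrable_integrandS k r', ?_,
    integrable_integrandT2 k r', hi₂, ht₂.symm, hn⟩
  · rw [h₁.apply_spherical hy κ, whittakerNorm_zero_left]
  · rw [h₂.apply_minimal hy κ j, whittakerNorm_zero_right]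
  · rw [tripleS_eq, hn]
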